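/- **Proposition 3.1.** For a subring $\mathbb Z\subset A\subset\mathbb Q$ let $MHS^A$ be the abelian category of polarizable mixed $A$-Hodge structures $V=(V_A,\ W_\bullet\subset V_{\mathbb Q},\ F^\bullet\subset V_{\mathbb C})$, where $V_A$ is a finitely generated $A$-module, $V_{\mathbb Q}=V_A\otimes_A\mathbb Q$, $V_{\mathbb C}=V_A\otimes_A\mathbb C$, and every $Gr^W_n V_{\mathbb Q}$ with the filtration induced by $F$ is a polarizable pure $\mathbb Q$-Hodge structure of weight $n$. Let $MHS^A_{eff}\subset MHS^A$ be the full subcategory of the effective objects, that is those with $F^1=0$, and let $MHS_1^A\subset MHS^A_{eff}$ be the full subcategory of the objects with $V_A$ torsion-free whose Hodge numbers $h^{p,q}$ vanish for $(p,q)\notin\{(0,0),(0,-1),(-1,0),(-1,-1)\}$; it carries the exact structure whose exact sequences are those that are exact in $MHS^A$. For $\mathcal E=MHS^A_{eff}$ or $MHS^A_1$ let $D^b(\mathcal E)$ be the quotient of the homotopy category $K^b(\mathcal E)$ of bounded complexes by the acyclic complexes. (a) For every $A$ the functor $\overline{Tot}_A: D^b(MHS_1^A)\to D^b(MHS^A_{eff})$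 induced by the inclusion is fully faithful. (b) The inclusion $MHS_1^{\mathbb Q}\subset MHS_{eff}^{\mathbb Q}$ has an exact additive left adjoint $\overline{lalb}$, whose unit $V\to\overline{lalb}(V)$ exhibits $\overline{lalb}(V)$ as the maximal quotient of $V$ that belongs to $MHS_1^{\mathbb Q}$. The functor $\overline{Tot}_{\mathbb Q}$ has a left adjoint $\overline{LAlb}_{\mathbb Q}: D^b(MHS_{eff}^{\mathbb Q})\to D^b(MHS_1^{\mathbb Q})$; the functor $\overline{LAlb}_{\mathbb Q}$ and the unit of this adjunction are induced by applying $\overline{lalb}$ and its unit to complexes degree by degree. The functor $\overline{LAlb}_{\mathbb Q}$ is $t$-exact; in particular, for $M\in MHS^{\mathbb Q}_{eff}$ placed in degree $0$, $\overline{LAlb}_{\mathbb Q}(M)$ is isomorphic to the object $\overline{lalb}(M)$ of $MHS_1^{\mathbb Q}$ placed in degree $0$. -/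

import Mathlib

open CategoryTheory Limits
open scoped TensorProduct

universe u

namespace HodgeAlbanese

section Linear

variable {H : Type u} [AddCommGroup H] [Module ℚ H]
variable {H' : Type u} [AddCommGroup H'] [Module ℚ H']

/-- Complex conjugation `z ⊗ h ↦ conj z ⊗ h` on the complexification of a `ℚ`-vector space. -/
noncomputable def conj (H : Type u) [AddCommGroup H] [Module ℚ H] :
    (ℂ ⊗[ℚ] H) →ₛₗ[starRingEnd ℂ] (ℂ ⊗[ℚ] H) where
  toFun := LinearMap.rTensor H (Complex.conjAe.toLinearMap.restrictScalars ℚ)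
  map_add' := map_add _
  map_smul' c x := by
    induction x with
    | zero => simp
    | tmul z h => simp [TensorProduct.smul_tmul']
    | add x y hx hy => rw [smul_add, map_add, hx, hy, map_add, smul_add]

@[simp]
lemma conj_tmul (z : ℂ) (h : H) : conj H (z ⊗ₜ h) = (starRingEnd ℂ z) ⊗ₜ h := rfl

/-- The complex conjugate of a complex subspace of the complexification. -/
noncomputable def conjSubspace (S : Submodule ℂ (ℂ ⊗[ℚ] H)) : Submodule ℂ (ℂ ⊗[ℚ] H) :=
  S.comap (conj H)

lemma mem_conjSubspace {S : Submodule ℂ (ℂ ⊗[ℚ] H)} {x : ℂ ⊗[ℚ] H} :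
    x ∈ conjSubspace S ↔ conj H x ∈ S := Iff.rfl

lemma conj_baseChange (g : H →ₗ[ℚ] H') (x : ℂ ⊗[ℚ] H) :
    conj H' (g.baseChange ℂ x) = g.baseChange ℂ (conj H x) := by
  induction x with
  | zero => simp
  | tmul z h => simp
  | add x y hx hy => simp only [map_add, hx, hy]

/-- A decreasing filtration `F` of `H_ℂ` is a pure Hodge structure of weight `n`:
`H_ℂ = F^p ⊕ conj F^(n+1-p)` for all `p`. -/
def IsPure (F : ℤ → Submodule ℂ (ℂ ⊗[ℚ] H)) (n : ℤ) : Prop :=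
  ∀ p : ℤ, IsCompl (F p) (conjSubspace (F (n + 1 - p)))

/-- The Hodge component `H^{p,n-p} = F^p ∩ conj F^(n-p)` of a pure structure of weight `n`. -/
noncomputable def hodgePiece (F : ℤ → Submodule ℂ (ℂ ⊗[ℚ] H)) (n p : ℤ) :
    Submodule ℂ (ℂ ⊗[ℚ] H) :=
  F p ⊓ conjSubspace (F (n - p))

/-- `B` polarizes the pure Hodge structure `F` of weight `n` (the Riemann bilinear relations). -/
structure IsPolarization (F : ℤ → Submodule ℂ (ℂ ⊗[ℚ] H)) (n : ℤ)
    (B : LinearMap.BilinForm ℚ H) : Prop where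
  symm : ∀ x y, B x y = (-1 : ℚ) ^ n * B y x
  orthogonal : ∀ p, ∀ x ∈ F p, ∀ y ∈ F (n + 1 - p), B.baseChange ℂ x y = 0
  positive : ∀ p, ∀ x ∈ hodgePiece F n p, x ≠ 0 →
    ∃ r : ℝ, 0 < r ∧ Complex.I ^ (p - (n - p)) * B.baseChange ℂ x (conj H x) = (r : ℂ)

/-- The graded piece `Gr^W_n = W_n / W_(n-1)`. -/
abbrev Gr (W : ℤ → Submodule ℚ H) (n : ℤ) : Type u :=
  (W n) ⧸ (W (n - 1)).submoduleOf (W n)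

/-- The filtration induced by `F` on `(Gr^W_n)_ℂ`: the image of `F^p ∩ (W_n)_ℂ`. -/
noncomputable def grF (W : ℤ → Submodule ℚ H) (F : ℤ → Submodule ℂ (ℂ ⊗[ℚ] H)) (n p : ℤ) :
    Submodule ℂ (ℂ ⊗[ℚ] Gr W n) :=
  ((F p).comap ((W n).subtype.baseChange ℂ)).map
    (((W (n - 1)).submoduleOf (W n)).mkQ.baseChange ℂ)

/-- `(W, F)` is a polarizable mixed `ℚ`-Hodge structure on `H`. -/
structure IsPolarizableMixedHodge (W : ℤ → Submodule ℚ H)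
    (F : ℤ → Submodule ℂ (ℂ ⊗[ℚ] H)) : Prop where
  W_mono : Monotone W
  W_bot : ∃ n, W n = ⊥
  W_top : ∃ n, W n = ⊤
  F_anti : Antitone F
  F_bot : ∃ p, F p = ⊥
  F_top : ∃ p, F p = ⊤
  pure : ∀ n, IsPure (grF W F n) n
  polarizable : ∀ n, ∃ B, IsPolarization (grF W F n) n B

/-- All Hodge numbers of `(W, F)` outside `S` vanish. -/
def HasTypeIn (W : ℤ → Submodule ℚ H) (F : ℤ → Submodule ℂ (ℂ ⊗[ℚ] H)) (S : Set (ℤ × ℤ)) : Prop :=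
  ∀ n p : ℤ, hodgePiece (grF W F n) n p ≠ ⊥ → (p, n - p) ∈ S

/-- `g` is compatible with the weight and Hodge filtrations. -/
def IsFiltered (W : ℤ → Submodule ℚ H) (F : ℤ → Submodule ℂ (ℂ ⊗[ℚ] H))
    (W' : ℤ → Submodule ℚ H') (F' : ℤ → Submodule ℂ (ℂ ⊗[ℚ] H')) (g : H →ₗ[ℚ] H') : Prop :=
  (∀ n, ∀ x ∈ W n, g x ∈ W' n) ∧ ∀ p, ∀ x ∈ F p, g.baseChange ℂ x ∈ F' p

/-- The map induced on graded pieces. -/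
noncomputable def grMap {W : ℤ → Submodule ℚ H} {W' : ℤ → Submodule ℚ H'} (g : H →ₗ[ℚ] H')
    (hg : ∀ n, ∀ x ∈ W n, g x ∈ W' n) (n : ℤ) : Gr W n →ₗ[ℚ] Gr W' n :=
  Submodule.mapQ _ _ (g.restrict (hg n)) (fun _ hx => hg (n - 1) _ hx)

lemma grMap_mem {W : ℤ → Submodule ℚ H} {F : ℤ → Submodule ℂ (ℂ ⊗[ℚ] H)}
    {W' : ℤ → Submodule ℚ H'} {F' : ℤ → Submodule ℂ (ℂ ⊗[ℚ] H')} {g : H →ₗ[ℚ] H'}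
    (hg : IsFiltered W F W' F' g) (n p : ℤ) {x : ℂ ⊗[ℚ] Gr W n} (hx : x ∈ grF W F n p) :
    (grMap g hg.1 n).baseChange ℂ x ∈ grF W' F' n p := by
  obtain ⟨y, hy, rfl⟩ := hx
  refine ⟨LinearMap.baseChange ℂ (g.restrict (p := W n) (q := W' n) (hg.1 n)) y, ?_, ?_⟩
  · have h := hg.2 p _ hy
    rw [← LinearMap.comp_apply, ← LinearMap.baseChange_comp] at h
    change (W' n).subtype.baseChange ℂ (LinearMap.baseChange ℂ (g.restrict (p := W n) (q := W' n) (hg.1 n)) y) ∈ F' p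
    rw [← LinearMap.comp_apply, ← LinearMap.baseChange_comp]
    exact h
  · rw [← LinearMap.comp_apply, ← LinearMap.baseChange_comp, ← LinearMap.comp_apply,
      ← LinearMap.baseChange_comp]
    rfl

lemma grMap_mem_conj {W : ℤ → Submodule ℚ H} {F : ℤ → Submodule ℂ (ℂ ⊗[ℚ] H)}
    {W' : ℤ → Submodule ℚ H'} {F' : ℤ → Submodule ℂ (ℂ ⊗[ℚ] H')} {g : H →ₗ[ℚ] H'}
    (hg : IsFiltered W F W' F' g) (n p : ℤ) {x : ℂ ⊗[ℚ] Gr W n}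
    (hx : x ∈ conjSubspace (grF W F n p)) :
    (grMap g hg.1 n).baseChange ℂ x ∈ conjSubspace (grF W' F' n p) := by
  rw [mem_conjSubspace, conj_baseChange]
  exact grMap_mem hg n _ hx

lemma grMap_hodgePiece {W : ℤ → Submodule ℚ H} {F : ℤ → Submodule ℂ (ℂ ⊗[ℚ] H)}
    {W' : ℤ → Submodule ℚ H'} {F' : ℤ → Submodule ℂ (ℂ ⊗[ℚ] H')} {g : H →ₗ[ℚ] H'}
    (hg : IsFiltered W F W' F' g) (n p : ℤ) {x : ℂ ⊗[ℚ] Gr W n}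
    (hx : x ∈ hodgePiece (grF W F n) n p) :
    (grMap g hg.1 n).baseChange ℂ x ∈ hodgePiece (grF W' F' n) n p := by
  refine ⟨grMap_mem hg n p hx.1, grMap_mem_conj hg n _ hx.2⟩

/-- The filtrations of a direct sum. -/
structure IsSum {H₁ H₂ : Type u} [AddCommGroup H₁] [Module ℚ H₁] [AddCommGroup H₂] [Module ℚ H₂]
    (W : ℤ → Submodule ℚ H) (F : ℤ → Submodule ℂ (ℂ ⊗[ℚ] H))
    (W₁ : ℤ → Submodule ℚ H₁) (F₁ : ℤ → Submodule ℂ (ℂ ⊗[ℚ] H₁))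
    (W₂ : ℤ → Submodule ℚ H₂) (F₂ : ℤ → Submodule ℂ (ℂ ⊗[ℚ] H₂))
    (a : H →ₗ[ℚ] H₁) (b : H →ₗ[ℚ] H₂) (i : H₁ →ₗ[ℚ] H) (j : H₂ →ₗ[ℚ] H) : Prop where
  total : i ∘ₗ a + j ∘ₗ b = LinearMap.id
  ha : IsFiltered W F W₁ F₁ a
  hb : IsFiltered W F W₂ F₂ b
  hi : IsFiltered W₁ F₁ W F i
  hj : IsFiltered W₂ F₂ W F j

namespace IsSum

variable {H₁ H₂ : Type u} [AddCommGroup H₁] [Module ℚ H₁] [AddCommGroup H₂] [Module ℚ H₂]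
    {W : ℤ → Submodule ℚ H} {F : ℤ → Submodule ℂ (ℂ ⊗[ℚ] H)}
    {W₁ : ℤ → Submodule ℚ H₁} {F₁ : ℤ → Submodule ℂ (ℂ ⊗[ℚ] H₁)}
    {W₂ : ℤ → Submodule ℚ H₂} {F₂ : ℤ → Submodule ℂ (ℂ ⊗[ℚ] H₂)}
    {a : H →ₗ[ℚ] H₁} {b : H →ₗ[ℚ] H₂} {i : H₁ →ₗ[ℚ] H} {j : H₂ →ₗ[ℚ] H}

lemma totalC (h : i ∘ₗ a + j ∘ₗ b = LinearMap.id) (x : ℂ ⊗[ℚ] H) :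
    i.baseChange ℂ (a.baseChange ℂ x) + j.baseChange ℂ (b.baseChange ℂ x) = x := by
  have := congrArg (fun g : H →ₗ[ℚ] H => g.baseChange ℂ) h
  rw [LinearMap.baseChange_add, LinearMap.baseChange_comp, LinearMap.baseChange_comp,
    LinearMap.baseChange_id] at this
  exact LinearMap.congr_fun this x

lemma gr_total (h : IsSum W F W₁ F₁ W₂ F₂ a b i j) (n : ℤ) :
    grMap i h.hi.1 n ∘ₗ grMap a h.ha.1 n + grMap j h.hj.1 n ∘ₗ grMap b h.hb.1 n =
      LinearMap.id := by
  refine LinearMap.ext fun x => ?_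
  obtain ⟨x, rfl⟩ := Submodule.mkQ_surjective _ x
  have hx : i (a x) + j (b x) = x := LinearMap.congr_fun h.total (x : H)
  have e : (⟨i (a x), h.hi.1 n _ (h.ha.1 n _ x.2)⟩ + ⟨j (b x), h.hj.1 n _ (h.hb.1 n _ x.2)⟩ : W n)
      = x := Subtype.ext hx
  have e' := congrArg ((W (n - 1)).submoduleOf (W n)).mkQ e
  rw [map_add] at e'
  exact e'

lemma isPolarizableMixedHodge (h : IsSum W F W₁ F₁ W₂ F₂ a b i j)
    (hW : Monotone W) (hF : Antitone F)
    (h₁ : IsPolarizableMixedHodge W₁ F₁) (h₂ : IsPolarizableMixedHodge W₂ F₂) :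
    IsPolarizableMixedHodge W F where
  W_mono := hW
  F_anti := hF
  W_bot := by
    obtain ⟨m, hm⟩ := h₁.W_bot
    obtain ⟨n, hn⟩ := h₂.W_bot
    refine ⟨min m n, (Submodule.eq_bot_iff _).2 fun x hx => ?_⟩
    have e₁ := h.ha.1 _ _ (hW (min_le_left m n) hx)
    have e₂ := h.hb.1 _ _ (hW (min_le_right m n) hx)
    rw [hm, Submodule.mem_bot] at e₁
    rw [hn, Submodule.mem_bot] at e₂
    have := LinearMap.congr_fun h.total x
    simpa [e₁, e₂] using this.symm
  W_top := by
    obtain ⟨m, hm⟩ := h₁.W_top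
    obtain ⟨n, hn⟩ := h₂.W_top
    refine ⟨max m n, (Submodule.eq_top_iff').2 fun x => ?_⟩
    have hx : i (a x) + j (b x) = x := LinearMap.congr_fun h.total x
    rw [← hx]
    exact add_mem (hW (le_max_left m n) (h.hi.1 _ _ (by rw [hm]; trivial)))
      (hW (le_max_right m n) (h.hj.1 _ _ (by rw [hn]; trivial)))
  F_bot := by
    obtain ⟨m, hm⟩ := h₁.F_bot
    obtain ⟨n, hn⟩ := h₂.F_bot
    refine ⟨max m n, (Submodule.eq_bot_iff _).2 fun x hx => ?_⟩
    have e₁ := h.ha.2 _ _ (hF (le_max_left m n) hx)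
    have e₂ := h.hb.2 _ _ (hF (le_max_right m n) hx)
    rw [hm, Submodule.mem_bot] at e₁
    rw [hn, Submodule.mem_bot] at e₂
    have := totalC h.total x
    simpa [e₁, e₂] using this.symm
  F_top := by
    obtain ⟨m, hm⟩ := h₁.F_top
    obtain ⟨n, hn⟩ := h₂.F_top
    refine ⟨min m n, (Submodule.eq_top_iff').2 fun x => ?_⟩
    rw [← totalC h.total x]
    exact add_mem (hF (min_le_left m n) (h.hi.2 _ _ (by rw [hm]; trivial)))
      (hF (min_le_right m n) (h.hj.2 _ _ (by rw [hn]; trivial)))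
  pure n p := by
    have ht := totalC (h.gr_total n)
    constructor
    · rw [Submodule.disjoint_def]
      intro x hx hx'
      have e₁ := (Submodule.disjoint_def.1 (h₁.pure n p).disjoint) _ (grMap_mem h.ha n p hx) (grMap_mem_conj h.ha n _ hx')
      have e₂ := (Submodule.disjoint_def.1 (h₂.pure n p).disjoint) _ (grMap_mem h.hb n p hx) (grMap_mem_conj h.hb n _ hx')
      rw [← ht x, e₁, e₂, map_zero, map_zero, add_zero]
    · rw [codisjoint_iff, Submodule.eq_top_iff']
      intro x
      have k₁ : (grMap a h.ha.1 n).baseChange ℂ x ∈ _ ⊔ _ :=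
        (codisjoint_iff.1 (h₁.pure n p).codisjoint).symm ▸ Submodule.mem_top
      have k₂ : (grMap b h.hb.1 n).baseChange ℂ x ∈ _ ⊔ _ :=
        (codisjoint_iff.1 (h₂.pure n p).codisjoint).symm ▸ Submodule.mem_top
      obtain ⟨y₁, hy₁, z₁, hz₁, e₁⟩ := Submodule.mem_sup.1 k₁
      obtain ⟨y₂, hy₂, z₂, hz₂, e₂⟩ := Submodule.mem_sup.1 k₂
      rw [← ht x, ← e₁, ← e₂, map_add, map_add, add_add_add_comm]
      refine add_mem (Submodule.mem_sup_left
        (add_mem (grMap_mem h.hi n p hy₁) (grMap_mem h.hj n p hy₂)))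
        (Submodule.mem_sup_right (add_mem ?_ ?_))
      · exact grMap_mem_conj h.hi n _ hz₁
      · exact grMap_mem_conj h.hj n _ hz₂
  polarizable n := by
    obtain ⟨B₁, hB₁⟩ := h₁.polarizable n
    obtain ⟨B₂, hB₂⟩ := h₂.polarizable n
    have ht := totalC (h.gr_total n)
    set α := grMap a h.ha.1 n
    set β := grMap b h.hb.1 n
    have key : ∀ x y, (B₁.comp α α + B₂.comp β β).baseChange ℂ x y =
        B₁.baseChange ℂ (α.baseChange ℂ x) (α.baseChange ℂ y) +
        B₂.baseChange ℂ (β.baseChange ℂ x) (β.baseChange ℂ y) := by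
      intro x y
      induction x with
      | zero => simp
      | add x x' hx hx' =>
        simp only [map_add, LinearMap.add_apply] at hx hx' ⊢
        rw [hx, hx']; ring
      | tmul z v =>
        induction y with
        | zero => simp
        | add y y' hy hy' => simp only [map_add] at hy hy' ⊢; rw [hy, hy']; ring
        | tmul w v' => simp [add_smul]
    refine ⟨B₁.comp α α + B₂.comp β β, ?_, ?_, ?_⟩
    · intro x y
      simp only [LinearMap.add_apply, LinearMap.BilinForm.comp_apply]
      rw [hB₁.symm, hB₂.symm (β x), mul_add]
    · intro p x hx y hy
      rw [key, hB₁.orthogonal p _ (grMap_mem h.ha n p hx) _ (grMap_mem h.ha n _ hy),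
        hB₂.orthogonal p _ (grMap_mem h.hb n p hx) _ (grMap_mem h.hb n _ hy), add_zero]
    · intro p x hx hx0
      have m₁ := grMap_hodgePiece h.ha n p hx
      have m₂ := grMap_hodgePiece h.hb n p hx
      rw [key, ← conj_baseChange, ← conj_baseChange, mul_add]
      have c₁ := hB₁.positive p _ m₁
      have c₂ := hB₂.positive p _ m₂
      change α.baseChange ℂ x ≠ 0 → _ at c₁
      change β.baseChange ℂ x ≠ 0 → _ at c₂
      by_cases e₁ : α.baseChange ℂ x = 0
      · have e₂ : β.baseChange ℂ x ≠ 0 := by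
          intro e₂
          apply hx0
          rw [← ht x, e₁, e₂, map_zero, map_zero, add_zero]
        obtain ⟨r, hr, er⟩ := c₂ e₂
        exact ⟨r, hr, by rw [e₁, ← er]; simp [β]⟩
      · obtain ⟨r, hr, er⟩ := c₁ e₁
        by_cases e₂ : β.baseChange ℂ x = 0
        · exact ⟨r, hr, by rw [e₂, ← er]; simp [α]⟩
        · obtain ⟨s, hs, es⟩ := c₂ e₂
          refine ⟨r + s, add_pos hr hs, ?_⟩
          rw [Complex.ofReal_add, ← er, ← es]

lemma hasTypeIn (h : IsSum W F W₁ F₁ W₂ F₂ a b i j) {S : Set (ℤ × ℤ)}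
    (h₁ : HasTypeIn W₁ F₁ S) (h₂ : HasTypeIn W₂ F₂ S) : HasTypeIn W F S := by
  intro n p hne
  by_contra hS
  have k₁ := not_imp_comm.1 (h₁ n p) hS
  have k₂ := not_imp_comm.1 (h₂ n p) hS
  apply hne
  rw [Submodule.eq_bot_iff]
  intro x hx
  have e₁ := grMap_hodgePiece h.ha n p hx
  have e₂ := grMap_hodgePiece h.hb n p hx
  rw [k₁, Submodule.mem_bot] at e₁
  rw [k₂, Submodule.mem_bot] at e₂
  rw [← totalC (h.gr_total n) x, e₁, e₂, map_zero, map_zero, add_zero]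

end IsSum

/-- If all Hodge numbers with `p ≥ 1` vanish then `F^1 = 0`. -/
lemma eq_bot_of_hasTypeIn {W : ℤ → Submodule ℚ H} {F : ℤ → Submodule ℂ (ℂ ⊗[ℚ] H)}
    (h : IsPolarizableMixedHodge W F) {S : Set (ℤ × ℤ)} (hS : ∀ p q, (p, q) ∈ S → p ≤ 0)
    (hT : HasTypeIn W F S) : F 1 = ⊥ := by
  have inj : ∀ n, Function.Injective ((W n).subtype.baseChange ℂ) := fun n =>
    Module.Flat.lTensor_preserves_injective_linearMap (M := ℂ) _ (W n).injective_subtype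
  have gr : ∀ n, grF W F n 1 = ⊥ := by
    intro n
    obtain ⟨P, hP⟩ := h.F_bot
    have hbig : ∀ p, P ≤ p → grF W F n p = ⊥ := by
      intro p hp
      have : F p = ⊥ := le_bot_iff.1 (hP ▸ h.F_anti hp)
      rw [grF, this, Submodule.comap_bot, LinearMap.ker_eq_bot.2 (inj n), Submodule.map_bot]
    have hstep : ∀ p, 1 ≤ p → grF W F n (p + 1) = ⊥ → grF W F n p = ⊥ := by
      intro p hp hp1
      have hc := (h.pure n (n - p)).symm
      have e : n + 1 - (n - p) = p + 1 := by ring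
      rw [e, hp1] at hc
      have hb : conjSubspace (⊥ : Submodule ℂ (ℂ ⊗[ℚ] Gr W n)) = ⊥ := by
        rw [Submodule.eq_bot_iff]
        intro x hx
        have hx' : conj _ x = 0 := hx
        have inv : ∀ y : ℂ ⊗[ℚ] Gr W n, conj _ (conj _ y) = y := by
          intro y
          induction y with
          | zero => simp
          | tmul z v => simp
          | add y y' e e' => rw [map_add, map_add, e, e']
        rw [← inv x, hx', map_zero]
      rw [hb] at hc
      have ht : grF W F n (n - p) = ⊤ := by
        simpa using codisjoint_iff.1 hc.codisjoint
      by_contra hne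
      have := hT n p (by
        rw [hodgePiece, ht]
        have : conjSubspace (⊤ : Submodule ℂ (ℂ ⊗[ℚ] Gr W n)) = ⊤ := rfl
        rwa [this, inf_top_eq])
      have := hS _ _ this
      omega
    have hall : ∀ k : ℕ, ∀ p, 1 ≤ p → P ≤ p + k → grF W F n p = ⊥ := by
      intro k
      induction k with
      | zero => intro p _ hp; exact hbig p (by simpa using hp)
      | succ k ih =>
        intro p hp hk
        exact hstep p hp (ih (p + 1) (by omega) (by push_cast at hk; omega))
    exact hall (P - 1).toNat 1 le_rfl (by omega)
  obtain ⟨m, hm⟩ := h.W_bot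
  obtain ⟨M, hM⟩ := h.W_top
  have main : ∀ k : ℕ, ∀ n, n = m + k → ∀ y, (W n).subtype.baseChange ℂ y ∈ F 1 →
      (W n).subtype.baseChange ℂ y = 0 := by
    intro k
    induction k with
    | zero =>
      intro n hn y _
      have e : (W n).subtype = 0 := by
        have hle : W n ≤ ⊥ := by rw [hn, Nat.cast_zero, add_zero, hm]
        ext z
        exact (Submodule.mem_bot ℚ).1 (hle z.2)
      rw [e]
      simp
    | succ k ih =>
      intro n hn y hx
      have hy : ((W (n - 1)).submoduleOf (W n)).mkQ.baseChange ℂ y = 0 := by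
        have : ((W (n - 1)).submoduleOf (W n)).mkQ.baseChange ℂ y ∈ grF W F n 1 :=
          ⟨y, hx, rfl⟩
        rwa [gr n, Submodule.mem_bot] at this
      have ex := lTensor_exact ℂ
        (f := ((W (n - 1)).submoduleOf (W n)).subtype)
        (g := ((W (n - 1)).submoduleOf (W n)).mkQ)
        (LinearMap.exact_subtype_mkQ _) (Submodule.mkQ_surjective _)
      obtain ⟨z, rfl⟩ := (ex y).1 hy
      let φ : (W (n - 1)).submoduleOf (W n) →ₗ[ℚ] W (n - 1) :=
        ((W n).subtype ∘ₗ ((W (n - 1)).submoduleOf (W n)).subtype).codRestrict _ (fun c => c.2)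
      have e : (W n).subtype.baseChange ℂ
          ((((W (n - 1)).submoduleOf (W n)).subtype).baseChange ℂ z) =
          (W (n - 1)).subtype.baseChange ℂ (φ.baseChange ℂ z) := by
        rw [← LinearMap.comp_apply, ← LinearMap.comp_apply, ← LinearMap.baseChange_comp,
          ← LinearMap.baseChange_comp]
        rfl
      change (W n).subtype.baseChange ℂ
          ((((W (n - 1)).submoduleOf (W n)).subtype).baseChange ℂ z) = 0
      rw [e]
      exact ih (n - 1) (by rw [hn]; push_cast; ring) _ (e ▸ hx)
  rw [Submodule.eq_bot_iff]
  intro x hx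
  have ht : W (m + ((M - m).toNat : ℤ)) = ⊤ := top_le_iff.1 (hM ▸ h.W_mono (by omega))
  have hs : Function.Surjective ((W (m + ((M - m).toNat : ℤ))).subtype.baseChange ℂ) := by
    apply LinearMap.lTensor_surjective
    intro v
    exact ⟨⟨v, by rw [ht]; trivial⟩, rfl⟩
  obtain ⟨y, rfl⟩ := hs x
  exact main (M - m).toNat _ rfl y hx

end Linear

/-- A polarizable mixed `A`-Hodge structure `(V_A, W ⊂ V_ℚ, F ⊂ V_ℂ)`: a finitely generated
`A`-module with a weight filtration on `V_ℚ = ℚ ⊗ V_A` and a Hodge filtration on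
`V_ℂ = ℂ ⊗ V_ℚ`. Torsion in `V_A` is allowed. -/
structure MHS (A : Subring ℚ) : Type (u + 1) where
  carrier : Type u
  [addCommGroup : AddCommGroup carrier]
  [module : Module A carrier]
  [finite : Module.Finite A carrier]
  W : ℤ → Submodule ℚ (ℚ ⊗[A] carrier)
  F : ℤ → Submodule ℂ (ℂ ⊗[ℚ] (ℚ ⊗[A] carrier))
  isPolarizableMixedHodge : IsPolarizableMixedHodge W F

namespace MHS

attribute [instance] addCommGroup module finite

variable {A : Subring ℚ}

/-- Morphisms of mixed Hodge structures: `A`-linear maps compatible with both filtrations. -/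
noncomputable def homs (X Y : MHS.{u} A) : AddSubgroup (X.carrier →ₗ[A] Y.carrier) where
  carrier := {f | IsFiltered X.W X.F Y.W Y.F (f.baseChange ℚ)}
  zero_mem' := by
    constructor
    · intro n x _; simp
    · intro p x _; simp
  add_mem' {f g} hf hg := by
    constructor
    · intro n x hx
      rw [LinearMap.baseChange_add]
      exact add_mem (hf.1 n x hx) (hg.1 n x hx)
    · intro p x hx
      rw [LinearMap.baseChange_add, LinearMap.baseChange_add]
      exact add_mem (hf.2 p x hx) (hg.2 p x hx)
  neg_mem' {f} hf := by
    constructor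
    · intro n x hx
      rw [LinearMap.baseChange_neg]
      exact neg_mem (hf.1 n x hx)
    · intro p x hx
      rw [LinearMap.baseChange_neg, LinearMap.baseChange_neg]
      exact neg_mem (hf.2 p x hx)

lemma comp_mem_homs {X Y Z : MHS.{u} A} {f : X.carrier →ₗ[A] Y.carrier}
    {g : Y.carrier →ₗ[A] Z.carrier} (hf : f ∈ homs X Y) (hg : g ∈ homs Y Z) :
    g ∘ₗ f ∈ homs X Z := by
  constructor
  · intro n x hx
    rw [LinearMap.baseChange_comp]
    exact hg.1 n _ (hf.1 n x hx)
  · intro p x hx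
    rw [LinearMap.baseChange_comp, LinearMap.baseChange_comp]
    exact hg.2 p _ (hf.2 p x hx)

lemma id_mem_homs (X : MHS.{u} A) : LinearMap.id ∈ homs X X := by
  constructor
  · intro n x hx
    rwa [LinearMap.baseChange_id]
  · intro p x hx
    rwa [LinearMap.baseChange_id, LinearMap.baseChange_id]

noncomputable instance : Category.{u} (MHS.{u} A) where
  Hom X Y := homs X Y
  id X := ⟨LinearMap.id, id_mem_homs X⟩
  comp f g := ⟨g.1 ∘ₗ f.1, comp_mem_homs f.2 g.2⟩

/-- The underlying `A`-linear map of a morphism. -/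
def Hom.lin {X Y : MHS.{u} A} (f : X ⟶ Y) : X.carrier →ₗ[A] Y.carrier := f.1

lemma hom_ext {X Y : MHS.{u} A} {f g : X ⟶ Y} (h : Hom.lin f = Hom.lin g) : f = g :=
  Subtype.ext h

noncomputable instance (X Y : MHS.{u} A) : AddCommGroup (X ⟶ Y) :=
  inferInstanceAs (AddCommGroup (homs X Y))

lemma Hom.lin_add {X Y : MHS.{u} A} (f g : X ⟶ Y) :
    Hom.lin (f + g) = Hom.lin f + Hom.lin g := rfl

lemma Hom.lin_comp {X Y Z : MHS.{u} A} (f : X ⟶ Y) (g : Y ⟶ Z) :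
    Hom.lin (f ≫ g) = Hom.lin g ∘ₗ Hom.lin f := rfl

noncomputable instance : Preadditive (MHS.{u} A) where
  add_comp _ _ _ f f' g := hom_ext (by
    rw [Hom.lin_comp, Hom.lin_add, Hom.lin_add, LinearMap.comp_add]; rfl)
  comp_add _ _ _ f g g' := hom_ext (by
    rw [Hom.lin_comp, Hom.lin_add, Hom.lin_add, LinearMap.add_comp]; rfl)

lemma isPolarizableMixedHodge_of_subsingleton {H : Type u} [AddCommGroup H] [Module ℚ H]
    [Subsingleton H] : IsPolarizableMixedHodge (fun _ => (⊥ : Submodule ℚ H)) (fun _ => ⊥) := by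
  have hs : Subsingleton (ℂ ⊗[ℚ] H) := by
    refine ⟨fun x y => ?_⟩
    have h0 : ∀ z : ℂ ⊗[ℚ] H, z = 0 := by
      intro z
      induction z with
      | zero => rfl
      | tmul z h => rw [Subsingleton.elim h 0, TensorProduct.tmul_zero]
      | add x y hx hy => rw [hx, hy, add_zero]
    rw [h0 x, h0 y]
  have hg : ∀ n, Subsingleton (Gr (fun _ => (⊥ : Submodule ℚ H)) n) := fun n => inferInstance
  have hgc : ∀ n, Subsingleton (ℂ ⊗[ℚ] Gr (fun _ => (⊥ : Submodule ℚ H)) n) := by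
    intro n
    refine ⟨fun x y => ?_⟩
    have h0 : ∀ z : ℂ ⊗[ℚ] Gr (fun _ => (⊥ : Submodule ℚ H)) n, z = 0 := by
      intro z
      induction z with
      | zero => rfl
      | tmul z h => rw [Subsingleton.elim h 0, TensorProduct.tmul_zero]
      | add x y hx hy => rw [hx, hy, add_zero]
    rw [h0 x, h0 y]
  refine ⟨fun _ _ _ => le_rfl, ⟨0, rfl⟩, ⟨0, Subsingleton.elim _ _⟩, fun _ _ _ => le_rfl,
    ⟨0, rfl⟩, ⟨0, Subsingleton.elim _ _⟩, fun n p => ?_, fun n => ⟨0, ?_, ?_, ?_⟩⟩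
  · have := hgc n
    constructor
    · rw [Submodule.disjoint_def]
      intro x _ _
      exact Subsingleton.elim _ _
    · rw [codisjoint_iff]
      exact Subsingleton.elim _ _
  · intro x y; simp
  · intro p x _ y _; simp
  · intro p x _ hx
    have := hgc n
    exact absurd (Subsingleton.elim x 0) hx

/-- The zero Hodge structure. -/
noncomputable def zero (A : Subring ℚ) : MHS.{u} A where
  carrier := PUnit
  W _ := ⊥
  F _ := ⊥
  isPolarizableMixedHodge := by
    have : Subsingleton (ℚ ⊗[A] PUnit.{u + 1}) := by
      refine ⟨fun x y => ?_⟩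
      have h0 : ∀ z : ℚ ⊗[A] PUnit.{u + 1}, z = 0 := by
        intro z
        induction z with
        | zero => rfl
        | tmul z h => rw [Subsingleton.elim h 0, TensorProduct.tmul_zero]
        | add x y hx hy => rw [hx, hy, add_zero]
      rw [h0 x, h0 y]
    exact isPolarizableMixedHodge_of_subsingleton

lemma isZero_zero (A : Subring ℚ) : IsZero (zero.{u} A) := by
  rw [IsZero.iff_id_eq_zero]
  exact hom_ext (LinearMap.ext fun x => Subsingleton.elim (α := PUnit) _ _)

/-- The weight filtration of a direct sum. -/
noncomputable def prodW (X Y : MHS.{u} A) (n : ℤ) :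
    Submodule ℚ (ℚ ⊗[A] (X.carrier × Y.carrier)) :=
  (X.W n).comap ((LinearMap.fst A X.carrier Y.carrier).baseChange ℚ) ⊓
    (Y.W n).comap ((LinearMap.snd A X.carrier Y.carrier).baseChange ℚ)

/-- The Hodge filtration of a direct sum. -/
noncomputable def prodF (X Y : MHS.{u} A) (p : ℤ) :
    Submodule ℂ (ℂ ⊗[ℚ] (ℚ ⊗[A] (X.carrier × Y.carrier))) :=
  (X.F p).comap (((LinearMap.fst A X.carrier Y.carrier).baseChange ℚ).baseChange ℂ) ⊓
    (Y.F p).comap (((LinearMap.snd A X.carrier Y.carrier).baseChange ℚ).baseChange ℂ)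

lemma prod_isSum (X Y : MHS.{u} A) : IsSum (prodW X Y) (prodF X Y) X.W X.F Y.W Y.F
    ((LinearMap.fst A X.carrier Y.carrier).baseChange ℚ)
    ((LinearMap.snd A X.carrier Y.carrier).baseChange ℚ)
    ((LinearMap.inl A X.carrier Y.carrier).baseChange ℚ)
    ((LinearMap.inr A X.carrier Y.carrier).baseChange ℚ) where
  total := by
    rw [← LinearMap.baseChange_comp, ← LinearMap.baseChange_comp, ← LinearMap.baseChange_add,
      ← LinearMap.baseChange_id]
    congr 1
    exact LinearMap.ext fun x => Prod.ext (add_zero x.1) (zero_add x.2)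
  ha := ⟨fun _ _ h => h.1, fun _ _ h => h.1⟩
  hb := ⟨fun _ _ h => h.2, fun _ _ h => h.2⟩
  hi := by
    refine ⟨fun n x hx => ⟨?_, ?_⟩, fun p x hx => ⟨?_, ?_⟩⟩ <;>
      rw [SetLike.mem_coe, Submodule.mem_comap, ← LinearMap.comp_apply, ← LinearMap.baseChange_comp]
    · rwa [LinearMap.fst_comp_inl, LinearMap.baseChange_id]
    · rw [LinearMap.snd_comp_inl, LinearMap.baseChange_zero]
      exact zero_mem _
    · rwa [← LinearMap.baseChange_comp, LinearMap.fst_comp_inl, LinearMap.baseChange_id,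
        LinearMap.baseChange_id]
    · rw [← LinearMap.baseChange_comp, LinearMap.snd_comp_inl, LinearMap.baseChange_zero,
        LinearMap.baseChange_zero]
      exact zero_mem _
  hj := by
    refine ⟨fun n x hx => ⟨?_, ?_⟩, fun p x hx => ⟨?_, ?_⟩⟩ <;>
      rw [SetLike.mem_coe, Submodule.mem_comap, ← LinearMap.comp_apply, ← LinearMap.baseChange_comp]
    · rw [LinearMap.fst_comp_inr, LinearMap.baseChange_zero]
      exact zero_mem _
    · rwa [LinearMap.snd_comp_inr, LinearMap.baseChange_id]
    · rw [← LinearMap.baseChange_comp, LinearMap.fst_comp_inr, LinearMap.baseChange_zero,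
        LinearMap.baseChange_zero]
      exact zero_mem _
    · rwa [← LinearMap.baseChange_comp, LinearMap.snd_comp_inr, LinearMap.baseChange_id,
        LinearMap.baseChange_id]

/-- The direct sum of two Hodge structures. -/
noncomputable def prod (X Y : MHS.{u} A) : MHS.{u} A where
  carrier := X.carrier × Y.carrier
  W := prodW X Y
  F := prodF X Y
  isPolarizableMixedHodge := (prod_isSum X Y).isPolarizableMixedHodge
      (fun _ _ h => inf_le_inf (Submodule.comap_mono (X.isPolarizableMixedHodge.W_mono h))
        (Submodule.comap_mono (Y.isPolarizableMixedHodge.W_mono h)))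
      (fun _ _ h => inf_le_inf (Submodule.comap_mono (X.isPolarizableMixedHodge.F_anti h))
        (Submodule.comap_mono (Y.isPolarizableMixedHodge.F_anti h)))
      X.isPolarizableMixedHodge Y.isPolarizableMixedHodge

/-- The biproduct diagram on the direct sum. -/
noncomputable def prodBicone (X Y : MHS.{u} A) : BinaryBicone X Y where
  pt := prod X Y
  fst := ⟨LinearMap.fst A X.carrier Y.carrier, (prod_isSum X Y).ha⟩
  snd := ⟨LinearMap.snd A X.carrier Y.carrier, (prod_isSum X Y).hb⟩
  inl := ⟨LinearMap.inl A X.carrier Y.carrier, (prod_isSum X Y).hi⟩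
  inr := ⟨LinearMap.inr A X.carrier Y.carrier, (prod_isSum X Y).hj⟩
  inl_fst := hom_ext (LinearMap.fst_comp_inl A X.carrier Y.carrier)
  inl_snd := hom_ext (LinearMap.snd_comp_inl A X.carrier Y.carrier)
  inr_fst := hom_ext (LinearMap.fst_comp_inr A X.carrier Y.carrier)
  inr_snd := hom_ext (LinearMap.snd_comp_inr A X.carrier Y.carrier)

lemma prodBicone_total (X Y : MHS.{u} A) :
    (prodBicone X Y).fst ≫ (prodBicone X Y).inl + (prodBicone X Y).snd ≫ (prodBicone X Y).inr =
      𝟙 (prodBicone X Y).pt := by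
  refine hom_ext ?_
  refine LinearMap.ext fun x => ?_
  exact Prod.ext (add_zero x.1) (zero_add x.2)

/-- `V` is effective if `F^1 = 0`. -/
def effective (A : Subring ℚ) : ObjectProperty (MHS.{u} A) := fun X => X.F 1 = ⊥

/-- The Hodge types `(0,0), (0,-1), (-1,0), (-1,-1)`. -/
def oneTypes : Set (ℤ × ℤ) := {(0, 0), (0, -1), (-1, 0), (-1, -1)}

/-- The torsion-free objects of type `{(0,0), (0,-1), (-1,0), (-1,-1)}`. -/
def one (A : Subring ℚ) : ObjectProperty (MHS.{u} A) := fun X =>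
  Module.IsTorsionFree A X.carrier ∧ HasTypeIn X.W X.F oneTypes

lemma one_le_effective (A : Subring ℚ) : one.{u} A ≤ effective A := fun X hX =>
  eq_bot_of_hasTypeIn X.isPolarizableMixedHodge (S := oneTypes) (by
    rintro p q h
    simp only [oneTypes, Set.mem_insert_iff, Set.mem_singleton_iff, Prod.mk.injEq] at h
    omega) hX.2

/-- A property of Hodge structures that holds for zero and is stable under direct sums. -/
class IsAdditive (P : ObjectProperty (MHS.{u} A)) : Prop where
  zero : P (zero A)
  prod : ∀ X Y, P X → P Y → P (prod X Y)

instance : IsAdditive (effective.{u} A) where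
  zero := rfl
  prod X Y hX hY := by
    change _ = _
    rw [Submodule.eq_bot_iff]
    intro x hx
    have e₁ := (prod_isSum X Y).ha.2 1 x hx
    have e₂ := (prod_isSum X Y).hb.2 1 x hx
    rw [show X.F 1 = ⊥ from hX, Submodule.mem_bot] at e₁
    rw [show Y.F 1 = ⊥ from hY, Submodule.mem_bot] at e₂
    rw [← IsSum.totalC (prod_isSum X Y).total x, e₁, e₂, map_zero, map_zero, add_zero]
    rfl

instance : IsAdditive (one.{u} A) where
  zero := by
    refine ⟨⟨fun _ _ _ _ _ => Subsingleton.elim (α := PUnit) _ _⟩, fun n p h => absurd ?_ h⟩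
    rw [Submodule.eq_bot_iff]
    rintro _ ⟨⟨y, hy, rfl⟩, -⟩
    have hy0 : ((zero A).W n).subtype.baseChange ℂ y = 0 := hy
    have inj : Function.Injective (((zero.{u} A).W n).subtype.baseChange ℂ) :=
      Module.Flat.lTensor_preserves_injective_linearMap (M := ℂ) _
        ((zero A).W n).injective_subtype
    rw [inj (hy0.trans (map_zero _).symm), map_zero]
  prod X Y hX hY := by
    refine ⟨⟨fun r hr x y h => ?_⟩, (prod_isSum X Y).hasTypeIn hX.2 hY.2⟩
    exact Prod.ext (hX.1.isSMulRegular hr (congrArg Prod.fst h))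
      (hY.1.isSMulRegular hr (congrArg Prod.snd h))

section

variable (P : ObjectProperty (MHS.{u} A)) [IsAdditive P]

instance : HasZeroObject P.FullSubcategory where
  zero := ⟨⟨zero A, IsAdditive.zero⟩, by
    rw [IsZero.iff_id_eq_zero]
    exact P.ι.map_injective ((isZero_zero A).eq_of_src _ _)⟩

/-- Direct sums in the full subcategory. -/
noncomputable def subBicone (X Y : P.FullSubcategory) : BinaryBicone X Y where
  pt := ⟨prod X.obj Y.obj, IsAdditive.prod _ _ X.property Y.property⟩
  fst := P.homMk (prodBicone X.obj Y.obj).fst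
  snd := P.homMk (prodBicone X.obj Y.obj).snd
  inl := P.homMk (prodBicone X.obj Y.obj).inl
  inr := P.homMk (prodBicone X.obj Y.obj).inr
  inl_fst := P.ι.map_injective (prodBicone X.obj Y.obj).inl_fst
  inl_snd := P.ι.map_injective (prodBicone X.obj Y.obj).inl_snd
  inr_fst := P.ι.map_injective (prodBicone X.obj Y.obj).inr_fst
  inr_snd := P.ι.map_injective (prodBicone X.obj Y.obj).inr_snd

instance : HasBinaryBiproducts P.FullSubcategory where
  has_binary_biproduct X Y := hasBinaryBiproduct_of_total (subBicone P X Y)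
    (P.ι.map_injective (prodBicone_total X.obj Y.obj))

end

end MHS

section Homotopy

universe v v' w w'

variable (C : Type w) [Category.{v} C] [Preadditive C]
variable {D : Type w'} [Category.{v'} D] [Preadditive D]

/-- The homotopy classes of bounded complexes, among all complexes up to homotopy. -/
def bounded : ObjectProperty (HomotopyCategory C (ComplexShape.up ℤ)) := fun K =>
  ∃ a b : ℤ, CochainComplex.IsStrictlyGE K.as a ∧ CochainComplex.IsStrictlyLE K.as b

/-- The bounded homotopy category `K^b(C)`. -/
abbrev Kb := (bounded C).FullSubcategory

section

open ZeroObject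

instance [HasZeroObject C] : (bounded C).ContainsZero where
  exists_zero := ⟨(HomotopyCategory.quotient _ _).obj 0, Functor.map_isZero _ (isZero_zero _),
    0, 0, (inferInstance : CochainComplex.IsStrictlyGE (0 : CochainComplex C ℤ) 0),
    (inferInstance : CochainComplex.IsStrictlyLE (0 : CochainComplex C ℤ) 0)⟩

end

instance : (bounded C).IsStableUnderShift ℤ where
  isStableUnderShiftBy n :=
    { le_shift := by
        rintro K ⟨a, b, ha, hb⟩
        obtain ⟨K, rfl⟩ := HomotopyCategory.quotient_obj_surjective K
        change CochainComplex.IsStrictlyGE K a at ha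
        change CochainComplex.IsStrictlyLE K b at hb
        rw [ObjectProperty.prop_shift_iff, HomotopyCategory.shift_quotient_obj]
        exact ⟨a - n, b - n, CochainComplex.isStrictlyGE_shift K a n (a - n) (by lia),
          CochainComplex.isStrictlyLE_shift K b n (b - n) (by lia)⟩ }

instance [HasZeroObject C] [HasBinaryBiproducts C] : (bounded C).IsTriangulatedClosed₃ where
  ext₃' T hT h₁ h₂ := by
    obtain ⟨a₁, b₁, _, _⟩ := h₁
    obtain ⟨a₂, b₂, _, _⟩ := h₂
    obtain ⟨f : T.obj₁.as ⟶ T.obj₂.as, hf⟩ :=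
      (HomotopyCategory.quotient _ _).map_surjective T.mor₁
    refine ⟨_, ?_, ⟨Pretriangulated.Triangle.π₃.mapIso (Pretriangulated.isoTriangleOfIso₁₂ T _ hT
      (HomotopyCategory.mappingCone_triangleh_distinguished f) (Iso.refl _) (Iso.refl _) ?_)⟩⟩
    · refine ⟨min (a₁ - 1) a₂, max (b₁ - 1) b₂,
        CochainComplex.isStrictlyGE_mappingCone f a₁ a₂ _ (by simp) (by simp), ?_⟩
      change CochainComplex.IsStrictlyLE (CochainComplex.mappingCone f) _
      rw [CochainComplex.isStrictlyLE_iff]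
      intro i hi
      rw [max_lt_iff] at hi
      rw [CochainComplex.mappingCone.isZero_X_iff]
      exact ⟨CochainComplex.isZero_of_isStrictlyLE T.obj₁.as b₁ _ (by lia),
        CochainComplex.isZero_of_isStrictlyLE T.obj₂.as b₂ _ (by lia)⟩
    · exact (Category.comp_id _).trans (hf.symm.trans (Category.id_comp _).symm)

instance [HasZeroObject C] [HasBinaryBiproducts C] : (bounded C).IsTriangulated where
  toIsTriangulatedClosed₂ := .of_isTriangulatedClosed₃

namespace Kb

variable {C}

/-- The functor `K^b(C) ⥤ K^b(D)` induced by an additive functor. -/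
noncomputable def map (F : C ⥤ D) [F.Additive] : Kb C ⥤ Kb D :=
  (bounded D).lift ((bounded C).ι ⋙ F.mapHomotopyCategory (ComplexShape.up ℤ)) (by
    rintro ⟨K, a, b, _, _⟩
    exact ⟨a, b, inferInstanceAs (CochainComplex.IsStrictlyGE
        ((F.mapHomologicalComplex _).obj K.as) a), inferInstanceAs (CochainComplex.IsStrictlyLE
        ((F.mapHomologicalComplex _).obj K.as) b)⟩)

noncomputable instance (F : C ⥤ D) [F.Additive] : (map F).CommShift ℤ :=
  inferInstanceAs (((bounded D).lift ((bounded C).ι ⋙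
    F.mapHomotopyCategory (ComplexShape.up ℤ)) _).CommShift ℤ)

instance [HasZeroObject C] [HasBinaryBiproducts C] [HasZeroObject D] [HasBinaryBiproducts D]
    (F : C ⥤ D) [F.Additive] : (map F).IsTriangulated :=
  ObjectProperty.isTriangulated_lift (bounded D)
    ((bounded C).ι ⋙ F.mapHomotopyCategory (ComplexShape.up ℤ)) _

/-- An object placed in degree `0`. -/
noncomputable def single (C : Type w) [Category.{v} C] [Preadditive C] [HasZeroObject C] :
    C ⥤ Kb C :=
  (bounded C).lift (HomotopyCategory.singleFunctor C 0) (fun X =>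
    ⟨0, 0, inferInstanceAs (CochainComplex.IsStrictlyGE
      ((CochainComplex.singleFunctor C 0).obj X) 0), inferInstanceAs (CochainComplex.IsStrictlyLE
      ((CochainComplex.singleFunctor C 0).obj X) 0)⟩)

/-- The map `K ⟶ G(F(K))` which is `η` in each degree. -/
noncomputable def unitApp {F : C ⥤ D} {G : D ⥤ C} [F.Additive] [G.Additive] (η : 𝟭 C ⟶ F ⋙ G)
    (K : Kb C) : K ⟶ (map G).obj ((map F).obj K) :=
  (bounded C).homMk ((HomotopyCategory.quotient C (ComplexShape.up ℤ)).map
    (show K.obj.as ⟶ (G.mapHomologicalComplex _).obj ((F.mapHomologicalComplex _).obj K.obj.as)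
      from
      { f := fun n => η.app (K.obj.as.X n)
        comm' := fun i j _ => (η.naturality (K.obj.as.d i j)).symm }))

end Kb

end Homotopy

section Derived

variable {A : Subring ℚ} (P R : ObjectProperty (MHS.{u} A)) [MHS.IsAdditive P] [MHS.IsAdditive R]

/-- A bounded complex of objects of `P` is acyclic if it is exact as a complex in the ambient
abelian category of polarizable mixed Hodge structures. (When `P` is stable under subobjects in
that category, the cycles of such a complex are again objects of `P`, so the complex is spliced
from short exact sequences of objects of `P`.) -/
def acyclic : ObjectProperty (Kb P.FullSubcategory) := fun K =>
  ((P.ι.mapHomologicalComplex (ComplexShape.up ℤ)).obj K.obj.as).Acyclic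

/-- The bounded derived category: the Verdier quotient of the bounded homotopy category by the
acyclic complexes, i.e. its localization at the morphisms with acyclic cone. -/
abbrev Db := (acyclic P).trW.Localization

/-- The localization functor `K^b ⥤ D^b`. -/
noncomputable abbrev Db.Q : Kb P.FullSubcategory ⥤ Db P := (acyclic P).trW.Q

/-- The embedding of objects of `P` as complexes concentrated in degree `0`. -/
noncomputable def Db.single : P.FullSubcategory ⥤ Db P := Kb.single P.FullSubcategory ⋙ Db.Q P

variable {P R}

/-- Objects of `D^{≤ n}`: those represented by a bounded complex vanishing in degrees `> n`. -/
def Db.IsLE (X : Db P) (n : ℤ) : Prop :=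
  ∃ K : Kb P.FullSubcategory, CochainComplex.IsStrictlyLE K.obj.as n ∧ Nonempty ((Db.Q P).obj K ≅ X)

/-- Objects of `D^{≥ n}`: those represented by a bounded complex vanishing in degrees `< n`. -/
def Db.IsGE (X : Db P) (n : ℤ) : Prop :=
  ∃ K : Kb P.FullSubcategory, CochainComplex.IsStrictlyGE K.obj.as n ∧ Nonempty ((Db.Q P).obj K ≅ X)

/-- Exactness of an additive functor: it preserves short exact sequences of Hodge structures. -/
def IsExact (F : P.FullSubcategory ⥤ R.FullSubcategory) [F.Additive] : Prop :=
  ∀ S : ShortComplex P.FullSubcategory, (S.map P.ι).ShortExact → ((S.map F).map R.ι).ShortExact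

/-- `t`-exactness: `D^{≤ n}` goes to `D^{≤ n}` and `D^{≥ n}` to `D^{≥ n}`. -/
def IsTExact (F : Db P ⥤ Db R) : Prop :=
  ∀ (X : Db P) (n : ℤ), (Db.IsLE X n → Db.IsLE (F.obj X) n) ∧ (Db.IsGE X n → Db.IsGE (F.obj X) n)

end Derived

/-- Effective polarizable mixed `A`-Hodge structures. -/
abbrev MHSEff (A : Subring ℚ) := (MHS.effective.{u} A).FullSubcategory

/-- Torsion-free polarizable mixed `A`-Hodge structures of type
`{(0,0), (0,-1), (-1,0), (-1,-1)}`. -/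
abbrev MHSOne (A : Subring ℚ) := (MHS.one.{u} A).FullSubcategory

/-- The inclusion of `MHSOne A` in `MHSEff A`. -/
noncomputable abbrev tot (A : Subring ℚ) : MHSOne.{u} A ⥤ MHSEff.{u} A :=
  ObjectProperty.ιOfLE (MHS.one_le_effective A)

instance (A : Subring ℚ) : (tot.{u} A).Additive where
  map_add := rfl

lemma acyclic_map_tot (A : Subring ℚ) (K : Kb (MHSOne.{u} A)) (hK : acyclic (MHS.one A) K) :
    acyclic (MHS.effective A) ((Kb.map (tot A)).obj K) := hK

lemma trW_map_tot (A : Subring ℚ) :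
    (acyclic (MHS.one.{u} A)).trW.IsInvertedBy (Kb.map (tot A) ⋙ Db.Q (MHS.effective A)) := by
  intro X Y f hf
  obtain ⟨Z, g, h, hT, hZ⟩ := hf
  have h' := (Kb.map (tot A)).map_distinguished _ hT
  exact Localization.inverts (Db.Q (MHS.effective A)) (acyclic (MHS.effective A)).trW _
    (ObjectProperty.trW.mk _ h' (acyclic_map_tot A Z hZ))

/-- The functor `D^b(MHSOne A) ⥤ D^b(MHSEff A)` induced by the inclusion. -/
noncomputable def Tot (A : Subring ℚ) : Db (MHS.one.{u} A) ⥤ Db (MHS.effective.{u} A) :=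
  Localization.lift (Kb.map (tot A) ⋙ Db.Q (MHS.effective A)) (trW_map_tot A)
    (Db.Q (MHS.one A))

/-- The square expressing that `Tot` is induced by the inclusion. -/
noncomputable def Tot.square (A : Subring ℚ) :
    Db.Q (MHS.one.{u} A) ⋙ Tot A ≅ Kb.map (tot A) ⋙ Db.Q (MHS.effective A) :=
  Localization.fac (Kb.map (tot A) ⋙ Db.Q (MHS.effective A)) (trW_map_tot A)
    (Db.Q (MHS.one A))

/-- `p : V ⟶ N` exhibits `N` as the maximal quotient of the effective Hodge structure `V` that is
torsion-free of type `{(0,0), (0,-1), (-1,0), (-1,-1)}`. -/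
def IsMaximalQuotient {A : Subring ℚ} {V : MHSEff.{u} A} {N : MHSOne.{u} A}
    (p : V ⟶ (tot A).obj N) : Prop :=
  Epi p ∧ ∀ (N' : MHSOne.{u} A) (q : V ⟶ (tot A).obj N'), Epi q →
    ∃ h : N ⟶ N', p ≫ (tot A).map h = q

end HodgeAlbanese

open HodgeAlbanese

/-! For a mixed Hodge structure V let `kappa` be the smallest rational subspace of V_ℚ that contains
W_(-3) and, over ℂ, F^0 ∩ W_(-2). In an effective structure all types have p, q ≤ 0, so the types
forbidden in MHS_1 are those of weight ≤ -3 together with (0,-2) and (-2,0). Hence `kappa` is a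
sub-Hodge structure (`isHodgeSub_kappa`), it vanishes exactly when only the four allowed types occur
(`one_iff`), and dividing by it gives the largest quotient with these types.

The central fact is strictness: f(V) ∩ kappa(V') = f(kappa(V)) for every morphism f
(`IsFiltered.strict_kappa`). In weights ≤ -3 it is strictness of the weight filtration. In weight -2
it uses polarizations: the image of Gr f has an orthogonal complement compatible with F
(`IsPolarization.exists_complement`).

All this takes place in the abelian category MHS, whose kernels and cokernels come from the
strictness of morphisms. Strictness rests on a functorial complement of F^p ∩ W_m in W_m, the sum
`tail` of the spaces G^(r-j) ∩ W_(m-j) with G the conjugate of F and r = m + 1 - p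
(`exists_add_tail`, `eq_zero_of_mem_tail`).

For (b), strictness of `kappa` makes V ↦ V / kappa(V) exact. An adjunction between two functors that
both preserve acyclic complexes passes from K^b to D^b, degree by degree; a functor applied
degreewise does not enlarge the range of degrees, whence t-exactness.

For (a), when A is smaller than ℚ the maximal quotient is no longer exact because of torsion. The
inclusion is therefore factored through the category `reduced` of effective structures with `kappa`
= 0, torsion allowed, and each half is fully faithful on D^b by calculus of fractions. First half: a
reduced structure is a quotient of an object of MHS_1 (`exists_epi_of_reduced`) and MHS_1 is closed
under subobjects, so bounded complexes of reduced structures have bounded resolutions by MHS_1.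
Second half: if K → L is a quasi-isomorphism from a reduced complex to an effective one, strictness
of `kappa` on its cone shows that kappa(L) is acyclic over ℚ. A lattice N in kappa(L) that is
acyclic over A is then constructed, and L → L/N is a quasi-isomorphism to a reduced complex
(`exists_reduced_quotient`). -/

namespace HodgeAlbanese

/-! ### Three opposed filtrations -/

section Opposed

variable {k : Type*} [Ring k]
variable {V : Type*} [AddCommGroup V] [Module k V]
variable {V' : Type*} [AddCommGroup V'] [Module k V']
variable {V'' : Type*} [AddCommGroup V''] [Module k V'']

/-- An increasing finite filtration `W` and two decreasing filtrations `F`, `G` such that `F` and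
`G` induce `n`-opposed filtrations on `Gr^W_n` for all `n`. -/
structure Opposed (W F G : ℤ → Submodule k V) : Prop where
  W_mono : Monotone W
  W_bot : ∃ n, W n = ⊥
  W_top : ∃ n, W n = ⊤
  F_anti : Antitone F
  F_bot : ∃ p, F p = ⊥
  F_top : ∃ p, F p = ⊤
  G_anti : Antitone G
  decomp : ∀ n p q, p + q = n + 1 → ∀ x ∈ W n, ∃ a ∈ F p ⊓ W n, ∃ b ∈ G q ⊓ W n,
    x - a - b ∈ W (n - 1)
  inter : ∀ n p q, p + q = n + 1 → ∀ a ∈ F p ⊓ W n, ∀ b ∈ G q ⊓ W n,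
    a - b ∈ W (n - 1) → a ∈ W (n - 1)

/-- A subspace is compatible with the opposed filtrations if the decomposition of `Gr^W_n` can be
performed inside of it. -/
def IsOpposedSub (W F G : ℤ → Submodule k V) (K : Submodule k V) : Prop :=
  ∀ n p q, p + q = n + 1 → ∀ x ∈ W n, x ∈ K → ∃ a ∈ F p ⊓ W n, a ∈ K ∧ ∃ b ∈ G q ⊓ W n,
    b ∈ K ∧ x - a - b ∈ W (n - 1)

/-- The functorial complement `∑ j, G^(r-j) ∩ W_(m-j)` of `F^(m+1-r) ∩ W_m` in `W_m`. -/
def tail (W G : ℤ → Submodule k V) (r m : ℤ) : Submodule k V :=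
  ⨆ j : ℕ, G (r - j) ⊓ W (m - j)

lemma tail_succ (W G : ℤ → Submodule k V) (r m : ℤ) :
    tail W G r m = (G r ⊓ W m) ⊔ tail W G (r - 1) (m - 1) := by
  unfold tail
  rw [← sup_iSup_nat_succ]
  congr 1
  · simp
  · refine iSup_congr fun j => ?_
    congr 2 <;> push_cast <;> ring

lemma tail_mono (W G : ℤ → Submodule k V) (r m : ℤ) (j : ℕ) :
    tail W G (r - j) (m - j) ≤ tail W G r m := by
  induction j with
  | zero => simp
  | succ j ih =>
    refine le_trans ?_ ih
    rw [tail_succ W G (r - j) (m - j)]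
    refine le_trans (le_of_eq ?_) le_sup_right
    congr 1 <;> push_cast <;> ring

lemma map_tail {W G : ℤ → Submodule k V} {W' G' : ℤ → Submodule k V'} {f : V →ₗ[k] V'}
    (hW : ∀ n, W n ≤ (W' n).comap f) (hG : ∀ n, G n ≤ (G' n).comap f) {r m : ℤ} {x : V}
    (hx : x ∈ tail W G r m) : f x ∈ tail W' G' r m := by
  have : tail W G r m ≤ (tail W' G' r m).comap f :=
    iSup_le fun j => (inf_le_inf (hG _) (hW _)).trans
      (Submodule.comap_mono (f := f) (le_iSup (fun j : ℕ => G' (r - j) ⊓ W' (m - j)) j))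
  exact this hx

namespace Opposed

variable {W F G : ℤ → Submodule k V} {W' F' G' : ℤ → Submodule k V'}

lemma tail_le (h : Opposed W F G) (r m : ℤ) : tail W G r m ≤ W m :=
  iSup_le fun j => inf_le_right.trans (h.W_mono (by omega))

/-- Induction on the weight. -/
lemma weight_induction (h : Opposed W F G) {P : ℤ → Prop} (h0 : ∀ n, W n = ⊥ → P n)
    (h1 : ∀ n, P (n - 1) → P n) (n : ℤ) : P n := by
  obtain ⟨m, hm⟩ := h.W_bot
  have hb : ∀ n, n ≤ m → P n := fun n hn => h0 n (le_bot_iff.1 (hm ▸ h.W_mono hn))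
  have key : ∀ j : ℕ, P (m + j) := by
    intro j
    induction j with
    | zero => exact hb _ (by simp)
    | succ j ih => exact h1 _ (by convert ih using 1; push_cast; ring)
  rcases le_total n m with hn | hn
  · exact hb n hn
  · have := key (n - m).toNat
    rwa [Int.toNat_of_nonneg (by omega), add_sub_cancel] at this

/-- Splitting Gr^W_n leaves a remainder in W_(n-1), which is split again with the same `p` and with
`r - 1`; this is the index shift in `tail`. With `eq_zero_of_mem_tail` it makes `tail` a complement
of F^p ∩ W_m, respected by morphisms because only W and G enter its construction. -/
lemma exists_add_tail (h : Opposed W F G) (m : ℤ) : ∀ p r, p + r = m + 1 → ∀ x ∈ W m,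
    ∃ a ∈ F p ⊓ W m, ∃ s ∈ tail W G r m, x = a + s := by
  refine h.weight_induction (P := fun m => ∀ p r, p + r = m + 1 → ∀ x ∈ W m,
    ∃ a ∈ F p ⊓ W m, ∃ s ∈ tail W G r m, x = a + s) ?_ ?_ m
  · intro n hn p r _ x hx
    rw [hn, Submodule.mem_bot] at hx
    exact ⟨0, zero_mem _, 0, zero_mem _, by rw [hx, add_zero]⟩
  · intro n ih p r hpr x hx
    obtain ⟨a, ha, b, hb, hy⟩ := h.decomp n p r hpr x hx
    obtain ⟨a', ha', s, hs, e⟩ := ih p (r - 1) (by omega) _ hy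
    refine ⟨a + a', add_mem ha ⟨ha'.1, h.W_mono (by omega) ha'.2⟩, b + s, ?_, ?_⟩
    · rw [tail_succ]
      exact add_mem (Submodule.mem_sup_left hb) (Submodule.mem_sup_right hs)
    · rw [add_add_add_comm, add_comm a' s, add_comm s a', ← e]
      abel

/-- Modulo W_(n-1) such an element lies in both F^p and G^r, so opposedness pushes it into W_(n-1).
Its leading term `b` drops along with it and is absorbed by the next tail, since G^r ⊂ G^(r-1). -/
lemma eq_zero_of_mem_tail (h : Opposed W F G) (m : ℤ) : ∀ p r, p + r = m + 1 → ∀ x ∈ F p,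
    x ∈ tail W G r m → x = 0 := by
  refine h.weight_induction (P := fun m => ∀ p r, p + r = m + 1 → ∀ x ∈ F p,
    x ∈ tail W G r m → x = 0) ?_ ?_ m
  · intro n hn p r _ x _ hx
    have := h.tail_le _ _ hx
    rwa [hn, Submodule.mem_bot] at this
  · intro n ih p r hpr x hx hxs
    have hxW := h.tail_le _ _ hxs
    rw [tail_succ] at hxs
    obtain ⟨b, hb, s, hs, e⟩ := Submodule.mem_sup.1 hxs
    have hs' := h.tail_le _ _ hs
    have hx1 : x ∈ W (n - 1) := h.inter n p r hpr x ⟨hx, hxW⟩ b hb (by rw [← e]; simpa using hs')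
    have hb1 : b ∈ W (n - 1) := by
      rw [eq_sub_of_add_eq e]
      exact sub_mem hx1 hs'
    refine ih p (r - 1) (by omega) x hx ?_
    rw [← e]
    refine add_mem ?_ hs
    rw [tail_succ]
    exact Submodule.mem_sup_left ⟨h.G_anti (by omega) hb.1, hb1⟩

section Morphism

variable (h : Opposed W F G) (h' : Opposed W' F' G') {f : V →ₗ[k] V'}
  (hW : ∀ n, W n ≤ (W' n).comap f) (hF : ∀ n, F n ≤ (F' n).comap f)
  (hG : ∀ n, G n ≤ (G' n).comap f)

include h h' hW hF hG

/-- The tail component of `x` maps into F'^p ∩ tail' = 0, so the component in F^p has the same image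
as `x`. -/
lemma strict_F {m p : ℤ} {x : V} (hx : x ∈ W m) (hfx : f x ∈ F' p) :
    ∃ a ∈ F p ⊓ W m, f a = f x := by
  obtain ⟨a, ha, s, hs, rfl⟩ := h.exists_add_tail m p (m + 1 - p) (by ring) x hx
  refine ⟨a, ha, ?_⟩
  have : f s = 0 := h'.eq_zero_of_mem_tail m p (m + 1 - p) (by ring) _
    (by simpa using sub_mem hfx (hF _ ha.1)) (map_tail hW hG hs)
  rw [map_add, this, add_zero]

/-- Elements of pure type modulo lower weights, with image of lower weight. -/
lemma strict_pure {m p q : ℤ} (hpq : p + q = m) {a b : V} (ha : a ∈ F p ⊓ W m)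
    (hb : b ∈ G q ⊓ W m) (hab : a - b ∈ W (m - 1)) (hfa : f a ∈ W' (m - 1)) :
    ∃ y ∈ W (m - 1), f y = f a := by
  -- The hypothesis p + q = m is p + q = (m - 1) + 1, the index condition for the splitting of
  -- W_(m-1).
  obtain ⟨c, hc, s, hs, e⟩ := h.exists_add_tail (m - 1) p q (by omega) _ hab
  refine ⟨c, hc.2, ?_⟩
  have hac : a - c = b + s := by rw [sub_eq_iff_eq_add.1 e]; abel
  have hfac : f (a - c) ∈ W' (m - 1) := by
    rw [map_sub]; exact sub_mem hfa (hW _ hc.2)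
  have : f (a - c) = 0 := by
    refine h'.eq_zero_of_mem_tail (m - 1) p q (by omega) _ (hF _ (sub_mem ha.1 hc.1)) ?_
    have hs' : f s ∈ tail W' G' q (m - 1) := map_tail hW hG hs
    have hb' : f b ∈ W' (m - 1) := by
      rw [hac, map_add] at hfac
      simpa using sub_mem hfac (h'.tail_le _ _ hs')
    rw [hac, map_add]
    refine add_mem ?_ hs'
    rw [tail_succ]
    exact Submodule.mem_sup_left ⟨hG _ hb.1, hb'⟩
  rw [map_sub, sub_eq_zero] at this
  exact this.symm

/-- Descending induction on the Hodge level of `x`. After splitting at (p + 1, m - p), the part `a`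
in F^(p+1) falls under the induction hypothesis, and `x - a` is of type (p, m - p) modulo lower
weights, the case of `strict_pure`. -/
lemma strict_W_step {m : ℤ} {x : V} (hx : x ∈ W m) (hfx : f x ∈ W' (m - 1)) :
    ∃ y ∈ W (m - 1), f y = f x := by
  obtain ⟨P, hP⟩ := h.F_bot
  obtain ⟨Q, hQ⟩ := h.F_top
  have main : ∀ j : ℕ, ∀ p, p = P - j → ∀ x ∈ F p ⊓ W m, f x ∈ W' (m - 1) →
      ∃ y ∈ W (m - 1), f y = f x := by
    intro j
    induction j with
    | zero =>
      intro p hp x hx _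
      have hx0 : x = 0 := by
        have : x ∈ F p := hx.1
        rwa [hp, Nat.cast_zero, sub_zero, hP, Submodule.mem_bot] at this
      exact ⟨0, zero_mem _, by rw [hx0]⟩
    | succ j ih =>
      intro p hp x hx hfx
      obtain ⟨a, ha, b, hb, hy⟩ := h.decomp m (p + 1) (m - p) (by ring) x hx.2
      have hfab : f a - -f b ∈ W' (m - 1) := by
        have e : f a - -f b = f x - f (x - a - b) := by simp only [map_sub]; abel
        rw [e]
        exact sub_mem hfx (hW _ hy)
      have hfa : f a ∈ W' (m - 1) :=
        h'.inter m (p + 1) (m - p) (by ring) _ ⟨hF _ ha.1, hW _ ha.2⟩ _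
          ⟨neg_mem (hG _ hb.1), neg_mem (hW _ hb.2)⟩ hfab
      obtain ⟨y₁, hy₁, e₁⟩ := ih (p + 1) (by push_cast at hp ⊢; omega) a ha hfa
      obtain ⟨y₂, hy₂, e₂⟩ := h.strict_pure h' hW hF hG (p := p) (q := m - p) (by ring)
        (a := x - a) (b := b)
        (sub_mem hx ⟨h.F_anti (by omega) ha.1, ha.2⟩) hb hy
        (by rw [map_sub]; exact sub_mem hfx hfa)
      exact ⟨y₁ + y₂, add_mem hy₁ hy₂, by rw [map_add, e₁, e₂, map_sub]; abel⟩
  -- The induction starts at `P`, where F vanishes, and has to reach a level where F is everything.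
  have hm : min P Q ≤ P := min_le_left _ _
  refine main (P - min P Q).toNat (min P Q) (by omega) x ⟨?_, hx⟩ hfx
  have : F (min P Q) = ⊤ := top_le_iff.1 (hQ ▸ h.F_anti (min_le_right _ _))
  rw [this]
  trivial

lemma strict_W {n : ℤ} {x : V} (hfx : f x ∈ W' n) : ∃ y ∈ W n, f y = f x := by
  obtain ⟨M, hM⟩ := h.W_top
  have main : ∀ j : ℕ, ∀ x ∈ W (n + j), f x ∈ W' n → ∃ y ∈ W n, f y = f x := by
    intro j
    induction j with
    | zero => intro x hx _; exact ⟨x, by simpa using hx, rfl⟩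
    | succ j ih =>
      intro x hx hfx
      obtain ⟨y, hy, e⟩ := h.strict_W_step h' hW hF hG hx (h'.W_mono (by push_cast; omega) hfx)
      obtain ⟨z, hz, e'⟩ := ih y (by convert hy using 2; push_cast; ring) (e ▸ hfx)
      exact ⟨z, hz, e'.trans e⟩
  refine main (M - n).toNat x ?_ hfx
  have : W (n + (M - n).toNat) = ⊤ := top_le_iff.1 (hM ▸ h.W_mono (by omega))
  rw [this]
  trivial

/-- On the cokernel of `f` this says that the image of F'^p meets the image of W'_n in the image of
F'^p ∩ W'_n. Split `w` in weight `n` and `z` in a weight where W is everything: once the F-parts are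
removed, what remains of `a` lies both in F'^p and in a tail. -/
lemma strict_FW {n p : ℤ} {a w : V'} {z : V} (ha : a ∈ F' p) (hw : w ∈ W' n)
    (e : a - w = f z) : ∃ a₁ ∈ F' p ⊓ W' n, ∃ z₁, a - a₁ = f z₁ := by
  obtain ⟨M, hM⟩ := h.W_top
  obtain ⟨j, hj⟩ : ∃ j : ℕ, M ≤ n + j := ⟨(M - n).toNat, by omega⟩
  have htop : W (n + j) = ⊤ := top_le_iff.1 (hM ▸ h.W_mono hj)
  obtain ⟨zF, hzF, zS, hzS, ez⟩ := h.exists_add_tail (n + j) p (n + j + 1 - p) (by ring) z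
    (by rw [htop]; trivial)
  obtain ⟨wF, hwF, wS, hwS, ew⟩ := h'.exists_add_tail n p (n + 1 - p) (by ring) w hw
  refine ⟨wF, hwF, zF, ?_⟩
  have e0 : a - wF - f zF = wS + f zS := by
    rw [ez, ew, map_add] at e
    rw [sub_eq_iff_eq_add.1 e]; abel
  have : a - wF - f zF = 0 := by
    refine h'.eq_zero_of_mem_tail (n + j) p (n + j + 1 - p) (by ring) _
      (sub_mem (sub_mem ha hwF.1) (hF _ hzF.1)) ?_
    rw [e0]
    refine add_mem ?_ (map_tail hW hG hzS)
    -- The tail containing `wS` is reached from that of weight `n + j` by `j` shifts, both with the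
    -- same `p`.
    refine tail_mono W' G' _ _ j ?_
    convert hwS using 1
    congr 1 <;> ring
  exact sub_eq_zero.1 this

lemma isOpposedSub_range : IsOpposedSub W' F' G' (LinearMap.range f) := by
  rintro n p q hpq _ hx ⟨z, rfl⟩
  obtain ⟨y, hy, e⟩ := h.strict_W h' hW hF hG hx
  obtain ⟨a, ha, b, hb, hab⟩ := h.decomp n p q hpq y hy
  refine ⟨f a, ⟨hF _ ha.1, hW _ ha.2⟩, ⟨a, rfl⟩, f b, ⟨hG _ hb.1, hW _ hb.2⟩, ⟨b, rfl⟩, ?_⟩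
  rw [← e, ← map_sub, ← map_sub]
  exact hW _ hab

end Morphism

/-- The splitting by F against a G-tail and the one by G against an F-tail are both respected by
`f`, so the components of a kernel element are again in the kernel. The first splitting gives `a`,
the second one, applied to the remainder, gives `b`. -/
lemma isOpposedSub_ker (h : Opposed W F G) (h₂ : Opposed W G F) (h' : Opposed W' F' G')
    (h₂' : Opposed W' G' F') {f : V →ₗ[k] V'}
    (hW : ∀ n, W n ≤ (W' n).comap f) (hF : ∀ n, F n ≤ (F' n).comap f)
    (hG : ∀ n, G n ≤ (G' n).comap f) : IsOpposedSub W F G (LinearMap.ker f) := by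
  intro n p q hpq x hx hfx
  rw [LinearMap.mem_ker] at hfx
  obtain ⟨a, ha, s, hs, rfl⟩ := h.exists_add_tail n p q hpq x hx
  have hfs : f s = 0 := h'.eq_zero_of_mem_tail n p q hpq _
    (by rw [map_add] at hfx
        rw [eq_neg_of_add_eq_zero_right hfx]
        exact neg_mem (hF _ ha.1)) (map_tail hW hG hs)
  have hfa : f a = 0 := by rwa [map_add, hfs, add_zero] at hfx
  obtain ⟨b, hb, t, ht, e⟩ := h₂.exists_add_tail n q p (by omega) s (h.tail_le _ _ hs)
  have hft : f t = 0 := h₂'.eq_zero_of_mem_tail n q p (by omega) _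
    (by rw [e, map_add] at hfs
        rw [eq_neg_of_add_eq_zero_right hfs]
        exact neg_mem (hG _ hb.1)) (map_tail hW hF ht)
  have hfb : f b = 0 := by rwa [e, map_add, hft, add_zero] at hfs
  refine ⟨a, ha, hfa, b, hb, hfb, ?_⟩
  rw [tail_succ] at hs ht
  obtain ⟨c, hc, s', hs', rfl⟩ := Submodule.mem_sup.1 hs
  obtain ⟨d, hd, t', ht', rfl⟩ := Submodule.mem_sup.1 ht
  have hs'' := h.tail_le _ _ hs'
  have ht'' := h₂.tail_le _ _ ht'
  -- Comparing leading terms in `s = b + t`: the element `d` of F^p agrees with `c - b` in G^q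
  -- modulo W_(n-1), so opposedness puts `d` in W_(n-1).
  have e₁ : d - (c - b) = s' - t' := by
    rw [← sub_eq_zero] at e ⊢
    rw [← neg_eq_zero, ← e]; abel
  have hdW : d ∈ W (n - 1) := h.inter n p q hpq d hd (c - b) (sub_mem hc hb)
    (by rw [e₁]; exact sub_mem hs'' ht'')
  have e₂ : a + (c + s') - a - b = d + t' := by rw [e]; abel
  rw [e₂]
  exact add_mem hdW ht''

/-- The filtrations induced on a compatible subspace are opposed. -/
lemma comap (h : Opposed W F G) {i : V' →ₗ[k] V} (hi : Function.Injective i)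
    (hK : IsOpposedSub W F G (LinearMap.range i)) :
    Opposed (fun n => (W n).comap i) (fun n => (F n).comap i) (fun n => (G n).comap i) where
  W_mono _ _ hmn := Submodule.comap_mono (h.W_mono hmn)
  W_bot := h.W_bot.imp fun n hn => by
    rw [hn, Submodule.comap_bot, LinearMap.ker_eq_bot.2 hi]
  W_top := h.W_top.imp fun n hn => by rw [hn, Submodule.comap_top]
  F_anti _ _ hmn := Submodule.comap_mono (h.F_anti hmn)
  F_bot := h.F_bot.imp fun n hn => by
    rw [hn, Submodule.comap_bot, LinearMap.ker_eq_bot.2 hi]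
  F_top := h.F_top.imp fun n hn => by rw [hn, Submodule.comap_top]
  G_anti _ _ hmn := Submodule.comap_mono (h.G_anti hmn)
  decomp n p q hpq x hx := by
    obtain ⟨_, ha, ⟨a, rfl⟩, _, hb, ⟨b, rfl⟩, hab⟩ := hK n p q hpq (i x) hx ⟨x, rfl⟩
    exact ⟨a, ha, b, hb, by simpa [Submodule.mem_comap] using hab⟩
  inter n p q hpq a ha b hb hab :=
    h.inter n p q hpq (i a) ha (i b) hb (by simpa [Submodule.mem_comap] using hab)

/-- The filtrations induced on a cokernel are opposed. -/
lemma map (h : Opposed W F G) (h₂ : Opposed W G F) (h' : Opposed W' F' G')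
    (h₂' : Opposed W' G' F') {f : V →ₗ[k] V'}
    (hW : ∀ n, W n ≤ (W' n).comap f) (hF : ∀ n, F n ≤ (F' n).comap f)
    (hG : ∀ n, G n ≤ (G' n).comap f) {g : V' →ₗ[k] V''} (hg : Function.Surjective g)
    (hfg : LinearMap.ker g = LinearMap.range f) :
    Opposed (fun n => (W' n).map g) (fun n => (F' n).map g) (fun n => (G' n).map g) where
  W_mono _ _ hmn := Submodule.map_mono (h'.W_mono hmn)
  W_bot := h'.W_bot.imp fun n hn => by rw [hn, Submodule.map_bot]
  W_top := h'.W_top.imp fun n hn => by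
    rw [hn, Submodule.map_top, LinearMap.range_eq_top.2 hg]
  F_anti _ _ hmn := Submodule.map_mono (h'.F_anti hmn)
  F_bot := h'.F_bot.imp fun n hn => by rw [hn, Submodule.map_bot]
  F_top := h'.F_top.imp fun n hn => by
    rw [hn, Submodule.map_top, LinearMap.range_eq_top.2 hg]
  G_anti _ _ hmn := Submodule.map_mono (h'.G_anti hmn)
  decomp n p q hpq x hx := by
    obtain ⟨x, hx, rfl⟩ := hx
    obtain ⟨a, ha, b, hb, hab⟩ := h'.decomp n p q hpq x hx
    exact ⟨g a, ⟨⟨a, ha.1, rfl⟩, ⟨a, ha.2, rfl⟩⟩, g b, ⟨⟨b, hb.1, rfl⟩, ⟨b, hb.2, rfl⟩⟩,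
      ⟨_, hab, by simp only [map_sub]⟩⟩
  inter n p q hpq := by
    have hgf : ∀ z, g (f z) = 0 := fun z => LinearMap.mem_ker.1 (hfg ▸ ⟨z, rfl⟩)
    have hgf' : ∀ z, g z = 0 → ∃ y, f y = z := fun z hz =>
      LinearMap.mem_range.1 (hfg ▸ LinearMap.mem_ker.2 hz)
    -- Stated for a general pair of filtrations, to be used once for F and once, with the roles
    -- exchanged, for G.
    have lift : ∀ {F₀ F₀' G₀ G₀' : ℤ → _} (_ : Opposed W F₀ G₀) (_ : Opposed W' F₀' G₀')
        (_ : ∀ n, F₀ n ≤ (F₀' n).comap f) (_ : ∀ n, G₀ n ≤ (G₀' n).comap f) {p : ℤ} {x : V''},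
        x ∈ (F₀' p).map g ⊓ (W' n).map g → ∃ a ∈ F₀' p ⊓ W' n, g a = x := by
      rintro F₀ F₀' G₀ G₀' k k' kF kG p x ⟨⟨a, ha, rfl⟩, ⟨w, hw, e⟩⟩
      obtain ⟨z, hz⟩ := hgf' (a - w) (by rw [map_sub, e, sub_self])
      obtain ⟨a₁, ha₁, z₁, e₁⟩ := k.strict_FW k' hW kF kG ha hw hz.symm
      refine ⟨a₁, ha₁, ?_⟩
      have := hgf z₁
      rw [← e₁, map_sub, sub_eq_zero] at this
      exact this.symm
    intro a ha b hb hab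
    obtain ⟨a, ha', rfl⟩ := lift h h' hF hG ha
    obtain ⟨b, hb', rfl⟩ := lift h₂ h₂' hG hF hb
    obtain ⟨w, hw, e⟩ := hab
    obtain ⟨z, hz⟩ := hgf' (a - b - w) (by rw [map_sub, map_sub, e, sub_self])
    obtain ⟨z, hzW, ez⟩ := h.strict_W h' hW hF hG (n := n) (x := z)
      (by rw [hz]; exact sub_mem (sub_mem ha'.2 hb'.2) (h'.W_mono (by omega) hw))
    rw [hz] at ez
    -- The two parts of `z` correct `a` and `b` by elements of the range of `f`; the corrected pair
    -- is congruent modulo W'_(n-1) and opposedness upstairs applies.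
    obtain ⟨c, hc, d, hd, ht⟩ := h.decomp n p q hpq z hzW
    have : a - f c ∈ W' (n - 1) := by
      refine h'.inter n p q hpq (a - f c) (sub_mem ha' ⟨hF _ hc.1, hW _ hc.2⟩) (b + f d)
        (add_mem hb' ⟨hG _ hd.1, hW _ hd.2⟩) ?_
      have e₁ : a - f c - (b + f d) = w + f (z - c - d) := by
        rw [map_sub, map_sub, ez]; abel
      rw [e₁]
      exact add_mem hw (hW _ ht)
    exact ⟨a - f c, this, by rw [map_sub, hgf, sub_zero]⟩

end Opposed

end Opposed

/-! ### Base change of subspaces -/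

section BaseChange

variable {R S M N : Type*} [CommRing R] [CommRing S] [Algebra R S]
  [AddCommGroup M] [Module R M] [AddCommGroup N] [Module R N]

lemma baseChange_map_eq (g : M →ₗ[R] N) (p : Submodule R M) :
    (p.map g).baseChange S = (p.baseChange S).map (g.baseChange S) := by
  simp only [Submodule.baseChange_eq_span, Submodule.map_span]
  congr 1
  ext x
  constructor
  · rintro ⟨_, ⟨m, hm, rfl⟩, rfl⟩
    exact ⟨1 ⊗ₜ m, ⟨m, hm, rfl⟩, by simp⟩
  · rintro ⟨_, ⟨m, hm, rfl⟩, rfl⟩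
    exact ⟨g m, ⟨m, hm, rfl⟩, by simp⟩

lemma range_baseChange_eq (g : M →ₗ[R] N) :
    LinearMap.range (g.baseChange S) = (LinearMap.range g).baseChange S := by
  rw [LinearMap.range_eq_map g, baseChange_map_eq, Submodule.baseChange_top,
    LinearMap.range_eq_map]

lemma ker_baseChange_eq [Module.Flat R S] (g : M →ₗ[R] N) :
    LinearMap.ker (g.baseChange S) = (LinearMap.ker g).baseChange S :=
  Module.Flat.ker_lTensor_eq S S g

/-- A preimage is the kernel of the composite with the quotient map, and flat base change preserves
kernels. -/
lemma comap_baseChange_eq [Module.Flat R S] (g : M →ₗ[R] N) (p : Submodule R N) :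
    (p.comap g).baseChange S = (p.baseChange S).comap (g.baseChange S) := by
  have e : ∀ (L : Type _) [AddCommGroup L] [Module R L] (f : L →ₗ[R] N),
      (p.comap f).baseChange S = LinearMap.ker ((p.mkQ ∘ₗ f).baseChange S) := by
    intro L _ _ f
    rw [ker_baseChange_eq, LinearMap.ker_comp, Submodule.ker_mkQ]
  have e' : p.baseChange S = LinearMap.ker (p.mkQ.baseChange S) := by
    rw [ker_baseChange_eq, Submodule.ker_mkQ]
  rw [e, e', LinearMap.baseChange_comp, LinearMap.ker_comp]

lemma sup_baseChange_eq (p q : Submodule R M) :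
    (p ⊔ q).baseChange S = p.baseChange S ⊔ q.baseChange S := by
  refine le_antisymm ?_ (sup_le (Submodule.baseChange_mono _ le_sup_left)
    (Submodule.baseChange_mono _ le_sup_right))
  rw [Submodule.baseChange_eq_span, Submodule.span_le]
  rintro _ ⟨x, hx, rfl⟩
  obtain ⟨y, hy, z, hz, rfl⟩ := Submodule.mem_sup.1 hx
  rw [map_add]
  exact add_mem (Submodule.mem_sup_left (Submodule.tmul_mem_baseChange_of_mem _ hy))
    (Submodule.mem_sup_right (Submodule.tmul_mem_baseChange_of_mem _ hz))

lemma baseChange_injective_of_injective [Module.Flat R S] {g : M →ₗ[R] N}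
    (hg : Function.Injective g) : Function.Injective (g.baseChange S) :=
  Module.Flat.lTensor_preserves_injective_linearMap (M := S) g hg

lemma baseChange_surjective_of_surjective {g : M →ₗ[R] N}
    (hg : Function.Surjective g) : Function.Surjective (g.baseChange S) :=
  LinearMap.lTensor_surjective S hg

/-- Descent from ℂ to ℚ: statements on rational subspaces are proved after complexification, where
the Hodge filtration lives, and brought back by faithful flatness. -/
lemma one_tmul_mem_baseChange_iff [Module.FaithfullyFlat R S] (p : Submodule R M) (x : M) :
    (1 : S) ⊗ₜ[R] x ∈ p.baseChange S ↔ x ∈ p := by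
  refine ⟨fun h => ?_, fun h => Submodule.tmul_mem_baseChange_of_mem _ h⟩
  have e' : p.baseChange S = LinearMap.ker (p.mkQ.baseChange S) := by
    rw [ker_baseChange_eq, Submodule.ker_mkQ]
  rw [e', LinearMap.mem_ker, LinearMap.baseChange_tmul,
    Module.FaithfullyFlat.one_tmul_eq_zero_iff] at h
  simpa using h

end BaseChange

/-! ### Mixed Hodge structures as opposed filtrations -/

section Hodge

variable {H : Type u} [AddCommGroup H] [Module ℚ H]
variable {H' : Type u} [AddCommGroup H'] [Module ℚ H']
variable {H'' : Type u} [AddCommGroup H''] [Module ℚ H'']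

lemma conj_conj (x : ℂ ⊗[ℚ] H) : conj H (conj H x) = x := by
  induction x with
  | zero => simp
  | tmul z v => simp
  | add x y hx hy => rw [map_add, map_add, hx, hy]

lemma conj_mem_conjSubspace {S : Submodule ℂ (ℂ ⊗[ℚ] H)} {x : ℂ ⊗[ℚ] H} :
    conj H x ∈ conjSubspace S ↔ x ∈ S := by
  rw [mem_conjSubspace, conj_conj]

lemma conjSubspace_bot : conjSubspace (⊥ : Submodule ℂ (ℂ ⊗[ℚ] H)) = ⊥ := by
  rw [Submodule.eq_bot_iff]
  intro x hx
  rw [mem_conjSubspace, Submodule.mem_bot] at hx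
  rw [← conj_conj x, hx, map_zero]

lemma conjSubspace_top : conjSubspace (⊤ : Submodule ℂ (ℂ ⊗[ℚ] H)) = ⊤ := rfl

lemma conjSubspace_mono {S T : Submodule ℂ (ℂ ⊗[ℚ] H)} (h : S ≤ T) :
    conjSubspace S ≤ conjSubspace T := fun _ hx => h hx

lemma conjSubspace_baseChange (K : Submodule ℚ H) :
    conjSubspace (K.baseChange ℂ) = K.baseChange ℂ := by
  have : ∀ x ∈ K.baseChange ℂ, conj H x ∈ K.baseChange ℂ := by
    rintro _ ⟨y, rfl⟩
    rw [conj_baseChange]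
    exact ⟨_, rfl⟩
  ext x
  exact ⟨fun h => by have := this _ h; rwa [conj_conj] at this, this x⟩

lemma conj_mem_baseChange {K : Submodule ℚ H} {x : ℂ ⊗[ℚ] H} (hx : x ∈ K.baseChange ℂ) :
    conj H x ∈ K.baseChange ℂ := by
  rwa [← mem_conjSubspace, conjSubspace_baseChange]

lemma conjSubspace_comap (g : H →ₗ[ℚ] H') (S : Submodule ℂ (ℂ ⊗[ℚ] H')) :
    conjSubspace (S.comap (g.baseChange ℂ)) = (conjSubspace S).comap (g.baseChange ℂ) := by
  ext x
  rw [mem_conjSubspace, Submodule.mem_comap, Submodule.mem_comap, mem_conjSubspace,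
    conj_baseChange]

lemma conjSubspace_map (g : H →ₗ[ℚ] H') (S : Submodule ℂ (ℂ ⊗[ℚ] H)) :
    conjSubspace (S.map (g.baseChange ℂ)) = (conjSubspace S).map (g.baseChange ℂ) := by
  ext x
  rw [mem_conjSubspace]
  constructor
  · rintro ⟨y, hy, e⟩
    exact ⟨conj H y, conj_mem_conjSubspace.2 hy, by rw [← conj_baseChange, e, conj_conj]⟩
  · rintro ⟨y, hy, rfl⟩
    exact ⟨conj H y, hy, (conj_baseChange g y).symm⟩

/-- The complexification of a rational filtration. -/
noncomputable abbrev complexify (W : ℤ → Submodule ℚ H) (n : ℤ) : Submodule ℂ (ℂ ⊗[ℚ] H) :=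
  (W n).baseChange ℂ

/-- The complex conjugate filtration. -/
noncomputable abbrev conjFil (F : ℤ → Submodule ℂ (ℂ ⊗[ℚ] H)) (p : ℤ) :
    Submodule ℂ (ℂ ⊗[ℚ] H) := conjSubspace (F p)

lemma conjSubspace_grF (W : ℤ → Submodule ℚ H) (F : ℤ → Submodule ℂ (ℂ ⊗[ℚ] H)) (n p : ℤ) :
    conjSubspace (grF W F n p) = grF W (conjFil F) n p := by
  rw [grF, grF, conjSubspace_map, conjSubspace_comap]

/-- Turns identities in the complexified Gr^W_n into congruences modulo W_(n-1) in H_ℂ. In this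
language purity of all graded pieces is opposedness of F and its conjugate. -/
lemma mkQ_eq_zero_iff (W : ℤ → Submodule ℚ H) (n : ℤ) (y : ℂ ⊗[ℚ] W n) :
    ((W (n - 1)).submoduleOf (W n)).mkQ.baseChange ℂ y = 0 ↔
      (W n).subtype.baseChange ℂ y ∈ complexify W (n - 1) := by
  rw [← LinearMap.mem_ker, ker_baseChange_eq, Submodule.ker_mkQ, Submodule.submoduleOf,
    comap_baseChange_eq, Submodule.mem_comap]

lemma mkQ_mem_grF_iff (W : ℤ → Submodule ℚ H) (F : ℤ → Submodule ℂ (ℂ ⊗[ℚ] H)) (n p : ℤ)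
    (y : ℂ ⊗[ℚ] W n) :
    ((W (n - 1)).submoduleOf (W n)).mkQ.baseChange ℂ y ∈ grF W F n p ↔
      ∃ a ∈ F p ⊓ complexify W n,
        (W n).subtype.baseChange ℂ y - a ∈ complexify W (n - 1) := by
  constructor
  · rintro ⟨a, ha, e⟩
    refine ⟨_, ⟨ha, ⟨a, rfl⟩⟩, ?_⟩
    rw [← map_sub, ← mkQ_eq_zero_iff, map_sub, e, sub_self]
  · rintro ⟨_, ⟨ha, ⟨a, rfl⟩⟩, e⟩
    refine ⟨a, ha, ?_⟩
    rw [← map_sub, ← mkQ_eq_zero_iff, map_sub, sub_eq_zero] at e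
    exact e.symm

section

variable {W : ℤ → Submodule ℚ H} {F : ℤ → Submodule ℂ (ℂ ⊗[ℚ] H)}

lemma mkQ_baseChange_surjective (W : ℤ → Submodule ℚ H) (n : ℤ) :
    Function.Surjective (((W (n - 1)).submoduleOf (W n)).mkQ.baseChange ℂ) :=
  baseChange_surjective_of_surjective (Submodule.mkQ_surjective _)

lemma decomp_of_isPure {n : ℤ} (h : IsPure (grF W F n) n) {p q : ℤ} (hpq : p + q = n + 1)
    {x : ℂ ⊗[ℚ] H} (hx : x ∈ complexify W n) : ∃ a ∈ F p ⊓ complexify W n,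
      ∃ b ∈ conjFil F q ⊓ complexify W n, x - a - b ∈ complexify W (n - 1) := by
  obtain ⟨y, rfl⟩ := hx
  have hc := h p
  rw [show n + 1 - p = q by omega, conjSubspace_grF] at hc
  have ht : ((W (n - 1)).submoduleOf (W n)).mkQ.baseChange ℂ y ∈ grF W F n p ⊔
      grF W (conjFil F) n q := by
    rw [codisjoint_iff.1 hc.codisjoint]; trivial
  obtain ⟨_, ⟨a, ha, rfl⟩, _, ⟨b, hb, rfl⟩, e⟩ := Submodule.mem_sup.1 ht
  refine ⟨_, ⟨ha, ⟨a, rfl⟩⟩, _, ⟨hb, ⟨b, rfl⟩⟩, ?_⟩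
  rw [← map_sub, ← map_sub, ← mkQ_eq_zero_iff, map_sub, map_sub, ← e]
  abel

lemma inter_of_isPure {n : ℤ} (h : IsPure (grF W F n) n) {p q : ℤ} (hpq : p + q = n + 1)
    {a b : ℂ ⊗[ℚ] H} (ha : a ∈ F p ⊓ complexify W n) (hb : b ∈ conjFil F q ⊓ complexify W n)
    (hab : a - b ∈ complexify W (n - 1)) : a ∈ complexify W (n - 1) := by
  obtain ⟨ha, ⟨a, rfl⟩⟩ := ha
  obtain ⟨hb, ⟨b, rfl⟩⟩ := hb
  have hc := h p
  rw [show n + 1 - p = q by omega, conjSubspace_grF] at hc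
  rw [← mkQ_eq_zero_iff]
  refine Submodule.disjoint_def.1 hc.disjoint _ ⟨a, ha, rfl⟩ ⟨b, hb, ?_⟩
  rw [← map_sub, ← mkQ_eq_zero_iff, map_sub, sub_eq_zero] at hab
  exact hab.symm

lemma IsPolarizableMixedHodge.opposed (h : IsPolarizableMixedHodge W F) :
    Opposed (complexify W) F (conjFil F) where
  W_mono _ _ hmn := Submodule.baseChange_mono _ (h.W_mono hmn)
  W_bot := h.W_bot.imp fun n hn => by rw [complexify, hn, Submodule.baseChange_bot]
  W_top := h.W_top.imp fun n hn => by rw [complexify, hn, Submodule.baseChange_top]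
  F_anti := h.F_anti
  F_bot := h.F_bot
  F_top := h.F_top
  G_anti _ _ hmn := conjSubspace_mono (h.F_anti hmn)
  decomp n _ _ hpq _ hx := decomp_of_isPure (h.pure n) hpq hx
  inter n _ _ hpq _ ha _ hb hab := inter_of_isPure (h.pure n) hpq ha hb hab

lemma _root_.HodgeAlbanese.Opposed.swap (h : Opposed (complexify W) F (conjFil F)) :
    Opposed (complexify W) (conjFil F) F where
  W_mono := h.W_mono
  W_bot := h.W_bot
  W_top := h.W_top
  F_anti := h.G_anti
  F_bot := h.F_bot.imp fun n hn => by rw [conjFil, hn, conjSubspace_bot]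
  F_top := h.F_top.imp fun n hn => by rw [conjFil, hn, conjSubspace_top]
  G_anti := h.F_anti
  decomp n p q hpq x hx := by
    obtain ⟨a, ha, b, hb, hab⟩ := h.decomp n q p (by omega) x hx
    exact ⟨b, hb, a, ha, by rwa [sub_right_comm]⟩
  inter n p q hpq a ha b hb hab := by
    have := h.inter n q p (by omega) b hb a ha (by rw [← neg_sub a b]; exact neg_mem hab)
    simpa using add_mem hab this

lemma Opposed.isPure (h : Opposed (complexify W) F (conjFil F)) (n : ℤ) :
    IsPure (grF W F n) n := by
  intro p
  rw [conjSubspace_grF]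
  constructor
  · rw [Submodule.disjoint_def]
    rintro _ ⟨a, ha, rfl⟩ ⟨b, hb, e⟩
    rw [mkQ_eq_zero_iff]
    refine h.inter n p (n + 1 - p) (by ring) _ ⟨ha, ⟨a, rfl⟩⟩ _ ⟨hb, ⟨b, rfl⟩⟩ ?_
    rw [← map_sub, ← mkQ_eq_zero_iff, map_sub, e, sub_self]
  · rw [codisjoint_iff, Submodule.eq_top_iff']
    intro x
    obtain ⟨y, rfl⟩ := mkQ_baseChange_surjective W n x
    obtain ⟨_, ⟨ha, ⟨a, rfl⟩⟩, _, ⟨hb, ⟨b, rfl⟩⟩, hab⟩ :=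
      h.decomp n p (n + 1 - p) (by ring) _ ⟨y, rfl⟩
    refine Submodule.mem_sup.2 ⟨_, ⟨a, ha, rfl⟩, _, ⟨b, hb, rfl⟩, ?_⟩
    rw [← map_sub, ← map_sub, ← mkQ_eq_zero_iff, map_sub, map_sub, sub_sub, sub_eq_zero] at hab
    exact hab.symm

end

section Morphism

variable {W : ℤ → Submodule ℚ H} {F : ℤ → Submodule ℂ (ℂ ⊗[ℚ] H)}
  {W' : ℤ → Submodule ℚ H'} {F' : ℤ → Submodule ℂ (ℂ ⊗[ℚ] H')}
  {f : H →ₗ[ℚ] H'}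

namespace IsFiltered

lemma le_comap_F (hf : IsFiltered W F W' F' f) (p : ℤ) :
    F p ≤ (F' p).comap (f.baseChange ℂ) := fun x hx => hf.2 p x hx

lemma le_comap_conjFil (hf : IsFiltered W F W' F' f) (p : ℤ) :
    conjFil F p ≤ (conjFil F' p).comap (f.baseChange ℂ) := fun x hx => by
  rw [Submodule.mem_comap, mem_conjSubspace, conj_baseChange]
  exact hf.2 p _ hx

lemma le_comap_complexify (hf : IsFiltered W F W' F' f) (n : ℤ) :
    complexify W n ≤ (complexify W' n).comap (f.baseChange ℂ) := by
  rw [complexify, complexify, ← comap_baseChange_eq]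
  exact Submodule.baseChange_mono _ (hf.1 n)

variable (hf : IsFiltered W F W' F' f) (h : IsPolarizableMixedHodge W F)
  (h' : IsPolarizableMixedHodge W' F')

include hf h h'

/-- Morphisms of mixed Hodge structures are strict for the Hodge filtration, on each `W_n`. -/
lemma strict_F {m p : ℤ} {x : ℂ ⊗[ℚ] H} (hx : x ∈ complexify W m)
    (hfx : f.baseChange ℂ x ∈ F' p) :
    ∃ a ∈ F p ⊓ complexify W m, f.baseChange ℂ a = f.baseChange ℂ x :=
  h.opposed.strict_F h'.opposed hf.le_comap_complexify hf.le_comap_F hf.le_comap_conjFil hx hfx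

lemma strict_F_top {p : ℤ} {x : ℂ ⊗[ℚ] H} (hfx : f.baseChange ℂ x ∈ F' p) :
    ∃ a ∈ F p, f.baseChange ℂ a = f.baseChange ℂ x := by
  obtain ⟨m, hm⟩ := h.opposed.W_top
  obtain ⟨a, ha, e⟩ := hf.strict_F h h' (m := m) (x := x) (by rw [hm]; trivial) hfx
  exact ⟨a, ha.1, e⟩

lemma strict_complexify {n : ℤ} {x : ℂ ⊗[ℚ] H} (hfx : f.baseChange ℂ x ∈ complexify W' n) :
    ∃ a ∈ complexify W n, f.baseChange ℂ a = f.baseChange ℂ x :=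
  h.opposed.strict_W h'.opposed hf.le_comap_complexify hf.le_comap_F hf.le_comap_conjFil hfx

/-- Morphisms of mixed Hodge structures are strict for the weight filtration. -/
lemma strict_W {n : ℤ} {x : H} (hfx : f x ∈ W' n) : ∃ y ∈ W n, f y = f x := by
  obtain ⟨a, ha, e⟩ := hf.strict_complexify h h' (n := n) (x := 1 ⊗ₜ x)
    (by rw [LinearMap.baseChange_tmul]; exact Submodule.tmul_mem_baseChange_of_mem _ hfx)
  have : (1 : ℂ) ⊗ₜ[ℚ] f x ∈ ((W n).map f).baseChange ℂ := by
    rw [baseChange_map_eq]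
    exact ⟨a, ha, by rw [e, LinearMap.baseChange_tmul]⟩
  rw [one_tmul_mem_baseChange_iff] at this
  exact this

end IsFiltered

/-- A rational subspace to which the Hodge structure can be restricted. -/
def IsHodgeSub (W : ℤ → Submodule ℚ H) (F : ℤ → Submodule ℂ (ℂ ⊗[ℚ] H)) (K : Submodule ℚ H) :
    Prop :=
  IsOpposedSub (complexify W) F (conjFil F) (K.baseChange ℂ)

lemma IsFiltered.isHodgeSub_ker (hf : IsFiltered W F W' F' f) (h : IsPolarizableMixedHodge W F)
    (h' : IsPolarizableMixedHodge W' F') : IsHodgeSub W F (LinearMap.ker f) := by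
  rw [IsHodgeSub, ← ker_baseChange_eq]
  exact h.opposed.isOpposedSub_ker h.opposed.swap h'.opposed h'.opposed.swap
    hf.le_comap_complexify hf.le_comap_F hf.le_comap_conjFil

lemma IsFiltered.isHodgeSub_range (hf : IsFiltered W F W' F' f)
    (h : IsPolarizableMixedHodge W F) (h' : IsPolarizableMixedHodge W' F') :
    IsHodgeSub W' F' (LinearMap.range f) := by
  rw [IsHodgeSub, ← range_baseChange_eq]
  exact h.opposed.isOpposedSub_range h'.opposed
    hf.le_comap_complexify hf.le_comap_F hf.le_comap_conjFil

end Morphism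

/-! ### Polarizations -/

section Polarization

variable {G G' : Type u} [AddCommGroup G] [Module ℚ G] [AddCommGroup G'] [Module ℚ G']
  {F : ℤ → Submodule ℂ (ℂ ⊗[ℚ] G)} {F' : ℤ → Submodule ℂ (ℂ ⊗[ℚ] G')} {n : ℤ}
  {B : LinearMap.BilinForm ℚ G}

lemma baseChange_comp_apply (B : LinearMap.BilinForm ℚ G) (α : G' →ₗ[ℚ] G) (x y : ℂ ⊗[ℚ] G') :
    (B.comp α α).baseChange ℂ x y = B.baseChange ℂ (α.baseChange ℂ x) (α.baseChange ℂ y) := by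
  induction x with
  | zero => simp
  | add x x' hx hx' => simp only [map_add, LinearMap.add_apply, hx, hx']
  | tmul z v =>
    induction y with
    | zero => simp
    | add y y' hy hy' => simp only [map_add, hy, hy']
    | tmul w v' => simp

lemma baseChange_conj_conj (B : LinearMap.BilinForm ℚ G) (x y : ℂ ⊗[ℚ] G) :
    B.baseChange ℂ (conj G x) (conj G y) = starRingEnd ℂ (B.baseChange ℂ x y) := by
  induction x with
  | zero => simp
  | add x x' hx hx' => simp only [map_add, LinearMap.add_apply, hx, hx']
  | tmul z v =>
    induction y with
    | zero => simp
    | add y y' hy hy' => simp only [map_add, hy, hy']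
    | tmul w v' => simp [Algebra.smul_def]

/-- A polarization restricts along injective morphisms. -/
lemma IsPolarization.comp (hB : IsPolarization F n B) {α : G' →ₗ[ℚ] G}
    (hα : Function.Injective α) (hF : ∀ p, ∀ x ∈ F' p, α.baseChange ℂ x ∈ F p) :
    IsPolarization F' n (B.comp α α) where
  symm x y := hB.symm _ _
  orthogonal p x hx y hy := by
    rw [baseChange_comp_apply]
    exact hB.orthogonal p _ (hF _ _ hx) _ (hF _ _ hy)
  positive p x hx hx0 := by
    obtain ⟨r, hr, e⟩ := hB.positive p (α.baseChange ℂ x) ⟨hF _ _ hx.1, by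
        change conj G _ ∈ F _; rw [conj_baseChange]; exact hF _ _ hx.2⟩
      (fun h => hx0 (baseChange_injective_of_injective hα (by rw [h, map_zero])))
    exact ⟨r, hr, by rw [← e, baseChange_comp_apply, conj_baseChange]⟩

lemma IsPolarization.orthogonal_conj (hB : IsPolarization F n B) {p q : ℤ} (hpq : p + q = n + 1)
    {x y : ℂ ⊗[ℚ] G} (hx : x ∈ conjSubspace (F p)) (hy : y ∈ conjSubspace (F q)) :
    B.baseChange ℂ x y = 0 := by
  rw [← conj_conj x, ← conj_conj y, baseChange_conj_conj,
    hB.orthogonal p _ hx _ (by rw [show n + 1 - p = q by omega]; exact hy), map_zero]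

/-- A polarization is nondegenerate on the image of a morphism of pure Hodge structures. -/
lemma IsPolarization.eq_zero_of_mem_range (hB : IsPolarization F n B) (hF' : IsPure F' n)
    (hb : ∃ p, F' p = ⊥) (ht : ∃ p, F' p = ⊤) (hanti : Antitone F') {φ : G' →ₗ[ℚ] G}
    (hφ : ∀ p, ∀ x ∈ F' p, φ.baseChange ℂ x ∈ F p) {x : ℂ ⊗[ℚ] G'}
    (hx : ∀ y, B.baseChange ℂ (φ.baseChange ℂ x) (φ.baseChange ℂ y) = 0) :
    φ.baseChange ℂ x = 0 := by
  have hφ' : ∀ p, ∀ x ∈ conjSubspace (F' p), φ.baseChange ℂ x ∈ conjSubspace (F p) := by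
    intro p x hx
    rw [mem_conjSubspace, conj_baseChange]
    exact hφ _ _ hx
  have split : ∀ p q, p + q = n + 1 → ∀ x, ∃ a ∈ F' p, ∃ b ∈ conjSubspace (F' q), a + b = x := by
    intro p q hpq x
    have h1 : x ∈ F' p ⊔ conjSubspace (F' (n + 1 - p)) := by
      rw [codisjoint_iff.1 (hF' p).codisjoint]; trivial
    rw [show n + 1 - p = q by omega] at h1
    exact Submodule.mem_sup.1 h1
  obtain ⟨P, hP⟩ := hb
  obtain ⟨Q, hQ⟩ := ht
  -- Descending induction on the Hodge level, reducing to a vector of type (p, n - p), where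
  -- positivity applies.
  have main : ∀ j : ℕ, ∀ p, p = P - j → ∀ x ∈ F' p,
      (∀ y, B.baseChange ℂ (φ.baseChange ℂ x) (φ.baseChange ℂ y) = 0) →
      φ.baseChange ℂ x = 0 := by
    intro j
    induction j with
    | zero =>
      intro p hp x hx _
      rw [hp, Nat.cast_zero, sub_zero, hP, Submodule.mem_bot] at hx
      rw [hx, map_zero]
    | succ j ih =>
      intro p hp x hxF hx
      obtain ⟨a, ha, b, hb, e⟩ := split (p + 1) (n - p) (by ring) x
      have hxab : φ.baseChange ℂ x = φ.baseChange ℂ a + φ.baseChange ℂ b := by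
        rw [← e, map_add]
      have ha0 : φ.baseChange ℂ a = 0 := by
        refine ih (p + 1) (by push_cast at hp ⊢; omega) a ha fun y => ?_
        obtain ⟨c, hc, d, hd, rfl⟩ := split (n - p) (p + 1) (by ring) y
        rw [map_add, map_add, hB.orthogonal (p + 1) _ (hφ _ _ ha) _
          (by rw [show n + 1 - (p + 1) = n - p by ring]; exact hφ _ _ hc), zero_add]
        -- Against `φ d`, the vectors `φ a` and `φ x` pair equally, because `φ b` is orthogonal to
        -- `φ d` by the conjugate bilinear relation.
        have h1 := hx d
        rwa [hxab, map_add, LinearMap.add_apply,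
          hB.orthogonal_conj (by ring) (hφ' _ _ hb) (hφ' _ _ hd), add_zero] at h1
      rw [ha0, zero_add] at hxab
      -- Now `φ x = φ b` lies in F^p and in the conjugate of F^(n-p). Its conjugate is again in the
      -- image of `φ`, where the pairing with `φ x` vanishes, against positivity.
      by_contra hne
      obtain ⟨r, hr, er⟩ := hB.positive p (φ.baseChange ℂ x)
        ⟨hφ _ _ hxF, by rw [hxab]; exact hφ' _ _ hb⟩ hne
      rw [conj_baseChange, hx, mul_zero] at er
      exact hr.ne (by exact_mod_cast er)
  have hm : min P Q ≤ P := min_le_left _ _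
  refine main (P - min P Q).toNat (min P Q) (by omega) x ?_ hx
  have : F' (min P Q) = ⊤ := top_le_iff.1 (hQ ▸ hanti (min_le_right _ _))
  rw [this]
  trivial

/-- The image of a morphism of polarized pure Hodge structures has an orthogonal complement that
is compatible with the Hodge filtrations. -/
lemma IsPolarization.exists_complement [Module.Finite ℚ G] (hB : IsPolarization F n B)
    (hF' : IsPure F' n)
    (hb : ∃ p, F' p = ⊥) (ht : ∃ p, F' p = ⊤) (hanti : Antitone F') {φ : G' →ₗ[ℚ] G}
    (hφ : ∀ p, ∀ x ∈ F' p, φ.baseChange ℂ x ∈ F p) :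
    ∃ M : Submodule ℚ G, IsCompl (LinearMap.range φ) M ∧
      ∀ p, ∀ x ∈ F p, ∃ a ∈ F' p, x - φ.baseChange ℂ a ∈ M.baseChange ℂ := by
  have hrefl : B.IsRefl := by
    intro x y h
    rw [hB.symm, h, mul_zero]
  have hnd := fun x => hB.eq_zero_of_mem_range hF' hb ht hanti hφ (x := x)
  -- The form is nondegenerate on the image of `φ`, by positivity, so the orthogonal of the image is
  -- a complement.
  have hcompl : IsCompl (LinearMap.range φ) (B.orthogonal (LinearMap.range φ)) := by
    refine LinearMap.BilinForm.isCompl_orthogonal_of_restrict_nondegenerate hrefl ?_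
    have hr : LinearMap.IsRefl (B.restrict (LinearMap.range φ)) := fun x y h => hrefl _ _ h
    refine hr.nondegenerate_iff_separatingLeft.2 ?_
    rintro ⟨_, x, rfl⟩ hx
    have hz : φ.baseChange ℂ (1 ⊗ₜ[ℚ] x) = 0 := by
      refine hnd _ fun y => ?_
      induction y with
      | zero => simp
      | add y y' hy hy' => simp only [map_add, hy, hy', add_zero]
      | tmul z v =>
        have := hx ⟨φ v, v, rfl⟩
        change B (φ x) (φ v) = 0 at this
        simp [this]
    rw [LinearMap.baseChange_tmul, Module.FaithfullyFlat.one_tmul_eq_zero_iff] at hz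
    exact Subtype.ext hz
  refine ⟨_, hcompl, fun p x hx => ?_⟩
  have hMorth : ∀ m ∈ (B.orthogonal (LinearMap.range φ)).baseChange ℂ, ∀ y,
      B.baseChange ℂ m (φ.baseChange ℂ y) = 0 := by
    rintro _ ⟨m, rfl⟩ y
    induction m with
    | zero => simp
    | add m m' h h' => simp only [map_add, LinearMap.add_apply, h, h', add_zero]
    | tmul z m =>
      induction y with
      | zero => simp
      | add y y' hy hy' => simp only [map_add, hy, hy', add_zero]
      | tmul w v =>
        have : B (φ v) m = 0 := m.2 (φ v) ⟨v, rfl⟩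
        have : B m (φ v) = 0 := hrefl _ _ this
        simp [this]
  have hxt : x ∈ (LinearMap.range φ).baseChange ℂ ⊔
      (B.orthogonal (LinearMap.range φ)).baseChange ℂ := by
    rw [← sup_baseChange_eq, codisjoint_iff.1 hcompl.codisjoint, Submodule.baseChange_top]
    trivial
  rw [← range_baseChange_eq] at hxt
  obtain ⟨_, ⟨ν, rfl⟩, m, hm, e⟩ := Submodule.mem_sup.1 hxt
  have split : ∀ p q, p + q = n + 1 → ∀ x, ∃ a ∈ F' p, ∃ b ∈ conjSubspace (F' q), a + b = x := by
    intro p q hpq x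
    have h1 : x ∈ F' p ⊔ conjSubspace (F' (n + 1 - p)) := by
      rw [codisjoint_iff.1 (hF' p).codisjoint]; trivial
    rw [show n + 1 - p = q by omega] at h1
    exact Submodule.mem_sup.1 h1
  have hφ' : ∀ p, ∀ x ∈ conjSubspace (F' p), φ.baseChange ℂ x ∈ conjSubspace (F p) := by
    intro p x hx
    rw [mem_conjSubspace, conj_baseChange]
    exact hφ _ _ hx
  obtain ⟨a, ha, b, hb', rfl⟩ := split p (n + 1 - p) (by ring) ν
  -- The conjugate part of `ν` dies. Against `φ d` this is the conjugate bilinear relation; against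
  -- `φ c` one writes `φ b = x - m - φ a`, three vectors orthogonal to `φ c`. So the projection of
  -- F^p to the image lies in the image of F'^p.
  have hb0 : φ.baseChange ℂ b = 0 := by
    refine hnd _ fun u => ?_
    obtain ⟨c, hc, d, hd, rfl⟩ := split (n + 1 - p) p (by ring) u
    rw [map_add, map_add, hB.orthogonal_conj (by ring) (hφ' _ _ hb') (hφ' _ _ hd), add_zero]
    have e1 : φ.baseChange ℂ b = x - m - φ.baseChange ℂ a := by
      rw [← e, map_add]; abel
    rw [e1, map_sub, map_sub, LinearMap.sub_apply, LinearMap.sub_apply,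
      hB.orthogonal p _ hx _ (hφ _ _ hc), hMorth m hm,
      hB.orthogonal p _ (hφ _ _ ha) _ (hφ _ _ hc)]
    simp
  refine ⟨a, ha, ?_⟩
  rw [← e, map_add, hb0, add_zero, add_sub_cancel_left]
  exact hm

end Polarization

end Hodge

/-! ### Subobjects and quotients of mixed Hodge structures -/

section SubQuotient

variable {H : Type u} [AddCommGroup H] [Module ℚ H]
variable {H' : Type u} [AddCommGroup H'] [Module ℚ H']
variable {H'' : Type u} [AddCommGroup H''] [Module ℚ H'']
variable {W : ℤ → Submodule ℚ H} {F : ℤ → Submodule ℂ (ℂ ⊗[ℚ] H)}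
  {W' : ℤ → Submodule ℚ H'} {F' : ℤ → Submodule ℂ (ℂ ⊗[ℚ] H')}
  {W'' : ℤ → Submodule ℚ H''} {F'' : ℤ → Submodule ℂ (ℂ ⊗[ℚ] H'')}

lemma grF_anti (hF : Antitone F) (n : ℤ) : Antitone (grF W F n) := fun _ _ hpq =>
  Submodule.map_mono (Submodule.comap_mono (hF hpq))

lemma grF_eq_bot {n p : ℤ} (h : F p ⊓ complexify W n = ⊥) : grF W F n p = ⊥ := by
  rw [Submodule.eq_bot_iff]
  intro x hx
  obtain ⟨y, rfl⟩ := mkQ_baseChange_surjective W n x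
  obtain ⟨a, ha, e⟩ := (mkQ_mem_grF_iff W F n p y).1 hx
  rw [h, Submodule.mem_bot] at ha
  rw [mkQ_eq_zero_iff]
  rwa [ha, sub_zero] at e

lemma grF_eq_top {n p : ℤ} (h : F p = ⊤) : grF W F n p = ⊤ := by
  rw [grF, h, Submodule.comap_top, Submodule.map_top, LinearMap.range_eq_top]
  exact mkQ_baseChange_surjective W n

lemma mem_of_grF_eq_bot {n p : ℤ} (h : grF W F n p = ⊥) {x : ℂ ⊗[ℚ] H}
    (hx : x ∈ F p ⊓ complexify W n) : x ∈ complexify W (n - 1) := by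
  obtain ⟨hx, ⟨y, rfl⟩⟩ := hx
  rw [← mkQ_eq_zero_iff, ← Submodule.mem_bot ℂ, ← h, mkQ_mem_grF_iff]
  exact ⟨_, ⟨hx, ⟨y, rfl⟩⟩, by rw [sub_self]; exact zero_mem _⟩

lemma IsPolarizableMixedHodge.exists_grF_eq_bot (h : IsPolarizableMixedHodge W F) (n : ℤ) :
    ∃ p, grF W F n p = ⊥ :=
  h.F_bot.imp fun p hp => grF_eq_bot (by rw [hp, bot_inf_eq])

lemma IsPolarizableMixedHodge.exists_grF_eq_top (h : IsPolarizableMixedHodge W F) (n : ℤ) :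
    ∃ p, grF W F n p = ⊤ :=
  h.F_top.imp fun _ hp => grF_eq_top hp

lemma grMap_mkQ {f : H →ₗ[ℚ] H'} (hf : ∀ n, ∀ x ∈ W n, f x ∈ W' n) (n : ℤ) (x : W n) :
    grMap f hf n (((W (n - 1)).submoduleOf (W n)).mkQ x) =
      ((W' (n - 1)).submoduleOf (W' n)).mkQ ⟨f x, hf n x x.2⟩ := rfl

lemma grMap_baseChange_mkQ {f : H →ₗ[ℚ] H'} (hf : ∀ n, ∀ x ∈ W n, f x ∈ W' n) (n : ℤ)
    {x : ℂ ⊗[ℚ] W n} {y : ℂ ⊗[ℚ] W' n}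
    (hxy : (W' n).subtype.baseChange ℂ y = f.baseChange ℂ ((W n).subtype.baseChange ℂ x)) :
    (grMap f hf n).baseChange ℂ (((W (n - 1)).submoduleOf (W n)).mkQ.baseChange ℂ x) =
      ((W' (n - 1)).submoduleOf (W' n)).mkQ.baseChange ℂ y := by
  have e : y = (f.restrict (hf n)).baseChange ℂ x := by
    refine baseChange_injective_of_injective (S := ℂ) (W' n).injective_subtype ?_
    change (W' n).subtype.baseChange ℂ y = (W' n).subtype.baseChange ℂ _
    rw [hxy, ← LinearMap.comp_apply, ← LinearMap.baseChange_comp, ← LinearMap.comp_apply,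
      ← LinearMap.baseChange_comp]
    rfl
  rw [e, ← LinearMap.comp_apply, ← LinearMap.baseChange_comp, ← LinearMap.comp_apply,
    ← LinearMap.baseChange_comp]
  rfl

/-- The structure induced on a subspace. -/
lemma IsPolarizableMixedHodge.sub (h : IsPolarizableMixedHodge W F) {i : H' →ₗ[ℚ] H}
    (hi : Function.Injective i) (hK : IsHodgeSub W F (LinearMap.range i)) :
    IsPolarizableMixedHodge (fun n => (W n).comap i)
      (fun p => (F p).comap (i.baseChange ℂ)) := by
  have hiC := baseChange_injective_of_injective (S := ℂ) hi
  have hop := h.opposed.comap hiC (by rwa [range_baseChange_eq])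
  have e1 : complexify (fun n => (W n).comap i) =
      fun n => (complexify W n).comap (i.baseChange ℂ) := by
    funext n; exact comap_baseChange_eq _ _
  have e2 : conjFil (fun p => (F p).comap (i.baseChange ℂ)) =
      fun n => (conjFil F n).comap (i.baseChange ℂ) := by
    funext n; exact conjSubspace_comap _ _
  rw [← e1, ← e2] at hop
  refine ⟨fun _ _ hmn => Submodule.comap_mono (h.W_mono hmn), h.W_bot.imp fun n hn => ?_,
    h.W_top.imp fun n hn => ?_, hop.F_anti, hop.F_bot, hop.F_top, hop.isPure, fun n => ?_⟩
  · rw [hn, Submodule.comap_bot, LinearMap.ker_eq_bot.2 hi]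
  · rw [hn, Submodule.comap_top]
  · obtain ⟨B, hB⟩ := h.polarizable n
    have hf : IsFiltered (fun n => (W n).comap i) (fun p => (F p).comap (i.baseChange ℂ)) W F i :=
      ⟨fun _ _ hx => hx, fun _ _ hx => hx⟩
    refine ⟨_, hB.comp (α := grMap i hf.1 n) ?_ (fun p x hx => grMap_mem hf n p hx)⟩
    rw [injective_iff_map_eq_zero]
    intro x hx
    obtain ⟨x, rfl⟩ := Submodule.mkQ_surjective _ x
    rw [grMap_mkQ, Submodule.mkQ_apply, Submodule.Quotient.mk_eq_zero] at hx
    rw [Submodule.mkQ_apply, Submodule.Quotient.mk_eq_zero]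
    exact hx

/-- The structure induced on a cokernel. -/
lemma IsPolarizableMixedHodge.quotient (h : IsPolarizableMixedHodge W F)
    (h' : IsPolarizableMixedHodge W' F') [Module.Finite ℚ H'] {f : H →ₗ[ℚ] H'}
    (hf : IsFiltered W F W' F' f) {g : H' →ₗ[ℚ] H''} (hg : Function.Surjective g)
    (hfg : LinearMap.ker g = LinearMap.range f) :
    IsPolarizableMixedHodge (fun n => (W' n).map g) (fun p => (F' p).map (g.baseChange ℂ)) := by
  have hgC := baseChange_surjective_of_surjective (S := ℂ) hg
  have hfgC : LinearMap.ker (g.baseChange ℂ) = LinearMap.range (f.baseChange ℂ) := by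
    rw [ker_baseChange_eq, range_baseChange_eq, hfg]
  have hop := h.opposed.map h.opposed.swap h'.opposed h'.opposed.swap hf.le_comap_complexify
    hf.le_comap_F hf.le_comap_conjFil hgC hfgC
  have e1 : complexify (fun n => (W' n).map g) =
      fun n => (complexify W' n).map (g.baseChange ℂ) := by
    funext n; exact baseChange_map_eq _ _
  have e2 : conjFil (fun p => (F' p).map (g.baseChange ℂ)) =
      fun n => (conjFil F' n).map (g.baseChange ℂ) := by
    funext n; exact conjSubspace_map _ _
  rw [← e1, ← e2] at hop
  refine ⟨fun _ _ hmn => Submodule.map_mono (h'.W_mono hmn), h'.W_bot.imp fun n hn => ?_,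
    h'.W_top.imp fun n hn => ?_, hop.F_anti, hop.F_bot, hop.F_top, hop.isPure, fun n => ?_⟩
  · rw [hn, Submodule.map_bot]
  · rw [hn, Submodule.map_top, LinearMap.range_eq_top.2 hg]
  · obtain ⟨B, hB⟩ := h'.polarizable n
    have hfg' : IsFiltered W' F' (fun n => (W' n).map g) (fun p => (F' p).map (g.baseChange ℂ)) g :=
      ⟨fun _ x hx => ⟨x, hx, rfl⟩, fun _ x hx => ⟨x, hx, rfl⟩⟩
    -- The quotient is polarized by identifying its graded piece with the orthogonal complement `M`
    -- of the image of Gr f and restricting `B` to `M`.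
    obtain ⟨M, hM, hMF⟩ := hB.exists_complement (h.pure n) (h.exists_grF_eq_bot n)
      (h.exists_grF_eq_top n) (grF_anti h.F_anti n) (φ := grMap f hf.1 n)
      (fun p x hx => grMap_mem hf n p hx)
    set φ := grMap f hf.1 n
    set γ := grMap g hfg'.1 n with hγ
    have hγφ : ∀ x, γ (φ x) = 0 := by
      intro x
      obtain ⟨x, rfl⟩ := Submodule.mkQ_surjective _ x
      have h0 : g (f x) = 0 := LinearMap.mem_ker.1 (hfg ▸ ⟨(x : H), rfl⟩)
      rw [hγ, grMap_mkQ, grMap_mkQ, Submodule.mkQ_apply, Submodule.Quotient.mk_eq_zero]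
      change g (f x) ∈ (W' (n - 1)).map g
      rw [h0]
      exact zero_mem _
    have hkerγ : ∀ x, γ x = 0 → x ∈ LinearMap.range φ := by
      intro x hx
      obtain ⟨x, rfl⟩ := Submodule.mkQ_surjective _ x
      rw [hγ, grMap_mkQ, Submodule.mkQ_apply, Submodule.Quotient.mk_eq_zero] at hx
      obtain ⟨w, hw, e⟩ : ∃ w ∈ W' (n - 1), g w = g x := hx
      obtain ⟨z, hz⟩ : (x : H') - w ∈ LinearMap.range f := by
        rw [← hfg, LinearMap.mem_ker, map_sub, e, sub_self]
      have hwn := h'.W_mono (by omega : n - 1 ≤ n) hw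
      -- Strictness for W lets `z` be chosen in W_n; this is what makes Gr^W_n exact in the middle.
      obtain ⟨y, hy, ey⟩ := hf.strict_W h h' (n := n) (x := z)
        (by rw [hz]; exact sub_mem x.2 hwn)
      refine ⟨Submodule.mkQ _ ⟨y, hy⟩, ?_⟩
      rw [grMap_mkQ, ← sub_eq_zero, ← map_sub, Submodule.mkQ_apply, Submodule.Quotient.mk_eq_zero]
      change f y - x ∈ W' (n - 1)
      rw [ey, hz, sub_sub_cancel_left]
      exact neg_mem hw
    have hγs : Function.Surjective γ := by
      intro x
      obtain ⟨⟨_, w, hw, rfl⟩, rfl⟩ := Submodule.mkQ_surjective _ x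
      exact ⟨Submodule.mkQ _ ⟨w, hw⟩, rfl⟩
    let e : M ≃ₗ[ℚ] Gr (fun n => (W' n).map g) n := LinearEquiv.ofBijective (γ ∘ₗ M.subtype) (by
      constructor
      · rw [injective_iff_map_eq_zero]
        intro m hm
        exact Subtype.ext (Submodule.disjoint_def.1 hM.disjoint _ (hkerγ _ hm) m.2)
      · intro x
        obtain ⟨y, rfl⟩ := hγs x
        have hy : y ∈ LinearMap.range φ ⊔ M := by
          rw [codisjoint_iff.1 hM.codisjoint]; trivial
        obtain ⟨_, ⟨z, rfl⟩, m, hm, rfl⟩ := Submodule.mem_sup.1 hy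
        exact ⟨⟨m, hm⟩, by simp [hγφ]⟩)
    let α : Gr (fun n => (W' n).map g) n →ₗ[ℚ] Gr W' n := M.subtype ∘ₗ e.symm.toLinearMap
    have hα : Function.Injective α := M.injective_subtype.comp e.symm.injective
    have hαγ : ∀ m ∈ M.baseChange ℂ, α.baseChange ℂ (γ.baseChange ℂ m) = m := by
      rintro _ ⟨m, rfl⟩
      rw [← LinearMap.comp_apply, ← LinearMap.comp_apply, ← LinearMap.baseChange_comp,
        ← LinearMap.baseChange_comp]
      congr 2
      refine LinearMap.ext fun m => ?_
      exact congrArg Subtype.val (e.symm_apply_apply m)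
    refine ⟨_, hB.comp (α := α) hα ?_⟩
    intro p x hx
    -- The Hodge filtration on the graded quotient is the image of the one on Gr W'. The lift has to
    -- be in F'^p and in W'_n simultaneously, which is the content of `strict_FW`.
    obtain ⟨y, hy, rfl⟩ : ∃ y ∈ grF W' F' n p, γ.baseChange ℂ y = x := by
      obtain ⟨y, ⟨a, ha, e⟩, rfl⟩ := hx
      obtain ⟨w, hw, e'⟩ : (Submodule.subtype ((W' n).map g)).baseChange ℂ y ∈
          (complexify W' n).map (g.baseChange ℂ) := by
        rw [← congrFun e1 n]; exact ⟨y, rfl⟩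
      have hk : a - w ∈ LinearMap.ker (g.baseChange ℂ) := by
        rw [LinearMap.mem_ker, map_sub, e, e', sub_self]
      rw [hfgC] at hk
      obtain ⟨z, hz⟩ := hk
      obtain ⟨_, ⟨ha₁, ⟨a₁, rfl⟩⟩, z₁, e₁⟩ := h.opposed.strict_FW h'.opposed
        hf.le_comap_complexify hf.le_comap_F hf.le_comap_conjFil ha hw hz.symm
      refine ⟨_, ⟨a₁, ha₁, rfl⟩, grMap_baseChange_mkQ hfg'.1 n ?_⟩
      rw [← e]
      have : a - (W' n).subtype.baseChange ℂ a₁ ∈ LinearMap.ker (g.baseChange ℂ) := by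
        rw [e₁, hfgC]; exact ⟨z₁, rfl⟩
      rwa [LinearMap.mem_ker, map_sub, sub_eq_zero] at this
    -- Subtracting `φ a` moves the lift into `M` without leaving F^p, and `α ∘ γ` is the identity on
    -- `M`.
    obtain ⟨a, ha, hm⟩ := hMF p y hy
    have hγφC : γ.baseChange ℂ (φ.baseChange ℂ a) = 0 := by
      rw [← LinearMap.comp_apply, ← LinearMap.baseChange_comp,
        show γ ∘ₗ φ = 0 from LinearMap.ext hγφ, LinearMap.baseChange_zero, LinearMap.zero_apply]
    have : γ.baseChange ℂ y = γ.baseChange ℂ (y - φ.baseChange ℂ a) := by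
      rw [map_sub, hγφC, sub_zero]
    rw [this, hαγ _ hm]
    exact sub_mem hy (grMap_mem hf n p ha)

end SubQuotient

/-! ### The kernel of the projection to the maximal quotient -/

section Kappa

variable {H : Type u} [AddCommGroup H] [Module ℚ H]
variable {H' : Type u} [AddCommGroup H'] [Module ℚ H']

/-- Arbitrary intersections commute with this base change because ℂ is free over ℚ: membership is
tested on the coordinates in a ℚ-basis of ℂ. It ensures that the infimum defining `kappa` satisfies
its own condition over ℂ. -/
lemma mem_sInf_baseChange_iff {𝒮 : Set (Submodule ℚ H)} {x : ℂ ⊗[ℚ] H} :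
    x ∈ (sInf 𝒮).baseChange ℂ ↔ ∀ S ∈ 𝒮, x ∈ S.baseChange ℂ := by
  classical
  let b := Module.Free.chooseBasis ℚ ℂ
  have key : ∀ (S : Submodule ℚ H) (x : ℂ ⊗[ℚ] H), x ∈ S.baseChange ℂ ↔
      ∀ i, TensorProduct.equivFinsuppOfBasisLeft b x i ∈ S := by
    intro S x
    constructor
    · rintro ⟨y, rfl⟩ i
      induction y with
      | zero => simp
      | add y y' h h' => rw [map_add, map_add, Finsupp.add_apply]; exact add_mem h h'
      | tmul z v =>
        rw [LinearMap.baseChange_tmul, TensorProduct.equivFinsuppOfBasisLeft_apply_tmul_apply]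
        exact S.smul_mem _ v.2
    · intro h
      rw [← (TensorProduct.equivFinsuppOfBasisLeft b).symm_apply_apply x,
        TensorProduct.equivFinsuppOfBasisLeft_symm_apply]
      exact Submodule.sum_mem _ fun i _ => Submodule.tmul_mem_baseChange_of_mem _ (h i)
  simp only [key, Submodule.mem_sInf]
  exact ⟨fun h S hS i => h i S hS, fun h i S hS => h S hS i⟩

/-- The smallest rational subspace that contains `W_(-3)` and, after complexification,
`F^0 ∩ W_(-2)`. -/
def kappa (W : ℤ → Submodule ℚ H) (F : ℤ → Submodule ℂ (ℂ ⊗[ℚ] H)) : Submodule ℚ H :=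
  sInf {S | W (-3) ≤ S ∧ F 0 ⊓ complexify W (-2) ≤ S.baseChange ℂ}

variable {W : ℤ → Submodule ℚ H} {F : ℤ → Submodule ℂ (ℂ ⊗[ℚ] H)}
  {W' : ℤ → Submodule ℚ H'} {F' : ℤ → Submodule ℂ (ℂ ⊗[ℚ] H')}

lemma kappa_le {S : Submodule ℚ H} (h₁ : W (-3) ≤ S)
    (h₂ : F 0 ⊓ complexify W (-2) ≤ S.baseChange ℂ) : kappa W F ≤ S :=
  sInf_le ⟨h₁, h₂⟩

lemma W_le_kappa : W (-3) ≤ kappa W F := le_sInf fun _ hS => hS.1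

lemma F_le_kappa : F 0 ⊓ complexify W (-2) ≤ (kappa W F).baseChange ℂ := fun _ hx =>
  mem_sInf_baseChange_iff.2 fun _ hS => hS.2 hx

lemma kappa_le_W (hW : Monotone W) : kappa W F ≤ W (-2) :=
  kappa_le (hW (by norm_num)) inf_le_right

/-- The preimage of `kappa W' F'` satisfies both conditions of which `kappa W F` is the smallest
solution. -/
lemma IsFiltered.kappa_le_comap {f : H →ₗ[ℚ] H'} (hf : IsFiltered W F W' F' f) :
    kappa W F ≤ (kappa W' F').comap f := by
  refine kappa_le (fun x hx => W_le_kappa (hf.1 _ x hx)) ?_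
  rw [comap_baseChange_eq]
  exact fun x hx => F_le_kappa ⟨hf.le_comap_F 0 hx.1, hf.le_comap_complexify _ hx.2⟩

/-- Morphisms of mixed Hodge structures are strict for `kappa`. -/
lemma IsFiltered.strict_kappa [Module.Finite ℚ H'] {f : H →ₗ[ℚ] H'} (hf : IsFiltered W F W' F' f)
    (h : IsPolarizableMixedHodge W F) (h' : IsPolarizableMixedHodge W' F') {x : H}
    (hx : f x ∈ kappa W' F') : ∃ y ∈ kappa W F, f y = f x := by
  obtain ⟨B, hB⟩ := h'.polarizable (-2)
  obtain ⟨M, hM, hMF⟩ := hB.exists_complement (h.pure (-2)) (h.exists_grF_eq_bot _)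
    (h.exists_grF_eq_top _) (grF_anti h.F_anti _) (φ := grMap f hf.1 (-2))
    (fun p x hx => grMap_mem hf _ p hx)
  set φ := grMap f hf.1 (-2)
  let π := ((W (-2 - 1)).submoduleOf (W (-2))).mkQ
  let π' := ((W' (-2 - 1)).submoduleOf (W' (-2))).mkQ
  -- The preimage `S` of `T` competes in the infimum defining `kappa W' F'`: a class in F^0 is the
  -- sum of the image of a class in F^0 of the source and an element of `M`.
  let T : Submodule ℚ (Gr W' (-2)) :=
    (((kappa W F).comap (W (-2)).subtype).map (φ ∘ₗ π)) ⊔ M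
  let S : Submodule ℚ H' := (T.comap π').map (W' (-2)).subtype
  have hS : kappa W' F' ≤ S := by
    refine kappa_le (fun w hw => ⟨⟨w, h'.W_mono (by norm_num) hw⟩, ?_, rfl⟩) ?_
    · change π' _ ∈ T
      have : π' ⟨w, h'.W_mono (by norm_num) hw⟩ = 0 := by
        rw [Submodule.mkQ_apply, Submodule.Quotient.mk_eq_zero]
        exact hw
      rw [this]
      exact zero_mem _
    · rintro _ ⟨hF, ⟨y, rfl⟩⟩
      rw [baseChange_map_eq, comap_baseChange_eq, sup_baseChange_eq, baseChange_map_eq]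
      refine ⟨y, ?_, rfl⟩
      rw [SetLike.mem_coe, Submodule.mem_comap]
      obtain ⟨_, ⟨a, ha, rfl⟩, hm⟩ := hMF 0 (π'.baseChange ℂ y) ⟨y, hF, rfl⟩
      rw [← add_sub_cancel (φ.baseChange ℂ (π.baseChange ℂ a)) (π'.baseChange ℂ y)]
      refine add_mem (Submodule.mem_sup_left ⟨a, ?_, ?_⟩) (Submodule.mem_sup_right hm)
      · rw [comap_baseChange_eq]
        exact F_le_kappa ⟨ha, ⟨a, rfl⟩⟩
      · rw [LinearMap.baseChange_comp]
        rfl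
  obtain ⟨y, hyT, hy⟩ := hS hx
  obtain ⟨_, ⟨k, hk, rfl⟩, m, hm, e⟩ := Submodule.mem_sup.1 (show π' y ∈ T from hyT)
  -- By strictness `f x` comes from W_(-2), so its class lies in the image of `φ` and has no
  -- component along `M`.
  obtain ⟨z, hz, ez⟩ := hf.strict_W h h' (n := -2) (x := x) (kappa_le_W h'.W_mono hx)
  have hyz : φ (π ⟨z, hz⟩) = π' y := by
    rw [grMap_mkQ]
    congr 1
    exact Subtype.ext (ez.trans hy.symm)
  have hm0 : m = 0 := by
    refine Submodule.disjoint_def.1 hM.disjoint m ⟨π ⟨z, hz⟩ - π k, ?_⟩ hm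
    rw [map_sub, hyz, ← e]
    simp
  rw [hm0, add_zero] at e
  have hyk : f x - f k ∈ W' (-3) := by
    have : π' (y - ⟨f k, hf.1 _ _ k.2⟩) = 0 := by
      rw [map_sub, ← e, sub_eq_zero]
      rfl
    rw [Submodule.mkQ_apply, Submodule.Quotient.mk_eq_zero] at this
    rw [← hy]
    exact this
  rw [← map_sub] at hyk
  -- The remaining difference has weight ≤ -3, where all of W belongs to `kappa`.
  obtain ⟨w, hw, ew⟩ := hf.strict_W h h' hyk
  exact ⟨k + w, add_mem hk (W_le_kappa hw), by rw [map_add, ew, map_sub]; abel⟩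

/-- Only weight -2 needs an argument, since W_n lies in `kappa` for n < -2 and `kappa` lies in
W_(n-1) for n > -2. In weight -2 the relation p + q = -1 forces p ≥ 0 or q ≥ 0; one of the two
components is then in F^0 or its conjugate, hence in `kappa`, and the other follows by difference
modulo W_(-3). -/
lemma IsPolarizableMixedHodge.isHodgeSub_kappa (h : IsPolarizableMixedHodge W F)
    (h1 : F 1 = ⊥) : IsHodgeSub W F (kappa W F) := by
  intro n p q hpq x hx hxK
  have hK : F 0 ⊓ complexify W (-2) ≤ (kappa W F).baseChange ℂ := F_le_kappa
  have hK' : conjFil F 0 ⊓ complexify W (-2) ≤ (kappa W F).baseChange ℂ := by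
    intro y hy
    have := conj_mem_baseChange (hK ⟨hy.1, conj_mem_baseChange hy.2⟩)
    rwa [conj_conj] at this
  have hF0 : ∀ r, 1 ≤ r → F r = ⊥ := fun r hr => le_bot_iff.1 (h1 ▸ h.F_anti hr)
  have hG0 : ∀ r, 1 ≤ r → conjFil F r = ⊥ := fun r hr => by
    rw [conjFil, hF0 r hr, conjSubspace_bot]
  have hKW : (kappa W F).baseChange ℂ ≤ complexify W (-2) :=
    Submodule.baseChange_mono _ (kappa_le_W h.W_mono)
  have hWK : complexify W (-3) ≤ (kappa W F).baseChange ℂ :=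
    Submodule.baseChange_mono _ W_le_kappa
  rcases lt_trichotomy n (-2) with hn | rfl | hn
  · obtain ⟨a, ha, b, hb, hab⟩ := h.opposed.decomp n p q hpq x hx
    have hle : complexify W n ≤ (kappa W F).baseChange ℂ :=
      (h.opposed.W_mono (by omega)).trans hWK
    exact ⟨a, ha, hle ha.2, b, hb, hle hb.2, hab⟩
  · obtain ⟨a, ha, b, hb, hab⟩ := h.opposed.decomp (-2) p q hpq x hx
    have habK : a + b ∈ (kappa W F).baseChange ℂ := by
      have : a + b = x - (x - a - b) := by abel
      rw [this]
      exact sub_mem hxK (hWK hab)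
    have : a ∈ (kappa W F).baseChange ℂ ∨ b ∈ (kappa W F).baseChange ℂ := by
      by_cases hp : 0 ≤ p
      · exact Or.inl (hK ⟨h.F_anti hp ha.1, ha.2⟩)
      · exact Or.inr (hK' ⟨h.opposed.G_anti (by omega : (0 : ℤ) ≤ q) hb.1, hb.2⟩)
    rcases this with haK | hbK
    · exact ⟨a, ha, haK, b, hb, by simpa using sub_mem habK haK, hab⟩
    · exact ⟨a, ha, by simpa using sub_mem habK hbK, b, hb, hbK, hab⟩
  · refine ⟨0, zero_mem _, zero_mem _, 0, zero_mem _, zero_mem _, ?_⟩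
    rw [sub_zero, sub_zero]
    exact h.opposed.W_mono (by omega) (hKW hxK)

/-- Effective structures with `kappa = 0` have the four Hodge types of `1`-motives. -/
lemma hasTypeIn_of_kappa_eq_bot (h : IsPolarizableMixedHodge W F) (h1 : F 1 = ⊥)
    (hk : kappa W F = ⊥) : HasTypeIn W F MHS.oneTypes := by
  have hF0 : ∀ n r, 1 ≤ r → grF W F n r = ⊥ := fun n r hr => grF_eq_bot (by
    rw [le_bot_iff.1 (h1 ▸ h.F_anti hr : F r ≤ ⊥), bot_inf_eq])
  intro n p hne
  have hp : p ≤ 0 := by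
    by_contra hp
    exact hne (by rw [hodgePiece, hF0 n p (by omega), bot_inf_eq])
  have hnp : n - p ≤ 0 := by
    by_contra hp
    exact hne (by rw [hodgePiece, hF0 n (n - p) (by omega), conjSubspace_bot, inf_bot_eq])
  have hn : -3 < n := by
    by_contra hn
    apply hne
    have : complexify W n = ⊥ := by
      rw [complexify, le_bot_iff.1 (((h.W_mono (by omega)).trans W_le_kappa).trans_eq hk),
        Submodule.baseChange_bot]
    rw [hodgePiece, grF_eq_bot (by rw [this, inf_bot_eq]), bot_inf_eq]
  have hn2 : n = -2 → p = -1 := by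
    rintro rfl
    have h0 : grF W F (-2) 0 = ⊥ := grF_eq_bot (le_bot_iff.1 (F_le_kappa.trans_eq (by
      rw [hk, Submodule.baseChange_bot])))
    by_contra hp1
    obtain rfl | rfl : p = 0 ∨ p = -2 := by omega
    · exact hne (by rw [hodgePiece, h0, bot_inf_eq])
    · exact hne (by
        rw [hodgePiece, show (-2 : ℤ) - -2 = 0 by norm_num, h0, conjSubspace_bot, inf_bot_eq])
  simp only [MHS.oneTypes, Set.mem_insert_iff, Set.mem_singleton_iff, Prod.mk.injEq]
  omega

/-- Descending induction: once F^(q+1) vanishes on Gr^W_n, purity makes F^(n-q) everything, so F^q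
coincides with the Hodge piece of type (q, n - q). -/
lemma grF_eq_bot_of_hodgePiece (h : IsPolarizableMixedHodge W F) {n p : ℤ}
    (hp : ∀ q, p ≤ q → hodgePiece (grF W F n) n q = ⊥) : grF W F n p = ⊥ := by
  obtain ⟨P, hP⟩ := h.exists_grF_eq_bot n
  have key : ∀ j : ℕ, ∀ q, p ≤ q → P - j ≤ q → grF W F n q = ⊥ := by
    intro j
    induction j with
    | zero =>
      intro q _ hq
      exact le_bot_iff.1 (hP ▸ grF_anti h.F_anti n (by simpa using hq))
    | succ j ih =>
      intro q hpq hq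
      have hc := (h.pure n (n - q)).codisjoint
      rw [show n + 1 - (n - q) = q + 1 by ring,
        ih (q + 1) (by omega) (by push_cast at hq; omega), conjSubspace_bot] at hc
      have ht : grF W F n (n - q) = ⊤ := by simpa using codisjoint_iff.1 hc
      have := hp q hpq
      rwa [hodgePiece, ht, conjSubspace_top, inf_top_eq] at this
  exact key (P - p).toNat p le_rfl (by omega)

/-- No allowed type has weight ≤ -3, so W_(-3) = 0. In weight -2 only (-1,-1) is allowed, so F^0
vanishes on Gr^W_(-2) and F^0 ∩ W_(-2) falls into W_(-3). -/
lemma kappa_eq_bot_of_hasTypeIn (h : IsPolarizableMixedHodge W F)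
    (hT : HasTypeIn W F MHS.oneTypes) : kappa W F = ⊥ := by
  have hT' : ∀ n p, (p, n - p) ∉ MHS.oneTypes → hodgePiece (grF W F n) n p = ⊥ := fun n p hnp => by
    by_contra hne
    exact hnp (hT n p hne)
  simp only [MHS.oneTypes, Set.mem_insert_iff, Set.mem_singleton_iff, Prod.mk.injEq] at hT'
  have hlow : ∀ n ≤ -3, complexify W n = ⊥ := by
    intro n
    refine h.opposed.weight_induction (P := fun n => n ≤ -3 → complexify W n = ⊥)
      (fun n hn _ => hn) (fun n ih hn => ?_) n
    rw [← le_bot_iff, ← ih (by omega)]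
    intro x hx
    obtain ⟨p, hp⟩ := h.F_top
    have hg : grF W F n p = ⊥ := grF_eq_bot_of_hodgePiece h fun q _ => hT' n q (by omega)
    exact mem_of_grF_eq_bot hg ⟨by rw [hp]; trivial, hx⟩
  rw [← le_bot_iff]
  refine kappa_le (fun x hx => ?_) fun x hx => ?_
  · have : (1 : ℂ) ⊗ₜ[ℚ] x ∈ (⊥ : Submodule ℚ H).baseChange ℂ := by
      rw [Submodule.baseChange_bot, ← hlow (-3) le_rfl]
      exact Submodule.tmul_mem_baseChange_of_mem _ hx
    rwa [one_tmul_mem_baseChange_iff] at this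
  · rw [Submodule.baseChange_bot, ← hlow (-3) le_rfl]
    have hg : grF W F (-2) 0 = ⊥ :=
      grF_eq_bot_of_hodgePiece h fun q hq => hT' (-2) q (by omega)
    have := mem_of_grF_eq_bot hg hx
    rwa [show (-2 : ℤ) - 1 = -3 by norm_num] at this

end Kappa

/-! ### Subrings of the rational numbers -/

section Coefficients

variable (A : Subring ℚ)

/-- By Bézout the denominator of a reduced fraction in `A` is a unit of `A`, so an ideal is
generated by its integers. The consequence used later is that finitely generated torsion-free
`A`-modules are free, so that torsion splits off. -/
instance : IsPrincipalIdealRing A where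
  principal I := by
    let ι : ℤ →+* A := Int.castRingHom A
    obtain ⟨n, hn⟩ := (IsPrincipalIdealRing.principal (I.comap ι)).principal
    have hnI : ι n ∈ I := by
      change n ∈ I.comap ι
      rw [hn]
      exact Submodule.mem_span_singleton_self n
    refine ⟨ι n, le_antisymm (fun x hx => ?_) ((Submodule.span_singleton_le_iff_mem _ _).2 hnI)⟩
    have hd : (x.1.den : ℚ) ≠ 0 := by exact_mod_cast x.1.den_nz
    obtain ⟨u, v, huv⟩ : ∃ u v : ℤ, u * x.1.num + v * x.1.den = 1 :=
      Int.isCoprime_iff_gcd_eq_one.2 x.1.reduced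
    have hinv : ((x.1.den : ℚ))⁻¹ ∈ A := by
      have e : ((x.1.den : ℚ))⁻¹ = u * x.1 + v := by
        have h1 : (u * x.1.num + v * x.1.den : ℚ) = 1 := by exact_mod_cast huv
        have h2 : x.1 * x.1.den = x.1.num := Rat.mul_den_eq_num _
        rw [← h2] at h1
        field_simp
        linarith
      rw [e]
      exact add_mem (mul_mem (intCast_mem A u) x.2) (intCast_mem A v)
    have hnum : x.1.num ∈ I.comap ι := by
      change ι x.1.num ∈ I
      have e : ι x.1.num = (x.1.den : A) * x := by
        refine Subtype.ext ?_
        rw [mul_comm]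
        simp [ι, Rat.mul_den_eq_num]
      rw [e]
      exact I.mul_mem_left _ hx
    rw [hn, Submodule.mem_span_singleton] at hnum
    obtain ⟨c, hc⟩ := hnum
    refine Submodule.mem_span_singleton.2 ⟨⟨_, hinv⟩ * (c : A), Subtype.ext ?_⟩
    have h2 : x.1 * x.1.den = x.1.num := Rat.mul_den_eq_num _
    have h3 : (c : ℚ) * n = x.1.num := by rw [← hc]; push_cast [smul_eq_mul]; rfl
    simp only [smul_eq_mul, Subring.coe_mul, Subring.coe_intCast, ι, eq_intCast]
    rw [mul_assoc, h3, ← h2]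
    field_simp

instance : IsFractionRing A ℚ :=
  IsFractionRing.of_field A ℚ fun z =>
    ⟨(z.num : A), (z.den : A), by
      rw [map_intCast, map_natCast]; exact (Rat.num_div_den z).symm⟩

variable {A}

lemma one_tmul_eq_zero_iff {M : Type*} [AddCommGroup M] [Module A M] {x : M} :
    (1 : ℚ) ⊗ₜ[A] x = 0 ↔ x ∈ Submodule.torsion A M := by
  rw [Submodule.mem_torsion_iff]
  have := IsLocalizedModule.eq_zero_iff (nonZeroDivisors A) (TensorProduct.mk A ℚ M 1) (m := x)
  simpa using this

/-- Clearing denominators; it allows subspaces of V_ℚ to be tested on elements of V_A. -/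
lemma exists_smul_eq_one_tmul {M : Type*} [AddCommGroup M] [Module A M] (x : ℚ ⊗[A] M) :
    ∃ (r : ℚ) (m : M), r ≠ 0 ∧ x = r • (1 : ℚ) ⊗ₜ[A] m := by
  obtain ⟨⟨m, s⟩, hs⟩ := IsLocalizedModule.surj (nonZeroDivisors A) (TensorProduct.mk A ℚ M 1) x
  have hs0 : ((s : A) : ℚ) ≠ 0 := fun h => nonZeroDivisors.ne_zero s.2 (Subtype.ext h)
  refine ⟨((s : A) : ℚ)⁻¹, m, inv_ne_zero hs0, ?_⟩
  rw [eq_inv_smul_iff₀ hs0]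
  exact hs

end Coefficients

namespace MHS

/-! ### The abelian category of mixed Hodge structures -/

section Abelian

variable {A : Subring ℚ}

lemma Hom.isFiltered {X Y : MHS.{u} A} (f : X ⟶ Y) :
    IsFiltered X.W X.F Y.W Y.F ((Hom.lin f).baseChange ℚ) := f.2

/-- A morphism from a filtered `A`-linear map. -/
def Hom.mk {X Y : MHS.{u} A} (f : X.carrier →ₗ[A] Y.carrier)
    (hf : IsFiltered X.W X.F Y.W Y.F (f.baseChange ℚ)) : X ⟶ Y := ⟨f, hf⟩

@[simp]
lemma Hom.lin_zero {X Y : MHS.{u} A} : Hom.lin (0 : X ⟶ Y) = 0 := rfl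

@[simp]
lemma Hom.lin_id {X : MHS.{u} A} : Hom.lin (𝟙 X) = LinearMap.id := rfl

lemma Hom.comp_apply {X Y Z : MHS.{u} A} (f : X ⟶ Y) (g : Y ⟶ Z) (x : X.carrier) :
    Hom.lin (f ≫ g) x = Hom.lin g (Hom.lin f x) := rfl

lemma Hom.apply_eq_zero {X Y Z : MHS.{u} A} {f : X ⟶ Y} {g : Y ⟶ Z} (h : f ≫ g = 0)
    (x : X.carrier) : Hom.lin g (Hom.lin f x) = 0 := by
  rw [← Hom.comp_apply, h]; rfl

lemma comp_baseChange {X Y Z : MHS.{u} A} {f : X ⟶ Y} {g : Y ⟶ Z} {h : X ⟶ Z} (w : f ≫ g = h)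
    (x : ℚ ⊗[A] X.carrier) :
    (Hom.lin g).baseChange ℚ ((Hom.lin f).baseChange ℚ x) = (Hom.lin h).baseChange ℚ x := by
  rw [← w, Hom.lin_comp, LinearMap.baseChange_comp]; rfl

/-- A linear map that becomes a morphism after composition with an injective morphism. -/
lemma isFiltered_of_comp_injective {T X Y : MHS.{u} A} (f : X ⟶ Y)
    (hf : Function.Injective ((Hom.lin f).baseChange ℚ)) (l : T.carrier →ₗ[A] X.carrier)
    (h : IsFiltered T.W T.F Y.W Y.F ((Hom.lin f ∘ₗ l).baseChange ℚ)) :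
    IsFiltered T.W T.F X.W X.F (l.baseChange ℚ) := by
  rw [LinearMap.baseChange_comp] at h
  constructor
  · intro n x hx
    obtain ⟨y, hy, e⟩ := (Hom.isFiltered f).strict_W X.isPolarizableMixedHodge
      Y.isPolarizableMixedHodge (h.1 n x hx)
    rwa [← hf e]
  · intro p x hx
    have h2 := h.2 p x hx
    rw [LinearMap.baseChange_comp] at h2
    obtain ⟨y, hy, e⟩ := (Hom.isFiltered f).strict_F_top X.isPolarizableMixedHodge
      Y.isPolarizableMixedHodge h2
    rwa [← baseChange_injective_of_injective hf e]

/-- A linear map that becomes a morphism after composition with a surjective morphism. -/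
lemma isFiltered_of_comp_surjective {X Y T : MHS.{u} A} (f : X ⟶ Y)
    (hf : Function.Surjective ((Hom.lin f).baseChange ℚ)) (l : Y.carrier →ₗ[A] T.carrier)
    (h : IsFiltered X.W X.F T.W T.F ((l ∘ₗ Hom.lin f).baseChange ℚ)) :
    IsFiltered Y.W Y.F T.W T.F (l.baseChange ℚ) := by
  rw [LinearMap.baseChange_comp] at h
  constructor
  · intro n y hy
    obtain ⟨x, rfl⟩ := hf y
    obtain ⟨x', hx', e⟩ := (Hom.isFiltered f).strict_W X.isPolarizableMixedHodge
      Y.isPolarizableMixedHodge hy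
    rw [← e]
    exact h.1 n x' hx'
  · intro p y hy
    obtain ⟨x, rfl⟩ := baseChange_surjective_of_surjective (S := ℂ) hf y
    obtain ⟨x', hx', e⟩ := (Hom.isFiltered f).strict_F_top X.isPolarizableMixedHodge
      Y.isPolarizableMixedHodge hy
    rw [← e, ← LinearMap.comp_apply, ← LinearMap.baseChange_comp]
    exact h.2 p x' hx'

/-- The Hodge structure on an `A`-module mapping to `V`, isomorphically onto a sub-Hodge structure
after tensoring with `ℚ`. -/
noncomputable def sub (V : MHS.{u} A) {M : Type u} [AddCommGroup M] [Module A M] [Module.Finite A M]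
    (i : M →ₗ[A] V.carrier) (hi : Function.Injective (i.baseChange ℚ))
    (hK : IsHodgeSub V.W V.F (LinearMap.range (i.baseChange ℚ))) : MHS.{u} A where
  carrier := M
  W n := (V.W n).comap (i.baseChange ℚ)
  F p := (V.F p).comap ((i.baseChange ℚ).baseChange ℂ)
  isPolarizableMixedHodge := V.isPolarizableMixedHodge.sub hi hK

/-- The morphism of a sub-Hodge structure to the ambient one. -/
noncomputable def subι (V : MHS.{u} A) {M : Type u} [AddCommGroup M] [Module A M] [Module.Finite A M]
    (i : M →ₗ[A] V.carrier) (hi : Function.Injective (i.baseChange ℚ))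
    (hK : IsHodgeSub V.W V.F (LinearMap.range (i.baseChange ℚ))) : V.sub i hi hK ⟶ V :=
  Hom.mk i ⟨fun _ _ h => h, fun _ _ h => h⟩

/-- The Hodge structure on a quotient of `V` which is a cokernel after tensoring with `ℚ`. -/
noncomputable def quot {X V : MHS.{u} A} (f : X ⟶ V) {Q : Type u} [AddCommGroup Q] [Module A Q]
    (g : V.carrier →ₗ[A] Q) (hg : Function.Surjective g)
    (hfg : LinearMap.ker (g.baseChange ℚ) = LinearMap.range ((Hom.lin f).baseChange ℚ)) :
    MHS.{u} A :=
  letI : Module.Finite A Q := Module.Finite.of_surjective g hg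
  { carrier := Q
    W := fun n => (V.W n).map (g.baseChange ℚ)
    F := fun p => (V.F p).map ((g.baseChange ℚ).baseChange ℂ)
    isPolarizableMixedHodge := X.isPolarizableMixedHodge.quotient V.isPolarizableMixedHodge
      (Hom.isFiltered f) (baseChange_surjective_of_surjective hg) hfg }

/-- The projection to a quotient Hodge structure. -/
noncomputable def quotπ {X V : MHS.{u} A} (f : X ⟶ V) {Q : Type u} [AddCommGroup Q] [Module A Q]
    (g : V.carrier →ₗ[A] Q) (hg : Function.Surjective g)
    (hfg : LinearMap.ker (g.baseChange ℚ) = LinearMap.range ((Hom.lin f).baseChange ℚ)) :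
    V ⟶ quot f g hg hfg :=
  ⟨g, fun _ x hx => ⟨x, hx, rfl⟩, fun _ x hx => ⟨x, hx, rfl⟩⟩

section Kernel

variable {X Y : MHS.{u} A} (f : X ⟶ Y)

lemma ker_subtype_injective :
    Function.Injective ((LinearMap.ker (Hom.lin f)).subtype.baseChange ℚ) :=
  baseChange_injective_of_injective (Submodule.injective_subtype _)

lemma ker_isHodgeSub : IsHodgeSub X.W X.F
    (LinearMap.range ((LinearMap.ker (Hom.lin f)).subtype.baseChange ℚ)) := by
  rw [range_baseChange_eq, Submodule.range_subtype, ← ker_baseChange_eq]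
  exact (Hom.isFiltered f).isHodgeSub_ker X.isPolarizableMixedHodge Y.isPolarizableMixedHodge

/-- The kernel of a morphism. -/
noncomputable def ker : MHS.{u} A :=
  X.sub (LinearMap.ker (Hom.lin f)).subtype (ker_subtype_injective f) (ker_isHodgeSub f)

/-- The inclusion of the kernel. -/
noncomputable def kerι : ker f ⟶ X := X.subι _ (ker_subtype_injective f) (ker_isHodgeSub f)

lemma kerι_comp : kerι f ≫ f = 0 := hom_ext (LinearMap.ext fun x => x.2)

instance : Mono (kerι f) where
  right_cancellation _ _ h := hom_ext (LinearMap.ext fun x =>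
    Subtype.ext (LinearMap.congr_fun (congrArg Hom.lin h) x))

/-- The kernel is a limit. -/
noncomputable def kerIsLimit : IsLimit (KernelFork.ofι (kerι f) (kerι_comp f)) :=
  KernelFork.IsLimit.ofι' _ _ fun k hk =>
    ⟨⟨(Hom.lin k).codRestrict _ fun x => Hom.apply_eq_zero hk x,
      isFiltered_of_comp_injective (kerι f) (ker_subtype_injective f) _ (Hom.isFiltered k)⟩,
      hom_ext (LinearMap.ext fun _ => rfl)⟩

lemma coker_eq : LinearMap.ker ((LinearMap.range (Hom.lin f)).mkQ.baseChange ℚ) =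
    LinearMap.range ((Hom.lin f).baseChange ℚ) := by
  rw [ker_baseChange_eq, Submodule.ker_mkQ, range_baseChange_eq]

/-- The cokernel of a morphism. -/
noncomputable def coker : MHS.{u} A :=
  quot f (LinearMap.range (Hom.lin f)).mkQ (Submodule.mkQ_surjective _) (coker_eq f)

/-- The projection to the cokernel. -/
noncomputable def cokerπ : Y ⟶ coker f := quotπ f _ (Submodule.mkQ_surjective _) (coker_eq f)

lemma comp_cokerπ : f ≫ cokerπ f = 0 := hom_ext (LinearMap.ext fun x =>
  (Submodule.Quotient.mk_eq_zero _).2 ⟨x, rfl⟩)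

lemma epi_of_surjective (hf : Function.Surjective (Hom.lin f)) : Epi f where
  left_cancellation _ _ h := hom_ext (LinearMap.ext fun y => by
    obtain ⟨x, rfl⟩ := hf y
    exact LinearMap.congr_fun (congrArg Hom.lin h) x)

lemma mono_of_injective (hf : Function.Injective (Hom.lin f)) : Mono f where
  right_cancellation _ _ h := hom_ext (LinearMap.ext fun y =>
    hf (LinearMap.congr_fun (congrArg Hom.lin h) y))

instance : Epi (cokerπ f) := epi_of_surjective _ (Submodule.mkQ_surjective _)

variable {f} in
lemma range_le_ker {Z : MHS.{u} A} {k : Y ⟶ Z} (hk : f ≫ k = 0) :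
    LinearMap.range (Hom.lin f) ≤ LinearMap.ker (Hom.lin k) := by
  rintro _ ⟨x, rfl⟩
  exact Hom.apply_eq_zero hk x

/-- The cokernel is a colimit. -/
noncomputable def cokerIsColimit :
    IsColimit (CokernelCofork.ofπ (cokerπ f) (comp_cokerπ f)) :=
  CokernelCofork.IsColimit.ofπ' _ _ fun k hk =>
    ⟨Hom.mk (X := coker f) ((LinearMap.range (Hom.lin f)).liftQ (Hom.lin k) (range_le_ker hk))
      (isFiltered_of_comp_surjective (cokerπ f)
        (baseChange_surjective_of_surjective (Submodule.mkQ_surjective _)) _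
        (Hom.isFiltered k)),
      hom_ext (Submodule.liftQ_mkQ _ _ _)⟩

lemma mono_iff_injective : Mono f ↔ Function.Injective (Hom.lin f) := by
  refine ⟨fun _ => ?_, mono_of_injective f⟩
  have h0 : kerι f = 0 := by rw [← cancel_mono f, kerι_comp, zero_comp]
  rw [injective_iff_map_eq_zero]
  intro x hx
  exact LinearMap.congr_fun (congrArg Hom.lin h0) (⟨x, hx⟩ : LinearMap.ker (Hom.lin f))

lemma epi_iff_surjective : Epi f ↔ Function.Surjective (Hom.lin f) := by
  refine ⟨fun _ => ?_, epi_of_surjective f⟩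
  have h0 : cokerπ f = 0 := by rw [← cancel_epi f, comp_cokerπ, comp_zero]
  intro y
  exact (Submodule.Quotient.mk_eq_zero _).1 (LinearMap.congr_fun (congrArg Hom.lin h0) y)

instance : HasKernels (MHS.{u} A) where
  has_limit f := ⟨⟨⟨_, kerIsLimit f⟩⟩⟩

instance : HasCokernels (MHS.{u} A) where
  has_colimit f := ⟨⟨⟨_, cokerIsColimit f⟩⟩⟩

instance : HasZeroObject (MHS.{u} A) := ⟨⟨zero A, isZero_zero A⟩⟩

instance : HasBinaryBiproducts (MHS.{u} A) where
  has_binary_biproduct X Y := hasBinaryBiproduct_of_total (prodBicone X Y) (prodBicone_total X Y)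

instance : HasFiniteProducts (MHS.{u} A) :=
  letI : HasTerminal (MHS.{u} A) := HasZeroObject.hasTerminal
  hasFiniteProducts_of_has_binary_and_terminal

instance : IsNormalMonoCategory (MHS.{u} A) where
  normalMonoOfMono {X Y} f hf := by
    have hinj := (mono_iff_injective f).1 hf
    refine ⟨⟨_, cokerπ f, comp_cokerπ f, KernelFork.IsLimit.ofι' _ _ fun {T} k hk => ?_⟩⟩
    have hk' : ∀ x, Hom.lin k x ∈ LinearMap.range (Hom.lin f) := fun x =>
      (Submodule.Quotient.mk_eq_zero _).1 (Hom.apply_eq_zero hk x)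
    let e := LinearEquiv.ofInjective (Hom.lin f) hinj
    let l : T.carrier →ₗ[A] X.carrier := e.symm.toLinearMap ∘ₗ (Hom.lin k).codRestrict _ hk'
    have hl : Hom.lin f ∘ₗ l = Hom.lin k := LinearMap.ext fun x =>
      congrArg Subtype.val (e.apply_symm_apply ⟨_, hk' x⟩)
    exact ⟨Hom.mk l (isFiltered_of_comp_injective f (baseChange_injective_of_injective hinj) l
      (hl ▸ Hom.isFiltered k)), hom_ext hl⟩

instance : IsNormalEpiCategory (MHS.{u} A) where
  normalEpiOfEpi {X Y} f hf := by
    have hsurj := (epi_iff_surjective f).1 hf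
    refine ⟨⟨_, kerι f, kerι_comp f, CokernelCofork.IsColimit.ofπ' _ _ fun {T} k hk => ?_⟩⟩
    have hk' : LinearMap.ker (Hom.lin f) ≤ LinearMap.ker (Hom.lin k) := fun x hx =>
      LinearMap.congr_fun (congrArg Hom.lin hk) (⟨x, hx⟩ : LinearMap.ker (Hom.lin f))
    let e := (Hom.lin f).quotKerEquivOfSurjective hsurj
    let l : Y.carrier →ₗ[A] T.carrier :=
      (LinearMap.ker (Hom.lin f)).liftQ (Hom.lin k) hk' ∘ₗ e.symm.toLinearMap
    have hl : l ∘ₗ Hom.lin f = Hom.lin k := LinearMap.ext fun x => by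
      have : e.symm (Hom.lin f x) = Submodule.Quotient.mk x := by
        rw [LinearEquiv.symm_apply_eq]; rfl
      change (LinearMap.ker (Hom.lin f)).liftQ (Hom.lin k) hk' (e.symm (Hom.lin f x)) = _
      rw [this]
      rfl
    exact ⟨Hom.mk l (isFiltered_of_comp_surjective f (baseChange_surjective_of_surjective hsurj) l
      (hl ▸ Hom.isFiltered k)), hom_ext hl⟩

noncomputable instance : Abelian (MHS.{u} A) where

end Kernel

/-- Exactness can be checked on the underlying `A`-modules. -/
lemma exact_iff (S : ShortComplex (MHS.{u} A)) :
    S.Exact ↔ ∀ y, Hom.lin S.g y = 0 → ∃ x, Hom.lin S.f x = y := by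
  rw [S.exact_iff_of_forks (kerIsLimit S.g) (cokerIsColimit S.f)]
  constructor
  · intro h y hy
    exact (Submodule.Quotient.mk_eq_zero _).1 (LinearMap.congr_fun (congrArg Hom.lin h)
      (⟨y, hy⟩ : LinearMap.ker (Hom.lin S.g)))
  · intro h
    exact hom_ext (LinearMap.ext fun x =>
      (Submodule.Quotient.mk_eq_zero _).2 (h x.1 x.2))

lemma exact_baseChange {X Y Z : MHS.{u} A} {f : X ⟶ Y} {g : Y ⟶ Z} (w : f ≫ g = 0)
    (h : ∀ y, Hom.lin g y = 0 → ∃ x, Hom.lin f x = y) (y : ℚ ⊗[A] Y.carrier)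
    (hy : (Hom.lin g).baseChange ℚ y = 0) : ∃ x, (Hom.lin f).baseChange ℚ x = y := by
  have : Function.Exact (Hom.lin f) (Hom.lin g) := fun y =>
    ⟨h y, by rintro ⟨x, rfl⟩; exact Hom.apply_eq_zero w x⟩
  exact (Module.Flat.lTensor_exact ℚ this y).1 hy

end Abelian

end MHS

/-! ### Full faithfulness of functors between localizations -/

section Localization

universe v₁ v₂ v₃ v₄ u₁ u₂ u₃ u₄

variable {C₁ : Type u₁} {C₂ : Type u₂} {D₁ : Type u₃} {D₂ : Type u₄} [Category.{v₁} C₁]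
  [Category.{v₂} C₂] [Category.{v₃} D₁] [Category.{v₄} D₂]

/-- A fully faithful functor induces a fully faithful functor on localizations if every morphism to
be inverted starting from its image can be prolonged into one that ends in its image. -/
lemma full_faithful_of_postcomp {Φ : C₁ ⥤ C₂} [Φ.Full] [Φ.Faithful]
    (W₁ : MorphismProperty C₁) (W₂ : MorphismProperty C₂) [W₁.HasLeftCalculusOfFractions]
    [W₂.HasLeftCalculusOfFractions] (L₁ : C₁ ⥤ D₁) (L₂ : C₂ ⥤ D₂) [L₁.IsLocalization W₁]
    [L₂.IsLocalization W₂] {G : D₁ ⥤ D₂} (e : L₁ ⋙ G ≅ Φ ⋙ L₂)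
    (hW : ∀ ⦃X Y : C₁⦄ (f : X ⟶ Y), W₂ (Φ.map f) → W₁ f)
    (h : ∀ ⦃X : C₁⦄ ⦃Y : C₂⦄ (s : Φ.obj X ⟶ Y), W₂ s →
      ∃ (Z : C₁) (t : Y ⟶ Φ.obj Z), W₂ (s ≫ t)) :
    G.Full ∧ G.Faithful := by
  have : L₁.EssSurj := Localization.essSurj L₁ W₁
  constructor
  · refine G.full_of_comp_essSurj L₁ fun X₁ X₂ φ => ?_
    obtain ⟨a, ha⟩ := Localization.exists_leftFraction L₂ W₂ (e.inv.app X₁ ≫ φ ≫ e.hom.app X₂)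
    -- The denominator of the fraction starts in the image of `Φ`. Prolonging both legs by `t` makes
    -- them end there as well, so the whole fraction lifts along the full functor `Φ`.
    obtain ⟨Z, t, ht⟩ := h a.s a.hs
    obtain ⟨f, hf⟩ := Φ.map_surjective (a.f ≫ t)
    obtain ⟨s, hs⟩ := Φ.map_surjective (a.s ≫ t)
    let b : W₁.LeftFraction X₁ X₂ := ⟨f, s, hW s (hs.symm ▸ ht)⟩
    have := Localization.inverts L₁ W₁ s b.hs
    refine ⟨b.map L₁ (Localization.inverts _ _), ?_⟩
    have ha' : e.inv.app X₁ ≫ φ ≫ e.hom.app X₂ ≫ L₂.map a.s = L₂.map a.f := by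
      have := congrArg (· ≫ L₂.map a.s) ha
      simpa using this
    have hφ : φ ≫ e.hom.app X₂ ≫ L₂.map a.s = e.hom.app X₁ ≫ L₂.map a.f := by
      rw [← ha', Iso.hom_inv_id_app_assoc]
    have n₁ := e.hom.naturality f
    have n₂ := e.hom.naturality s
    have hb : G.map (b.map L₁ (Localization.inverts _ _)) ≫ G.map (L₁.map s) =
        G.map (L₁.map f) := by
      rw [← G.map_comp]
      exact congrArg G.map (MorphismProperty.LeftFraction.map_comp_map_s b _ _)
    dsimp only [Functor.comp_obj, Functor.comp_map] at n₁ n₂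
    rw [← cancel_mono (G.map (L₁.map s)), hb, ← cancel_mono (e.hom.app _), Category.assoc, n₁, n₂,
      hs, hf, L₂.map_comp, L₂.map_comp]
    have := congrArg (· ≫ L₂.map t) hφ
    simp only [Category.assoc] at this
    exact this.symm
  · refine G.faithful_of_comp_essSurj L₁ fun X₁ X₂ a b hab => ?_
    obtain ⟨c, ha, hb⟩ := Localization.exists_leftFraction₂ L₁ W₁ a b
    have := Localization.inverts L₁ W₁ c.s c.hs
    have hca : a ≫ L₁.map c.s = L₁.map c.f := by
      rw [ha]; exact MorphismProperty.LeftFraction.map_comp_map_s c.fst _ _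
    have hcb : b ≫ L₁.map c.s = L₁.map c.f' := by
      rw [hb]; exact MorphismProperty.LeftFraction.map_comp_map_s c.snd _ _
    rw [← cancel_mono (L₁.map c.s), hca, hcb]
    have hL : L₂.map (Φ.map c.f) = L₂.map (Φ.map c.f') := by
      have n₁ := e.hom.naturality c.f
      have n₂ := e.hom.naturality c.f'
      dsimp only [Functor.comp_obj, Functor.comp_map] at n₁ n₂
      rw [← cancel_epi (e.hom.app _), ← n₁, ← n₂, ← hca, ← hcb, G.map_comp, G.map_comp, hab]
    obtain ⟨Z, s, hs, hfs⟩ := (MorphismProperty.map_eq_iff_postcomp L₂ W₂ _ _).1 hL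
    -- The denominator that equalizes the two images is prolonged until it comes from `C₁`, where
    -- faithfulness of `Φ` gives the equality.
    obtain ⟨Z', t, ht⟩ := h s hs
    obtain ⟨r, hr⟩ := Φ.map_surjective (s ≫ t)
    refine (MorphismProperty.map_eq_iff_postcomp L₁ W₁ _ _).2 ⟨Z', r, hW r (hr.symm ▸ ht), ?_⟩
    apply Φ.map_injective
    rw [Φ.map_comp, Φ.map_comp, hr, reassoc_of% hfs]

/-- A fully faithful functor induces a fully faithful functor on localizations if every morphism to
be inverted ending in its image can be prolonged into one that starts from its image. -/
lemma full_faithful_of_precomp {Φ : C₁ ⥤ C₂} [Φ.Full] [Φ.Faithful]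
    (W₁ : MorphismProperty C₁) (W₂ : MorphismProperty C₂) [W₁.HasRightCalculusOfFractions]
    [W₂.HasRightCalculusOfFractions] (L₁ : C₁ ⥤ D₁) (L₂ : C₂ ⥤ D₂) [L₁.IsLocalization W₁]
    [L₂.IsLocalization W₂] {G : D₁ ⥤ D₂} (e : L₁ ⋙ G ≅ Φ ⋙ L₂)
    (hW : ∀ ⦃X Y : C₁⦄ (f : X ⟶ Y), W₂ (Φ.map f) → W₁ f)
    (h : ∀ ⦃X : C₁⦄ ⦃Y : C₂⦄ (s : Y ⟶ Φ.obj X), W₂ s →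
      ∃ (Z : C₁) (t : Φ.obj Z ⟶ Y), W₂ (t ≫ s)) :
    G.Full ∧ G.Faithful := by
  obtain ⟨_, _⟩ := full_faithful_of_postcomp (Φ := Φ.op) W₁.op W₂.op L₁.op L₂.op (G := G.op)
    (NatIso.op e.symm) (fun X Y f hf => hW f.unop hf) (fun X Y s hs => by
      obtain ⟨Z, t, ht⟩ := h s.unop hs
      exact ⟨Opposite.op Z, t.op, ht⟩)
  have hG : G.FullyFaithful := (Functor.FullyFaithful.ofFullyFaithful G.op).unop
  exact ⟨hG.full, hG.faithful⟩

end Localization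

/-! ### The acyclic complexes among all complexes of Hodge structures -/

section Ambient

universe v v' w w'

instance {C : Type w} [Category.{v} C] [Preadditive C] {D : Type w'} [Category.{v'} D]
    [Preadditive D] (F : C ⥤ D) [F.Additive] [F.Full] [F.Faithful] : (Kb.map F).Faithful where
  map_injective {X Y f g} h := by
    ext
    exact (F.mapHomotopyCategory (ComplexShape.up ℤ)).map_injective
      (congrArg (fun k : (Kb.map F).obj X ⟶ (Kb.map F).obj Y => k.hom) h)

instance {C : Type w} [Category.{v} C] [Preadditive C] {D : Type w'} [Category.{v'} D]
    [Preadditive D] (F : C ⥤ D) [F.Additive] [F.Full] [F.Faithful] : (Kb.map F).Full where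
  map_surjective {X Y} f := ⟨ObjectProperty.homMk
    ((F.mapHomotopyCategory (ComplexShape.up ℤ)).preimage f.hom), by
      ext
      exact (F.mapHomotopyCategory (ComplexShape.up ℤ)).map_preimage f.hom⟩

variable {A : Subring ℚ} (P R : ObjectProperty (MHS.{u} A))

/-- The embedding of bounded complexes of objects of `P` in all complexes of Hodge structures. -/
noncomputable abbrev ambient :
    Kb P.FullSubcategory ⥤ HomotopyCategory (MHS.{u} A) (ComplexShape.up ℤ) :=
  (bounded P.FullSubcategory).ι ⋙ P.ι.mapHomotopyCategory (ComplexShape.up ℤ)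

lemma acyclic_eq_inverseImage :
    acyclic P = (HomotopyCategory.subcategoryAcyclic (MHS.{u} A)).inverseImage (ambient P) := by
  ext K
  exact (HomotopyCategory.quotient_obj_mem_subcategoryAcyclic_iff_acyclic _).symm

variable [MHS.IsAdditive P] [MHS.IsAdditive R]

instance : (acyclic P).IsTriangulated := by
  rw [acyclic_eq_inverseImage]
  infer_instance

variable {P}

/-- Having an acyclic cone means being a quasi-isomorphism of complexes in the abelian category MHS.
This condition does not involve `P`, so the morphisms to be inverted for nested properties
correspond. -/
lemma trW_acyclic_iff {X Y : Kb P.FullSubcategory} (f : X ⟶ Y) :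
    (acyclic P).trW f ↔
      HomotopyCategory.quasiIso (MHS.{u} A) (ComplexShape.up ℤ) ((ambient P).map f) := by
  rw [acyclic_eq_inverseImage, ObjectProperty.inverseImage_trW_iff,
    HomotopyCategory.quasiIso_eq_trW_subcategoryAcyclic]

variable {R}

instance (h : P ≤ R) : (ObjectProperty.ιOfLE h).Additive where

lemma trW_map_ιOfLE_iff (h : P ≤ R) {X Y : Kb P.FullSubcategory} (f : X ⟶ Y) :
    (acyclic R).trW ((Kb.map (ObjectProperty.ιOfLE h)).map f) ↔ (acyclic P).trW f := by
  rw [trW_acyclic_iff, trW_acyclic_iff]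
  obtain ⟨f₀, hf₀⟩ := (HomotopyCategory.quotient _ _).map_surjective f.hom
  change HomotopyCategory.quasiIso (MHS.{u} A) (ComplexShape.up ℤ)
    ((R.ι.mapHomotopyCategory _).map (((ObjectProperty.ιOfLE h).mapHomotopyCategory _).map f.hom))
    ↔ HomotopyCategory.quasiIso (MHS.{u} A) (ComplexShape.up ℤ)
    ((P.ι.mapHomotopyCategory _).map f.hom)
  rw [← hf₀]
  rfl

/-- The functor between derived categories induced by an inclusion. -/
noncomputable def Db.map (h : P ≤ R) : Db P ⥤ Db R :=
  Localization.lift (Kb.map (ObjectProperty.ιOfLE h) ⋙ Db.Q R)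
    (fun _ _ f hf => Localization.inverts (Db.Q R) (acyclic R).trW _
      ((trW_map_ιOfLE_iff h f).2 hf)) (Db.Q P)

/-- `Db.map` is induced by the inclusion. -/
noncomputable def Db.mapIso (h : P ≤ R) :
    Db.Q P ⋙ Db.map h ≅ Kb.map (ObjectProperty.ιOfLE h) ⋙ Db.Q R :=
  Localization.fac _ _ _

end Ambient

/-! ### Full faithfulness on D^b from resolutions of bounded complexes -/

section Bounded

universe v w

/-- A complex that vanishes in all but finitely many degrees. -/
def IsBounded {C : Type w} [Category.{v} C] [Preadditive C] (K : CochainComplex C ℤ) : Prop :=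
  ∃ a b : ℤ, K.IsStrictlyGE a ∧ K.IsStrictlyLE b

variable {A : Subring ℚ} {P R : ObjectProperty (MHS.{u} A)}

/-- A complex of Hodge structures with property `P` as a complex in the full subcategory. -/
noncomputable def liftComplex (K : CochainComplex (MHS.{u} A) ℤ) (hK : ∀ i, P (K.X i)) :
    CochainComplex P.FullSubcategory ℤ where
  X i := ⟨K.X i, hK i⟩
  d i j := P.homMk (K.d i j)
  shape i j h := P.ι.map_injective (K.shape i j h)
  d_comp_d' i j k _ _ := P.ι.map_injective (K.d_comp_d i j k)

lemma isZero_of_isZero_ι {X : P.FullSubcategory} (h : IsZero (P.ι.obj X)) : IsZero X := by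
  rw [IsZero.iff_id_eq_zero]
  exact P.ι.map_injective (h.eq_of_src _ _)

/-- A bounded complex of Hodge structures with property `P` as an object of `K^b`. -/
noncomputable def Kb.ofComplex (K : CochainComplex (MHS.{u} A) ℤ) (hK : ∀ i, P (K.X i))
    (hb : IsBounded K) : Kb P.FullSubcategory :=
  ⟨(HomotopyCategory.quotient _ _).obj (liftComplex K hK), by
    obtain ⟨a, b, _, _⟩ := hb
    refine ⟨a, b, ?_, ?_⟩
    · change (liftComplex K hK).IsStrictlyGE a
      rw [CochainComplex.isStrictlyGE_iff]
      exact fun i hi => isZero_of_isZero_ι (K.isZero_of_isStrictlyGE a i)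
    · change (liftComplex K hK).IsStrictlyLE b
      rw [CochainComplex.isStrictlyLE_iff]
      exact fun i hi => isZero_of_isZero_ι (K.isZero_of_isStrictlyLE b i)⟩

/-- The complex of Hodge structures underlying an object of `K^b`. -/
noncomputable abbrev Kb.complex (X : Kb P.FullSubcategory) : CochainComplex (MHS.{u} A) ℤ :=
  (P.ι.mapHomologicalComplex _).obj X.obj.as

lemma Kb.isBounded_complex (X : Kb P.FullSubcategory) : IsBounded X.complex := by
  obtain ⟨_, a, b, _, _⟩ := X
  exact ⟨a, b, inferInstanceAs (CochainComplex.IsStrictlyGE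
    ((P.ι.mapHomologicalComplex _).obj _) a), inferInstanceAs (CochainComplex.IsStrictlyLE
    ((P.ι.mapHomologicalComplex _).obj _) b)⟩

variable [MHS.IsAdditive P] [MHS.IsAdditive R]

lemma exists_quasiIso_of_trW {X Y : Kb P.FullSubcategory} {s : X ⟶ Y} (hs : (acyclic P).trW s) :
    ∃ s' : X.complex ⟶ Y.complex, QuasiIso s' := by
  obtain ⟨s', hs'⟩ := (HomotopyCategory.quotient (MHS.{u} A) (ComplexShape.up ℤ)).map_surjective
    (X := X.complex) (Y := Y.complex) ((ambient P).map s)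
  refine ⟨s', ?_⟩
  rw [trW_acyclic_iff, ← hs'] at hs
  exact (HomotopyCategory.quotient_map_mem_quasiIso_iff s').1 hs

lemma exists_trW_of_quasiIso {X Y : Kb P.FullSubcategory} (s : X.complex ⟶ Y.complex)
    (hs : QuasiIso s) : ∃ s' : X ⟶ Y, (acyclic P).trW s' := by
  obtain ⟨q, hq⟩ := (ambient P).map_surjective (X := X) (Y := Y)
    ((HomotopyCategory.quotient (MHS.{u} A) (ComplexShape.up ℤ)).map s)
  refine ⟨q, ?_⟩
  rw [trW_acyclic_iff, hq]
  exact (HomotopyCategory.quotient_map_mem_quasiIso_iff s).2 hs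

/-- Full faithfulness on derived categories when complexes of objects of `P` absorb
quasi-isomorphisms on the right. -/
lemma Db.full_faithful_map_of_postcomp (h : P ≤ R)
    (H : ∀ (K L : CochainComplex (MHS.{u} A) ℤ), (∀ i, P (K.X i)) → (∀ i, R (L.X i)) →
      IsBounded K → IsBounded L → ∀ s : K ⟶ L, QuasiIso s →
      ∃ M : CochainComplex (MHS.{u} A) ℤ, (∀ i, P (M.X i)) ∧ IsBounded M ∧
        ∃ t : L ⟶ M, QuasiIso t) :
    (Db.map h).Full ∧ (Db.map h).Faithful := by
  refine full_faithful_of_postcomp (acyclic P).trW (acyclic R).trW (Db.Q P) (Db.Q R)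
    (Db.mapIso h) (fun X Y f hf => (trW_map_ιOfLE_iff h f).1 hf) fun X Y s hs => ?_
  obtain ⟨s', hs'⟩ := exists_quasiIso_of_trW hs
  obtain ⟨M, hM, hb, t, ht⟩ := H X.complex Y.complex (fun i => (X.obj.as.X i).property)
    (fun i => (Y.obj.as.X i).property) X.isBounded_complex Y.isBounded_complex s' hs'
  obtain ⟨t', ht'⟩ := exists_trW_of_quasiIso (X := Y)
    (Y := (Kb.map (ObjectProperty.ιOfLE h)).obj (Kb.ofComplex M hM hb)) t ht
  exact ⟨_, t', (acyclic R).trW.comp_mem _ _ hs ht'⟩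

/-- Full faithfulness on derived categories when complexes of objects of `R` are resolved by
complexes of objects of `P`. -/
lemma Db.full_faithful_map_of_precomp (h : P ≤ R)
    (H : ∀ (L : CochainComplex (MHS.{u} A) ℤ), (∀ i, R (L.X i)) → IsBounded L →
      ∃ M : CochainComplex (MHS.{u} A) ℤ, (∀ i, P (M.X i)) ∧ IsBounded M ∧
        ∃ t : M ⟶ L, QuasiIso t) :
    (Db.map h).Full ∧ (Db.map h).Faithful := by
  refine full_faithful_of_precomp (acyclic P).trW (acyclic R).trW (Db.Q P) (Db.Q R)
    (Db.mapIso h) (fun X Y f hf => (trW_map_ιOfLE_iff h f).1 hf) fun X Y s hs => ?_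
  obtain ⟨M, hM, hb, t, ht⟩ := H Y.complex
    (fun i => (Y.obj.as.X i).property) Y.isBounded_complex
  obtain ⟨t', ht'⟩ := exists_trW_of_quasiIso (Y := Y)
    (X := (Kb.map (ObjectProperty.ιOfLE h)).obj (Kb.ofComplex M hM hb)) t ht
  exact ⟨_, t', (acyclic R).trW.comp_mem _ _ ht' hs⟩

end Bounded

/-- If the inclusion of `MHSOne A` factors through a full subcategory such that both inclusions
induce fully faithful functors, then `Tot A` is fully faithful. -/
lemma Tot.full_faithful_of_factorization {A : Subring ℚ} {R : ObjectProperty (MHS.{u} A)}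
    [MHS.IsAdditive R] (h₁ : MHS.one A ≤ R) (h₂ : R ≤ MHS.effective A)
    (H₁ : (Db.map h₁).Full ∧ (Db.map h₁).Faithful)
    (H₂ : (Db.map h₂).Full ∧ (Db.map h₂).Faithful) : (Tot.{u} A).Full ∧ (Tot.{u} A).Faithful := by
  obtain ⟨_, _⟩ := H₁
  obtain ⟨_, _⟩ := H₂
  let γ : Kb.map (ObjectProperty.ιOfLE h₁) ⋙ Kb.map (ObjectProperty.ιOfLE h₂) ≅ Kb.map (tot A) :=
    NatIso.ofComponents (fun X => Iso.refl _) fun {X Y} f => by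
      refine (Category.comp_id _).trans (Eq.trans ?_ (Category.id_comp _).symm)
      ext
      obtain ⟨f₀, hf₀⟩ := (HomotopyCategory.quotient _ _).map_surjective f.hom
      change ((ObjectProperty.ιOfLE h₂).mapHomotopyCategory _).map
        (((ObjectProperty.ιOfLE h₁).mapHomotopyCategory _).map f.hom) =
        ((tot A).mapHomotopyCategory _).map f.hom
      rw [← hf₀]
      rfl
  let α : Db.Q (MHS.one A) ⋙ (Db.map h₁ ⋙ Db.map h₂) ≅ Db.Q (MHS.one A) ⋙ Tot A :=
    (Functor.associator _ _ _).symm ≪≫ Functor.isoWhiskerRight (Db.mapIso h₁) _ ≪≫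
      Functor.associator _ _ _ ≪≫ Functor.isoWhiskerLeft _ (Db.mapIso h₂) ≪≫
      (Functor.associator _ _ _).symm ≪≫ Functor.isoWhiskerRight γ _ ≪≫ (Tot.square A).symm
  let β : Db.map h₁ ⋙ Db.map h₂ ≅ Tot A :=
    Localization.liftNatIso (Db.Q (MHS.one A)) (acyclic (MHS.one A)).trW _ _ _ _ α
  exact ⟨Functor.Full.of_iso β, Functor.Faithful.of_iso β⟩

/-! ### Hodge structures without the part excluded from `MHSOne` -/

section Reduced

variable {H : Type u} [AddCommGroup H] [Module ℚ H]
variable {H' : Type u} [AddCommGroup H'] [Module ℚ H']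
variable {W : ℤ → Submodule ℚ H} {F : ℤ → Submodule ℂ (ℂ ⊗[ℚ] H)}
  {W' : ℤ → Submodule ℚ H'} {F' : ℤ → Submodule ℂ (ℂ ⊗[ℚ] H')}

lemma IsFiltered.F_eq_bot_of_injective {f : H →ₗ[ℚ] H'} (hf : IsFiltered W F W' F' f)
    (hi : Function.Injective f) {p : ℤ} (h : F' p = ⊥) : F p = ⊥ := by
  rw [Submodule.eq_bot_iff]
  intro x hx
  have := hf.2 p x hx
  rw [h, Submodule.mem_bot] at this
  exact baseChange_injective_of_injective hi (this.trans (map_zero _).symm)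

lemma isFiltered_of_eq_zero {f : H →ₗ[ℚ] H'} (hf : f = 0) : IsFiltered W F W' F' f := by
  subst hf
  exact ⟨fun _ _ _ => zero_mem _, fun _ _ _ => by simp⟩

lemma IsFiltered.kappa_eq_bot_of_injective {f : H →ₗ[ℚ] H'} (hf : IsFiltered W F W' F' f)
    (hi : Function.Injective f) (h : kappa W' F' = ⊥) : kappa W F = ⊥ := by
  rw [Submodule.eq_bot_iff]
  intro x hx
  have : f x ∈ kappa W' F' := hf.kappa_le_comap hx
  rw [h, Submodule.mem_bot] at this
  exact hi (this.trans (map_zero _).symm)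

lemma IsSum.kappa_eq_bot {H₁ H₂ : Type u} [AddCommGroup H₁] [Module ℚ H₁] [AddCommGroup H₂]
    [Module ℚ H₂] {W₁ : ℤ → Submodule ℚ H₁} {F₁ : ℤ → Submodule ℂ (ℂ ⊗[ℚ] H₁)}
    {W₂ : ℤ → Submodule ℚ H₂} {F₂ : ℤ → Submodule ℂ (ℂ ⊗[ℚ] H₂)}
    {a : H →ₗ[ℚ] H₁} {b : H →ₗ[ℚ] H₂} {i : H₁ →ₗ[ℚ] H} {j : H₂ →ₗ[ℚ] H}
    (h : IsSum W F W₁ F₁ W₂ F₂ a b i j) (h₁ : kappa W₁ F₁ = ⊥) (h₂ : kappa W₂ F₂ = ⊥) :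
    kappa W F = ⊥ := by
  rw [Submodule.eq_bot_iff]
  intro x hx
  have e₁ := Submodule.mem_comap.1 (h.ha.kappa_le_comap hx)
  have e₂ := Submodule.mem_comap.1 (h.hb.kappa_le_comap hx)
  rw [h₁, Submodule.mem_bot] at e₁
  rw [h₂, Submodule.mem_bot] at e₂
  simpa [e₁, e₂] using (LinearMap.congr_fun h.total x).symm

end Reduced

namespace MHS

variable {A : Subring ℚ}

/-- Effective Hodge structures, possibly with torsion, whose `kappa` vanishes. -/
def reduced (A : Subring ℚ) : ObjectProperty (MHS.{u} A) := fun X =>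
  X.F 1 = ⊥ ∧ kappa X.W X.F = ⊥

lemma reduced_le_effective (A : Subring ℚ) : reduced.{u} A ≤ effective A := fun _ h => h.1

/-- Separates the two conditions on MHS_1, torsion-freeness and vanishing of `kappa`, which the
factorization through `reduced` treats one at a time. -/
lemma one_iff (X : MHS.{u} A) : one A X ↔ Module.IsTorsionFree A X.carrier ∧ reduced A X :=
  ⟨fun h => ⟨h.1, one_le_effective A X h, kappa_eq_bot_of_hasTypeIn X.isPolarizableMixedHodge h.2⟩,
    fun h => ⟨h.1, hasTypeIn_of_kappa_eq_bot X.isPolarizableMixedHodge h.2.1 h.2.2⟩⟩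

lemma one_le_reduced (A : Subring ℚ) : one.{u} A ≤ reduced A := fun X h => ((one_iff X).1 h).2

instance : IsAdditive (reduced.{u} A) where
  zero := by
    refine ⟨rfl, le_bot_iff.1 (kappa_le (W := (zero A).W) (F := (zero A).F) le_rfl ?_)⟩
    exact inf_le_left.trans bot_le
  prod X Y hX hY := by
    exact ⟨IsAdditive.prod (P := effective A) X Y hX.1 hY.1,
      (prod_isSum X Y).kappa_eq_bot hX.2 hY.2⟩

lemma reduced_of_injective {X Y : MHS.{u} A} (f : X ⟶ Y)
    (hf : Function.Injective ((Hom.lin f).baseChange ℚ)) (hY : reduced A Y) : reduced A X :=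
  ⟨(Hom.isFiltered f).F_eq_bot_of_injective hf hY.1,
    (Hom.isFiltered f).kappa_eq_bot_of_injective hf hY.2⟩

/-- Closure under subobjects, which keeps the kernels and cones of a resolution inside MHS_1. -/
lemma one_of_mono {X Y : MHS.{u} A} (f : X ⟶ Y) [Mono f] (hY : one A Y) : one A X := by
  have hf := (mono_iff_injective f).1 inferInstance
  rw [one_iff] at hY ⊢
  refine ⟨⟨fun r hr x y h => hf (hY.1.isSMulRegular hr ?_)⟩,
    reduced_of_injective f (baseChange_injective_of_injective hf) hY.2⟩
  change r • Hom.lin f x = r • Hom.lin f y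
  rw [← map_smul, ← map_smul]
  exact congrArg _ h

lemma effective_of_epi {X Y : MHS.{u} A} (f : X ⟶ Y) [Epi f] (hX : effective A X) :
    effective A Y := by
  have hf := baseChange_surjective_of_surjective (S := ℂ)
    (baseChange_surjective_of_surjective (S := ℚ) ((epi_iff_surjective f).1 inferInstance))
  change Y.F 1 = ⊥
  rw [Submodule.eq_bot_iff]
  intro y hy
  obtain ⟨x, rfl⟩ := hf y
  obtain ⟨a, ha, e⟩ := (Hom.isFiltered f).strict_F_top X.isPolarizableMixedHodge
    Y.isPolarizableMixedHodge hy
  rw [show X.F 1 = ⊥ from hX, Submodule.mem_bot] at ha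
  rw [← e, ha, map_zero]

/-- A quotient by a subobject containing `kappa` is reduced. -/
lemma reduced_of_epi {X Y : MHS.{u} A} (f : X ⟶ Y) [Epi f] (hX : effective A X)
    (hf : ∀ x ∈ kappa X.W X.F, (Hom.lin f).baseChange ℚ x = 0) : reduced A Y := by
  refine ⟨effective_of_epi f hX, ?_⟩
  rw [Submodule.eq_bot_iff]
  intro y hy
  obtain ⟨x, rfl⟩ := baseChange_surjective_of_surjective (S := ℚ)
    ((epi_iff_surjective f).1 inferInstance) y
  obtain ⟨x', hx', e⟩ := (Hom.isFiltered f).strict_kappa X.isPolarizableMixedHodge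
    Y.isPolarizableMixedHodge hy
  rw [← e, hf x' hx']

end MHS

/-! ### Trivial Hodge structures -/

section Trivial

variable {H : Type u} [AddCommGroup H] [Module ℚ H]

/-- The standard positive definite form of a basis. -/
noncomputable def stdForm {ι : Type*} [Fintype ι] (b : Module.Basis ι ℚ H) : LinearMap.BilinForm ℚ H :=
  ∑ i, LinearMap.BilinForm.linMulLin (b.coord i) (b.coord i)

lemma stdForm_apply {ι : Type*} [Fintype ι] (b : Module.Basis ι ℚ H) (x y : H) :
    stdForm b x y = ∑ i, b.coord i x * b.coord i y := by
  simp [stdForm, LinearMap.sum_apply]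

lemma stdForm_baseChange_apply {ι : Type*} [Fintype ι] (b : Module.Basis ι ℚ H) (x y : ℂ ⊗[ℚ] H) :
    (stdForm b).baseChange ℂ x y =
      ∑ i, (b.baseChange ℂ).coord i x * (b.baseChange ℂ).coord i y := by
  induction x with
  | zero => simp
  | add x x' hx hx' => simp only [map_add, LinearMap.add_apply, hx, hx', add_mul, Finset.sum_add_distrib]
  | tmul z v =>
    induction y with
    | zero => simp
    | add y y' hy hy' => simp only [map_add, hy, hy', mul_add, Finset.sum_add_distrib]
    | tmul w v' =>
      simp only [LinearMap.BilinForm.baseChange_tmul, stdForm_apply, Algebra.smul_def,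
        Module.Basis.coord_apply, Module.Basis.baseChange_repr_tmul, map_sum, map_mul,
        Finset.sum_mul]
      exact Finset.sum_congr rfl fun i _ => by ring

lemma coord_conj {ι : Type*} (b : Module.Basis ι ℚ H) (i : ι) (x : ℂ ⊗[ℚ] H) :
    (b.baseChange ℂ).coord i (conj H x) = starRingEnd ℂ ((b.baseChange ℂ).coord i x) := by
  induction x with
  | zero => simp
  | add x x' hx hx' => simp only [map_add, hx, hx']
  | tmul z v => simp [Algebra.smul_def]

lemma stdForm_positive {ι : Type*} [Fintype ι] (b : Module.Basis ι ℚ H) {x : ℂ ⊗[ℚ] H}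
    (hx : x ≠ 0) : ∃ r : ℝ, 0 < r ∧ (stdForm b).baseChange ℂ x (conj H x) = (r : ℂ) := by
  refine ⟨∑ i, Complex.normSq ((b.baseChange ℂ).coord i x), ?_, ?_⟩
  · refine Finset.sum_pos' (fun i _ => Complex.normSq_nonneg _) ?_
    by_contra! h
    apply hx
    refine (b.baseChange ℂ).ext_elem fun i => ?_
    have := le_antisymm (h i (Finset.mem_univ i)) (Complex.normSq_nonneg _)
    rw [map_zero]
    exact Complex.normSq_eq_zero.1 this
  · rw [stdForm_baseChange_apply]
    push_cast
    exact Finset.sum_congr rfl fun i _ => by rw [coord_conj, Complex.mul_conj]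

/-- The weight filtration of a structure of weight `0`. -/
noncomputable def trivialW (H : Type u) [AddCommGroup H] [Module ℚ H] (n : ℤ) : Submodule ℚ H :=
  if 0 ≤ n then ⊤ else ⊥

/-- The Hodge filtration of a structure of type `(0, 0)`. -/
noncomputable def trivialF (H : Type u) [AddCommGroup H] [Module ℚ H] (p : ℤ) :
    Submodule ℂ (ℂ ⊗[ℚ] H) :=
  if p ≤ 0 then ⊤ else ⊥

lemma subsingleton_gr_trivial {n : ℤ} (hn : n ≠ 0) :
    Subsingleton (ℂ ⊗[ℚ] Gr (trivialW H) n) := by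
  have h : trivialW H n ≤ trivialW H (n - 1) := by
    unfold trivialW
    split_ifs <;> first | exact le_rfl | exact bot_le | omega
  refine ⟨fun x y => ?_⟩
  obtain ⟨x, rfl⟩ := mkQ_baseChange_surjective _ n x
  obtain ⟨y, rfl⟩ := mkQ_baseChange_surjective _ n y
  have h0 : ((trivialW H (n - 1)).submoduleOf (trivialW H n)).mkQ = 0 :=
    LinearMap.ext fun x => (Submodule.Quotient.mk_eq_zero _).2 (h x.2)
  rw [h0]
  simp

lemma grF_trivial_of_nonpos {n p : ℤ} (hp : p ≤ 0) :
    grF (trivialW H) (trivialF H) n p = ⊤ := grF_eq_top (if_pos hp)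

lemma grF_trivial_of_pos {n p : ℤ} (hp : 0 < p) :
    grF (trivialW H) (trivialF H) n p = ⊥ :=
  grF_eq_bot (by rw [trivialF, if_neg (by omega), bot_inf_eq])

lemma isPolarizableMixedHodge_trivial [Module.Finite ℚ H] :
    IsPolarizableMixedHodge (trivialW H) (trivialF H) where
  W_mono m n h := by
    unfold trivialW
    split_ifs <;> first | exact le_rfl | exact bot_le | omega
  W_bot := ⟨-1, if_neg (by norm_num)⟩
  W_top := ⟨0, if_pos le_rfl⟩
  F_anti m n h := by
    unfold trivialF
    split_ifs <;> first | exact le_rfl | exact bot_le | omega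
  F_bot := ⟨1, if_neg (by norm_num)⟩
  F_top := ⟨0, if_pos le_rfl⟩
  pure n p := by
    rcases eq_or_ne n 0 with rfl | hn
    · rcases le_or_gt p 0 with hp | hp
      · rw [grF_trivial_of_nonpos hp, grF_trivial_of_pos (by omega), conjSubspace_bot]
        exact isCompl_top_bot
      · rw [grF_trivial_of_pos hp, grF_trivial_of_nonpos (by omega), conjSubspace_top]
        exact isCompl_bot_top
    · have := subsingleton_gr_trivial (H := H) hn
      exact ⟨Submodule.disjoint_def.2 fun x _ _ => Subsingleton.elim _ _,
        codisjoint_iff.2 (Subsingleton.elim _ _)⟩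
  polarizable n := by
    rcases eq_or_ne n 0 with rfl | hn
    · refine ⟨stdForm (Module.finBasis ℚ _), fun x y => ?_, fun p x hx y hy => ?_,
        fun p x hx hx0 => ?_⟩
      · rw [zpow_zero, one_mul, stdForm_apply, stdForm_apply]
        exact Finset.sum_congr rfl fun i _ => mul_comm _ _
      · rcases le_or_gt p 0 with hp | hp
        · rw [grF_trivial_of_pos (by omega), Submodule.mem_bot] at hy
          rw [hy, map_zero]
        · rw [grF_trivial_of_pos hp, Submodule.mem_bot] at hx
          rw [hx, map_zero, LinearMap.zero_apply]
      · have hp : p = 0 := by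
          by_contra hp
          apply hx0
          rcases lt_or_gt_of_ne hp with hp | hp
          · have := hx.2
            rw [grF_trivial_of_pos (by omega), conjSubspace_bot] at this
            exact this
          · have := hx.1
            rw [grF_trivial_of_pos hp] at this
            exact this
        subst hp
        simpa using stdForm_positive _ hx0
    · have := subsingleton_gr_trivial (H := H) hn
      have h0 : Subsingleton (Gr (trivialW H) n) := by
        refine ⟨fun x y => ?_⟩
        have : Function.Injective (TensorProduct.mk ℚ ℂ (Gr (trivialW H) n) 1) :=
          Module.FaithfullyFlat.tensorProduct_mk_injective _
        exact this (Subsingleton.elim _ _)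
      exact ⟨0, fun x y => by simp, fun p x _ y _ => by simp,
        fun p x _ hx => absurd (Subsingleton.elim x 0) hx⟩

lemma hasTypeIn_trivial : HasTypeIn (trivialW H) (trivialF H) MHS.oneTypes := by
  intro n p hne
  rcases eq_or_ne n 0 with rfl | hn
  · rcases lt_trichotomy p 0 with hp | rfl | hp
    · refine absurd ?_ hne
      rw [hodgePiece, grF_trivial_of_pos (p := 0 - p) (by omega), conjSubspace_bot, inf_bot_eq]
    · simp [MHS.oneTypes]
    · refine absurd ?_ hne
      rw [hodgePiece, grF_trivial_of_pos hp, bot_inf_eq]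
  · have := subsingleton_gr_trivial (H := H) hn
    exact absurd (Subsingleton.elim _ _) hne

end Trivial

namespace MHS

variable {A : Subring ℚ}

/-- The Hodge structure of type `(0, 0)` on a finitely generated module. -/
noncomputable def trivial (A : Subring ℚ) (M : Type u) [AddCommGroup M] [Module A M]
    [Module.Finite A M] : MHS.{u} A where
  carrier := M
  W := trivialW _
  F := trivialF _
  isPolarizableMixedHodge := isPolarizableMixedHodge_trivial

lemma one_trivial (M : Type u) [AddCommGroup M] [Module A M]
    [Module.Finite A M] [Module.IsTorsionFree A M] : one A (trivial A M) :=
  ⟨inferInstanceAs (Module.IsTorsionFree A M), hasTypeIn_trivial⟩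

lemma baseChange_eq_zero_of_forall_mem_torsion {M N : Type*} [AddCommGroup M] [Module A M]
    [AddCommGroup N] [Module A N] (f : M →ₗ[A] N) (hf : ∀ x, f x ∈ Submodule.torsion A N) :
    f.baseChange ℚ = 0 := by
  ext x
  simpa using one_tmul_eq_zero_iff.2 (hf x)

/-- Every reduced Hodge structure is a quotient of an object of `MHSOne`. -/
lemma exists_epi_of_reduced (X : MHS.{u} A) (hX : reduced A X) :
    ∃ (Y : MHS.{u} A) (f : Y ⟶ X), one A Y ∧ Epi f := by
  let T := Submodule.torsion A X.carrier
  -- The quotient by the torsion is finitely generated and torsion-free over a principal ideal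
  -- domain; being free, it has a section `s`, which is an isomorphism over ℚ and transports the
  -- Hodge structure.
  have : Module.Free A (X.carrier ⧸ T) := inferInstance
  obtain ⟨s, hs⟩ := Module.projective_lifting_property T.mkQ LinearMap.id T.mkQ_surjective
  have hs' : ∀ x, T.mkQ (s x) = x := fun x => LinearMap.congr_fun hs x
  have hinj : Function.Injective s := fun x y h => by rw [← hs' x, ← hs' y, h]
  have hrange : LinearMap.range (s.baseChange ℚ) = LinearMap.range ((Hom.lin (𝟙 X)).baseChange ℚ) := by
    rw [Hom.lin_id, LinearMap.baseChange_id, LinearMap.range_id, eq_top_iff]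
    intro x _
    obtain ⟨r, m, -, rfl⟩ := exists_smul_eq_one_tmul x
    refine Submodule.smul_mem _ _ ⟨1 ⊗ₜ T.mkQ m, ?_⟩
    rw [LinearMap.baseChange_tmul, ← sub_eq_zero, ← TensorProduct.tmul_sub, one_tmul_eq_zero_iff,
      ← Submodule.Quotient.mk_eq_zero, Submodule.Quotient.mk_sub, sub_eq_zero]
    exact hs' _
  have hK : IsHodgeSub X.W X.F (LinearMap.range (s.baseChange ℚ)) :=
    hrange ▸ (Hom.isFiltered (𝟙 X)).isHodgeSub_range X.isPolarizableMixedHodge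
      X.isPolarizableMixedHodge
  have hsQ : Function.Injective (s.baseChange ℚ) := baseChange_injective_of_injective hinj
  let S : MHS.{u} A := X.sub s hsQ hK
  have hS : one A S := (one_iff S).2
    ⟨inferInstanceAs (Module.IsTorsionFree A (X.carrier ⧸ T)),
      reduced_of_injective (X.subι s hsQ hK) hsQ hX⟩
  -- The torsion is covered by a free module of type (0,0). A map into torsion vanishes over ℚ, so
  -- it respects all filtrations.
  obtain ⟨n, g, hg⟩ := Module.Finite.exists_fin' A T
  let M := ULift.{u} (Fin n → A)
  let t : M →ₗ[A] X.carrier := T.subtype ∘ₗ g ∘ₗ ULift.moduleEquiv.toLinearMap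
  have ht : t.baseChange ℚ = 0 :=
    baseChange_eq_zero_of_forall_mem_torsion t fun x => (g x.down).2
  have : Module.Free A M := Module.Free.of_equiv ULift.moduleEquiv.symm
  let τ : trivial A M ⟶ X := Hom.mk t (isFiltered_of_eq_zero ht)
  refine ⟨prod S (trivial A M), (prodBicone S (trivial A M)).fst ≫ X.subι s hsQ hK +
    (prodBicone S (trivial A M)).snd ≫ τ, IsAdditive.prod _ _ hS (one_trivial M),
    epi_of_surjective _ fun x => ?_⟩
  have hx : x - s (T.mkQ x) ∈ T := by
    rw [← Submodule.Quotient.mk_eq_zero, Submodule.Quotient.mk_sub, sub_eq_zero]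
    exact (hs' _).symm
  obtain ⟨m, hm⟩ := hg ⟨_, hx⟩
  refine ⟨(T.mkQ x, ULift.up m), ?_⟩
  change s (T.mkQ x) + (g m : X.carrier) = x
  rw [hm, add_sub_cancel]

end MHS

/-! ### Resolutions of bounded complexes -/

section Complexes

universe v w

open CochainComplex HomComplex HomologicalComplex ZeroObject

variable {C : Type w} [Category.{v} C] [Abelian C]

lemma IsBounded.mappingCone {K L : CochainComplex C ℤ} (hK : IsBounded K) (hL : IsBounded L)
    (f : K ⟶ L) : IsBounded (mappingCone f) := by
  obtain ⟨a₁, b₁, _, _⟩ := hK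
  obtain ⟨a₂, b₂, _, _⟩ := hL
  refine ⟨min (a₁ - 1) a₂, max (b₁ - 1) b₂,
    CochainComplex.isStrictlyGE_mappingCone f a₁ a₂ _ (by simp) (by simp), ?_⟩
  rw [CochainComplex.isStrictlyLE_iff]
  intro i hi
  rw [max_lt_iff] at hi
  rw [mappingCone.isZero_X_iff]
  exact ⟨K.isZero_of_isStrictlyLE b₁ _ (by lia), L.isZero_of_isStrictlyLE b₂ _ (by lia)⟩

lemma IsBounded.of_isZero {K L : CochainComplex C ℤ} (hL : IsBounded L)
    (h : ∀ i, IsZero (L.X i) → IsZero (K.X i)) : IsBounded K := by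
  obtain ⟨a, b, _, _⟩ := hL
  refine ⟨a, b, ?_, ?_⟩
  · rw [CochainComplex.isStrictlyGE_iff]
    exact fun i hi => h i (L.isZero_of_isStrictlyGE a i)
  · rw [CochainComplex.isStrictlyLE_iff]
    exact fun i hi => h i (L.isZero_of_isStrictlyLE b i)

/-- The complex with zero differentials and objects `Y (p - 1)`. -/
noncomputable def zeroComplex (Y : ℤ → C) : CochainComplex C ℤ where
  X p := Y (p + -1)
  d _ _ := 0

lemma isBounded_zeroComplex {L : CochainComplex C ℤ} (hL : IsBounded L) {Y : ℤ → C}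
    (h : ∀ i, IsZero (L.X i) → IsZero (Y i)) : IsBounded (zeroComplex Y) := by
  obtain ⟨a, b, _, _⟩ := hL
  refine ⟨a + 1, b + 1, ?_, ?_⟩
  · rw [CochainComplex.isStrictlyGE_iff]
    exact fun i hi => h _ (L.isZero_of_isStrictlyGE a _ (by lia))
  · rw [CochainComplex.isStrictlyLE_iff]
    exact fun i hi => h _ (L.isZero_of_isStrictlyLE b _ (by lia))

/-- Morphisms to the objects of a complex as a cochain on `zeroComplex`. -/
noncomputable def zeroComplexCochain {L : CochainComplex C ℤ} {Y : ℤ → C} (y : ∀ i, Y i ⟶ L.X i) :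
    Cochain (zeroComplex Y) L (-1) :=
  Cochain.mk fun p _ hpq => y (p + -1) ≫ eqToHom (congrArg L.X hpq)

/-- The map from the cone over the identity of `zeroComplex Y` that is induced by maps from `Y` to
the objects of a complex. -/
noncomputable def zeroComplexConeDesc {L : CochainComplex C ℤ} {Y : ℤ → C}
    (y : ∀ i, Y i ⟶ L.X i) : mappingCone (𝟙 (zeroComplex Y)) ⟶ L :=
  mappingCone.desc _ (zeroComplexCochain y)
    -- The cone is taken over an identity, so the second component has to be the coboundary of the
    -- first.
    (Cocycle.homOf (Cocycle.mk (δ (-1) 0 (zeroComplexCochain y)) 1 (by norm_num)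
      (δ_δ _ _ _ _))) (by simp)

/-- In degree `q` the cone has the summand of `zeroComplex Y` in degree `q + 1`, which by the shift
in its definition is `Y q`; on that summand the map is `y q`. -/
instance {L : CochainComplex C ℤ} {Y : ℤ → C} (y : ∀ i, Y i ⟶ L.X i) [∀ i, Epi (y i)] :
    Epi (zeroComplexConeDesc y) := by
  refine epi_of_epi_f _ fun q => ?_
  have h := mappingCone.inl_v_desc_f (𝟙 (zeroComplex Y)) (zeroComplexCochain y)
    (Cocycle.homOf (Cocycle.mk (δ (-1) 0 (zeroComplexCochain y)) 1 (by norm_num)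
      (δ_δ _ _ _ _))) (by simp) (q + 1) q (by ring)
  have : Epi ((zeroComplexCochain y).v (q + 1) q (by ring)) :=
    inferInstanceAs (Epi (y (q + 1 + -1) ≫ eqToHom _))
  exact epi_of_epi_fac h

instance {K L : CochainComplex C ℤ} (f : K ⟶ L) (i : ℤ) : Mono ((kernel.ι f).f i) :=
  inferInstanceAs (Mono ((HomologicalComplex.eval C _ i).map (kernel.ι f)))

instance {K L : CochainComplex C ℤ} (f : K ⟶ L) (i : ℤ) : Epi ((cokernel.π f).f i) :=
  inferInstanceAs (Epi ((HomologicalComplex.eval C _ i).map (cokernel.π f)))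

lemma shortExact_kernel {K L : CochainComplex C ℤ} (f : K ⟶ L) [Epi f] :
    (ShortComplex.mk (kernel.ι f) f (kernel.condition f)).ShortExact where
  exact := ShortComplex.exact_of_f_is_kernel _ (kernelIsKernel f)

lemma shortExact_cokernel {K L : CochainComplex C ℤ} (f : K ⟶ L) [Mono f] :
    (ShortComplex.mk f (cokernel.π f) (cokernel.condition f)).ShortExact where
  exact := ShortComplex.exact_of_g_is_cokernel _ (cokernelIsCokernel f)

/-- The quotient by an acyclic subcomplex is a quasi-isomorphism. -/
lemma quasiIso_of_shortExact {S : ShortComplex (CochainComplex C ℤ)} (hS : S.ShortExact)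
    (h : S.X₁.Acyclic) : QuasiIso S.g := by
  let S₀ : ShortComplex (CochainComplex C ℤ) := ShortComplex.mk (0 : 0 ⟶ S.X₂) (𝟙 _) (by simp)
  let φ : S₀ ⟶ S := { τ₁ := 0, τ₂ := 𝟙 _, τ₃ := S.g, comm₁₂ := (Limits.isZero_zero _).eq_of_src _ _ }
  have hS₀ : S₀.ShortExact := (ShortComplex.Splitting.ofIsZeroOfIsIso S₀
    (Limits.isZero_zero _) (by dsimp [S₀]; infer_instance)).shortExact
  refine HomologySequence.quasiIso_τ₃ φ hS₀ hS ?_ (by dsimp [φ]; infer_instance)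
  rw [quasiIso_iff]
  intro i
  refine (quasiIsoAt_iff_exactAt _ i ?_).2 (h i)
  rw [exactAt_iff_isZero_homology]
  exact (HomologicalComplex.homologyFunctor C _ i).map_isZero (Limits.isZero_zero _)

end Complexes

/-! ### Resolutions of reduced complexes by objects of MHS_1 -/

namespace MHS

variable {A : Subring ℚ}

open CochainComplex

/-- Each term of the cone embeds in the explicit direct sum, so closure under sums and subobjects
suffices. -/
lemma one_mappingCone {K L : CochainComplex (MHS.{u} A) ℤ} (f : K ⟶ L) (hK : ∀ i, one A (K.X i))
    (hL : ∀ i, one A (L.X i)) (i : ℤ) : one A ((mappingCone f).X i) := by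
  let B := prodBicone (K.X (i + 1)) (L.X i)
  let l : (mappingCone f).X i ⟶ B.pt := (mappingCone.fst f).1.v i (i + 1) rfl ≫ B.inl +
    (mappingCone.snd f).v i i (add_zero i) ≫ B.inr
  have : Mono l := ⟨fun a b hab => by
    rw [mappingCone.ext_to_iff _ i (i + 1) rfl]
    constructor
    · simpa [l] using congrArg (· ≫ B.fst) hab
    · simpa [l] using congrArg (· ≫ B.snd) hab⟩
  exact one_of_mono l (IsAdditive.prod _ _ (hK _) (hL _))

/-- Bounded complexes of reduced Hodge structures are resolved by complexes in `MHSOne`. -/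
lemma exists_resolution_of_reduced (L : CochainComplex (MHS.{u} A) ℤ)
    (hL : ∀ i, reduced A (L.X i)) (hb : IsBounded L) :
    ∃ M : CochainComplex (MHS.{u} A) ℤ, (∀ i, one A (M.X i)) ∧ IsBounded M ∧
      ∃ t : M ⟶ L, QuasiIso t := by
  -- Zero terms are covered by zero, so that the resolution stays bounded.
  have hY : ∀ i, ∃ (Y : MHS.{u} A) (f : Y ⟶ L.X i), one A Y ∧ Epi f ∧
      (IsZero (L.X i) → IsZero Y) := by
    intro i
    by_cases hi : IsZero (L.X i)
    · exact ⟨zero A, 0, IsAdditive.zero, ⟨fun _ _ _ => hi.eq_of_src _ _⟩, fun _ => isZero_zero A⟩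
    · obtain ⟨Y, f, hY, hf⟩ := exists_epi_of_reduced _ (hL i)
      exact ⟨Y, f, hY, hf, fun h => absurd h hi⟩
  choose Y y hY hy hY0 using hY
  have hZ := isBounded_zeroComplex hb hY0
  let p := zeroComplexConeDesc y
  have hD : ∀ i, one A ((mappingCone (𝟙 (zeroComplex Y))).X i) :=
    one_mappingCone _ (fun i => hY _) (fun i => hY _)
  have hDb : IsBounded (mappingCone (𝟙 (zeroComplex Y))) := hZ.mappingCone hZ _
  have hR : ∀ i, one A ((kernel p).X i) := fun i => one_of_mono ((kernel.ι p).f i) (hD i)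
  have hRb : IsBounded (kernel p) := hDb.of_isZero fun i h => h.of_mono ((kernel.ι p).f i)
  -- The surjection `p` has its kernel in MHS_1, and the cone of the kernel inclusion is
  -- quasi-isomorphic to the cokernel `L`.
  exact ⟨mappingCone (kernel.ι p), one_mappingCone _ hR hD, hRb.mappingCone hDb _,
    mappingCone.descShortComplex (ShortComplex.mk (kernel.ι p) p (kernel.condition p)),
    mappingCone.quasiIso_descShortComplex (shortExact_kernel p)⟩

end MHS

lemma Db.full_faithful_map_one_reduced (A : Subring ℚ) :
    (Db.map (MHS.one_le_reduced.{u} A)).Full ∧ (Db.map (MHS.one_le_reduced.{u} A)).Faithful :=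
  Db.full_faithful_map_of_precomp _ MHS.exists_resolution_of_reduced

namespace MHS

variable {A : Subring ℚ}

/-! ### Integral `kappa` -/

/-- The elements of `V_A` whose image in `V_ℚ` lies in `kappa`. -/
noncomputable def kappaInt (V : MHS.{u} A) : Submodule A V.carrier :=
  ((kappa V.W V.F).restrictScalars A).comap (TensorProduct.mk A ℚ V.carrier 1)

lemma mem_kappaInt {V : MHS.{u} A} {x : V.carrier} :
    x ∈ V.kappaInt ↔ (1 : ℚ) ⊗ₜ[A] x ∈ kappa V.W V.F := Iff.rfl

lemma map_mem_kappaInt {V V' : MHS.{u} A} (f : V ⟶ V') {x : V.carrier} (hx : x ∈ V.kappaInt) :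
    Hom.lin f x ∈ V'.kappaInt := by
  rw [mem_kappaInt, ← LinearMap.baseChange_tmul]
  exact (Hom.isFiltered f).kappa_le_comap hx

lemma exists_smul_one_tmul_of_mem_kappa {V : MHS.{u} A} {y : ℚ ⊗[A] V.carrier}
    (hy : y ∈ kappa V.W V.F) : ∃ (r : ℚ), ∃ x ∈ V.kappaInt, y = r • (1 : ℚ) ⊗ₜ[A] x := by
  obtain ⟨r, x, hr, rfl⟩ := exists_smul_eq_one_tmul y
  exact ⟨r, x, ((kappa V.W V.F).smul_mem_iff hr).1 hy, rfl⟩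

lemma range_baseChange_subtype_eq_kappa {V : MHS.{u} A} {N : Submodule A V.carrier}
    (h₁ : N ≤ V.kappaInt)
    (h₂ : ∀ x ∈ V.kappaInt, (1 : ℚ) ⊗ₜ[A] x ∈ LinearMap.range (N.subtype.baseChange ℚ)) :
    LinearMap.range (N.subtype.baseChange ℚ) = kappa V.W V.F := by
  apply le_antisymm
  · rintro _ ⟨y, rfl⟩
    obtain ⟨r, x, -, rfl⟩ := exists_smul_eq_one_tmul y
    rw [map_smul]
    exact Submodule.smul_mem _ _ (h₁ x.2)
  · intro y hy
    obtain ⟨r, x, hx, rfl⟩ := exists_smul_one_tmul_of_mem_kappa hy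
    exact Submodule.smul_mem _ _ (h₂ x hx)

/-- A submodule that maps isomorphically, up to torsion, to the image of `K` under `f`. -/
lemma exists_submodule_injOn {M N : Type*} [AddCommGroup M] [Module A M] [Module.Finite A M]
    [AddCommGroup N] [Module A N] [Module.Finite A N] (f : M →ₗ[A] N) (K : Submodule A M) :
    ∃ C ≤ K, (∀ x ∈ C, f x = 0 → x = 0) ∧
      ∀ x ∈ K, ∃ c ∈ C, f (x - c) ∈ Submodule.torsion A N := by
  let T := Submodule.torsion A N
  let g : K →ₗ[A] N ⧸ T := T.mkQ ∘ₗ f ∘ₗ K.subtype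
  -- The image of `K` modulo torsion is torsion-free, hence free; the submodule sought is the image
  -- of a section of `g` over it.
  have : Module.Free A (LinearMap.range g) := inferInstance
  obtain ⟨s, hs⟩ := Module.projective_lifting_property g.rangeRestrict LinearMap.id
    g.surjective_rangeRestrict
  have hs' : ∀ x, g (s x) = x := fun x => congrArg Subtype.val (LinearMap.congr_fun hs x)
  refine ⟨(LinearMap.range s).map K.subtype, ?_, ?_, ?_⟩
  · rintro _ ⟨x, -, rfl⟩
    exact x.2
  · rintro _ ⟨_, ⟨x, rfl⟩, rfl⟩ hx
    have : x = 0 := Subtype.ext (by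
      rw [← hs' x]
      exact (Submodule.Quotient.mk_eq_zero _).2 (hx.symm ▸ zero_mem _))
    rw [this, map_zero, map_zero]
  · intro x hx
    refine ⟨_, ⟨_, ⟨g.rangeRestrict ⟨x, hx⟩, rfl⟩, rfl⟩, ?_⟩
    rw [← Submodule.Quotient.mk_eq_zero, map_sub, Submodule.Quotient.mk_sub, sub_eq_zero]
    exact (hs' (g.rangeRestrict ⟨x, hx⟩)).symm

/-! ### Exactness of complexes of Hodge structures -/

open CochainComplex HomologicalComplex

lemma exactAt_iff_exists (K : CochainComplex (MHS.{u} A) ℤ) {i j k : ℤ} (hij : i + 1 = j)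
    (hjk : j + 1 = k) :
    K.ExactAt j ↔ ∀ y, Hom.lin (K.d j k) y = 0 → ∃ x, Hom.lin (K.d i j) x = y := by
  rw [K.exactAt_iff' i j k (by simp; omega) (by simp; omega)]
  exact exact_iff _

lemma acyclic_mappingCone {K L : CochainComplex (MHS.{u} A) ℤ} (s : K ⟶ L) [_root_.QuasiIso s] :
    (mappingCone s).Acyclic := by
  rw [← HomotopyCategory.quotient_obj_mem_subcategoryAcyclic_iff_acyclic]
  refine ((HomotopyCategory.subcategoryAcyclic _).trW_iff_of_distinguished _
    (HomotopyCategory.mappingCone_triangleh_distinguished s)).1 ?_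
  rw [← HomotopyCategory.quasiIso_eq_trW_subcategoryAcyclic]
  exact (HomotopyCategory.quotient_map_mem_quasiIso_iff s).2 ‹_›

/-- If a complex is quasi-isomorphic to a complex without `kappa`, then its `kappa` is exact. -/
lemma exists_mem_kappa_of_quasiIso {K L : CochainComplex (MHS.{u} A) ℤ} (s : K ⟶ L)
    [_root_.QuasiIso s] (hK : ∀ i, kappa (K.X i).W (K.X i).F = ⊥) {i j k : ℤ} (hij : i + 1 = j) (hjk : j + 1 = k)
    {y : ℚ ⊗[A] (L.X j).carrier} (hy : y ∈ kappa (L.X j).W (L.X j).F)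
    (hdy : (Hom.lin (L.d j k)).baseChange ℚ y = 0) :
    ∃ x ∈ kappa (L.X i).W (L.X i).F, (Hom.lin (L.d i j)).baseChange ℚ x = y := by
  -- The cycle `y` of `L` is a cycle of the acyclic cone, hence a boundary. Strictness of `kappa`
  -- for the differential of the cone yields a primitive `w` in `kappa`; its component in K lies in
  -- `kappa` of K, which is zero, so its component in L is a primitive of `y`.
  have hex := (exactAt_iff_exists _ hij hjk).1 (acyclic_mappingCone s j)
  have hinr : (Hom.lin ((mappingCone s).d j k)).baseChange ℚ
      ((Hom.lin ((mappingCone.inr s).f j)).baseChange ℚ y) = 0 := by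
    rw [comp_baseChange (mappingCone.inr_f_d s j k), ← comp_baseChange rfl, hdy, map_zero]
  obtain ⟨z, hz⟩ := exact_baseChange ((mappingCone s).d_comp_d i j k) hex _ hinr
  have hk := (Hom.isFiltered ((mappingCone.inr s).f j)).kappa_le_comap hy
  rw [Submodule.mem_comap, ← hz] at hk
  obtain ⟨w, hw, e⟩ := (Hom.isFiltered ((mappingCone s).d i j)).strict_kappa
    (MHS.isPolarizableMixedHodge _) (MHS.isPolarizableMixedHodge _) hk
  rw [hz] at e
  have hfst := (Hom.isFiltered ((mappingCone.fst s).1.v i j hij)).kappa_le_comap hw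
  rw [hK, Submodule.mem_comap, Submodule.mem_bot] at hfst
  refine ⟨_, (Hom.isFiltered ((mappingCone.snd s).v i i (add_zero i))).kappa_le_comap hw, ?_⟩
  have hsnd := congrArg ((Hom.lin ((mappingCone.snd s).v j j (add_zero j))).baseChange ℚ) e
  rw [comp_baseChange (mappingCone.inr_f_snd_v s j), comp_baseChange (mappingCone.d_snd_v s i j hij),
    Hom.lin_id, LinearMap.baseChange_id, Hom.lin_add, LinearMap.baseChange_add,
    LinearMap.add_apply, ← comp_baseChange rfl, hfst, map_zero, zero_add] at hsnd
  rw [comp_baseChange rfl]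
  exact hsnd

/-- The subcomplex defined by submodules that are sub-Hodge structures rationally. -/
noncomputable def subComplex (L : CochainComplex (MHS.{u} A) ℤ)
    (N : ∀ i, Submodule A (L.X i).carrier)
    (hN : ∀ i, IsHodgeSub (L.X i).W (L.X i).F (LinearMap.range ((N i).subtype.baseChange ℚ)))
    (hd : ∀ i j, ∀ x ∈ N i, Hom.lin (L.d i j) x ∈ N j) : CochainComplex (MHS.{u} A) ℤ where
  X i := (L.X i).sub (N i).subtype
    (baseChange_injective_of_injective (N i).injective_subtype) (hN i)
  d i j := Hom.mk ((Hom.lin (L.d i j)).restrict (hd i j))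
    (isFiltered_of_comp_injective ((L.X j).subι (N j).subtype
      (baseChange_injective_of_injective (N j).injective_subtype) (hN j))
      (baseChange_injective_of_injective (N j).injective_subtype) _
      (Hom.isFiltered ((L.X i).subι (N i).subtype
        (baseChange_injective_of_injective (N i).injective_subtype) (hN i) ≫ L.d i j)))
  shape i j h := hom_ext (LinearMap.ext fun x => Subtype.ext
    (LinearMap.congr_fun (congrArg Hom.lin (L.shape i j h)) x.1))
  d_comp_d' i j k _ _ := hom_ext (LinearMap.ext fun x => Subtype.ext
    (LinearMap.congr_fun (congrArg Hom.lin (L.d_comp_d i j k)) x.1))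

section SubComplex

variable (L : CochainComplex (MHS.{u} A) ℤ) (N : ∀ i, Submodule A (L.X i).carrier)
  (hN : ∀ i, IsHodgeSub (L.X i).W (L.X i).F (LinearMap.range ((N i).subtype.baseChange ℚ)))
  (hd : ∀ i j, ∀ x ∈ N i, Hom.lin (L.d i j) x ∈ N j)

/-- The inclusion of a subcomplex. -/
noncomputable def subComplexι : subComplex L N hN hd ⟶ L where
  f i := (L.X i).subι (N i).subtype
    (baseChange_injective_of_injective (N i).injective_subtype) (hN i)

instance : Mono (subComplexι L N hN hd) :=
  mono_of_mono_f _ fun i => mono_of_injective _ (N i).injective_subtype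

lemma subComplex_acyclic
    (h : ∀ i, ∀ x ∈ N i, Hom.lin (L.d i (i + 1)) x = 0 →
      ∃ y ∈ N (i - 1), Hom.lin (L.d (i - 1) i) y = x) :
    (subComplex L N hN hd).Acyclic := fun i => by
  rw [exactAt_iff_exists _ (sub_add_cancel i 1) rfl]
  intro x hx
  obtain ⟨y, hy, e⟩ := h i x.1 x.2 (congrArg Subtype.val hx)
  exact ⟨⟨y, hy⟩, Subtype.ext e⟩

end SubComplex

/-- A complex of effective Hodge structures quasi-isomorphic to a reduced one has a quasi-isomorphic
reduced quotient. -/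
lemma exists_reduced_quotient {K L : CochainComplex (MHS.{u} A) ℤ} (hK : ∀ i, reduced A (K.X i))
    (hL : ∀ i, effective A (L.X i)) (hb : IsBounded L) (s : K ⟶ L) (hs : QuasiIso s) :
    ∃ M : CochainComplex (MHS.{u} A) ℤ, (∀ i, reduced A (M.X i)) ∧ IsBounded M ∧
      ∃ t : L ⟶ M, QuasiIso t := by
  -- The complex `kappaInt` is acyclic over ℚ but may have torsion cohomology over `A`. It is
  -- replaced by N = dC + C, where `C` lies in `kappaInt`, the differential is injective on `C`, and
  -- dC exhausts d(kappaInt) up to torsion.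
  choose C hCK hC0 hCt using fun i =>
    exists_submodule_injOn (Hom.lin (L.d i (i + 1))) (L.X i).kappaInt
  let N : ∀ i, Submodule A (L.X i).carrier := fun i =>
    (C (i - 1)).map (Hom.lin (L.d (i - 1) i)) ⊔ C i
  have hdd : ∀ i j k x, Hom.lin (L.d j k) (Hom.lin (L.d i j) x) = 0 := fun i j k x =>
    Hom.apply_eq_zero (L.d_comp_d i j k) x
  have hCi : ∀ i j, i + 1 = j → ∀ x ∈ C i, Hom.lin (L.d i j) x ∈ N j := by
    rintro i j hij x hx
    obtain rfl : i = j - 1 := by omega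
    exact Submodule.mem_sup_left ⟨x, hx, rfl⟩
  have hd : ∀ i j, ∀ x ∈ N i, Hom.lin (L.d i j) x ∈ N j := by
    intro i j x hx
    by_cases hij : i + 1 = j
    · obtain ⟨_, ⟨c, -, rfl⟩, c', hc', rfl⟩ := Submodule.mem_sup.1 hx
      rw [map_add, hdd, zero_add]
      exact hCi i j hij c' hc'
    · rw [L.shape i j hij]
      exact zero_mem _
  have hNk : ∀ i, N i ≤ (L.X i).kappaInt := fun i => by
    refine sup_le ?_ (hCK i)
    rintro _ ⟨x, hx, rfl⟩
    exact map_mem_kappaInt _ (hCK _ hx)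
  have mem_range : ∀ i, ∀ x ∈ N i, (1 : ℚ) ⊗ₜ[A] x ∈
      LinearMap.range ((N i).subtype.baseChange ℚ) := fun i x hx => ⟨1 ⊗ₜ ⟨x, hx⟩, rfl⟩
  have hCd : ∀ i j, i + 1 = j → ∀ x ∈ (L.X i).kappaInt, ∃ c ∈ C i,
      (1 : ℚ) ⊗ₜ[A] Hom.lin (L.d i j) (x - c) = 0 := by
    rintro i _ rfl x hx
    obtain ⟨c, hc, h⟩ := hCt i x hx
    exact ⟨c, hc, one_tmul_eq_zero_iff.2 h⟩
  have hNQ : ∀ i, LinearMap.range ((N i).subtype.baseChange ℚ) = kappa (L.X i).W (L.X i).F := by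
    intro i
    refine range_baseChange_subtype_eq_kappa (hNk i) fun x hx => ?_
    obtain ⟨c, hc, hxc⟩ := hCd i _ rfl x hx
    -- Rationally `x - c` is a cycle, so it is the differential of some `v` in `kappa`. Up to a
    -- scalar `v` is integral and may be replaced by an element of `C` without changing its
    -- differential over ℚ, so `x` lies in the span of N.
    obtain ⟨v, hv, e⟩ := exists_mem_kappa_of_quasiIso s (fun i => (hK i).2)
      (sub_add_cancel i 1) rfl (y := (1 : ℚ) ⊗ₜ[A] (x - c)) (sub_mem hx (hCK i hc)) hxc
    obtain ⟨r, x', hx', rfl⟩ := exists_smul_one_tmul_of_mem_kappa hv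
    obtain ⟨c', hc', hxc'⟩ := hCd (i - 1) i (sub_add_cancel i 1) x' hx'
    rw [map_smul, LinearMap.baseChange_tmul] at e
    rw [map_sub, TensorProduct.tmul_sub, sub_eq_zero] at hxc'
    rw [hxc', TensorProduct.tmul_sub, eq_sub_iff_add_eq] at e
    rw [← e]
    exact add_mem (Submodule.smul_mem _ _ (mem_range i _ (hCi _ _ (sub_add_cancel i 1) c' hc')))
      (mem_range i _ (Submodule.mem_sup_right hc))
  have hN : ∀ i, IsHodgeSub (L.X i).W (L.X i).F
      (LinearMap.range ((N i).subtype.baseChange ℚ)) := fun i => by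
    rw [hNQ]
    exact (L.X i).isPolarizableMixedHodge.isHodgeSub_kappa (hL i)
  have hac : (subComplex L N hN hd).Acyclic := by
    refine subComplex_acyclic L N hN hd fun i x hx hdx => ?_
    -- The differential of dc + c' is dc', and it is injective on `C`; so the cycles of N are the
    -- elements dc, each bounded by `c` in N.
    obtain ⟨_, ⟨c, hc, rfl⟩, c', hc', rfl⟩ := Submodule.mem_sup.1 hx
    rw [map_add, hdd, zero_add] at hdx
    rw [hC0 i c' hc' hdx, add_zero]
    exact ⟨c, Submodule.mem_sup_right hc, rfl⟩
  let j := subComplexι L N hN hd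
  refine ⟨cokernel j, fun i => reduced_of_epi ((cokernel.π j).f i) (hL i) fun x hx => ?_,
    hb.of_isZero fun i h => h.of_epi ((cokernel.π j).f i), cokernel.π j,
    quasiIso_of_shortExact (shortExact_cokernel j) hac⟩
  rw [← hNQ i] at hx
  obtain ⟨y, rfl⟩ := hx
  have h0 : j.f i ≫ (cokernel.π j).f i = 0 := by
    rw [← comp_f, cokernel.condition, zero_f]
  refine (comp_baseChange h0 y).trans ?_
  rw [Hom.lin_zero, LinearMap.baseChange_zero]
  rfl

end MHS

lemma Db.full_faithful_map_reduced_effective (A : Subring ℚ) :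
    (Db.map (MHS.reduced_le_effective.{u} A)).Full ∧
      (Db.map (MHS.reduced_le_effective.{u} A)).Faithful :=
  Db.full_faithful_map_of_postcomp _ fun _ _ hK hL _ hb s hs =>
    MHS.exists_reduced_quotient hK hL hb s hs

/-- `Tot` is fully faithful for every ring of coefficients. -/
lemma Tot.full_faithful (A : Subring ℚ) : (Tot.{u} A).Full ∧ (Tot.{u} A).Faithful :=
  Tot.full_faithful_of_factorization (MHS.one_le_reduced A) (MHS.reduced_le_effective A)
    (Db.full_faithful_map_one_reduced A) (Db.full_faithful_map_reduced_effective A)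

/-! ### The left adjoint of the inclusion, for rational coefficients -/

lemma isTorsionFree_top (M : Type*) [AddCommGroup M] [Module (⊤ : Subring ℚ) M] :
    Module.IsTorsionFree (⊤ : Subring ℚ) M where
  isSMulRegular r hr x y h := by
    have hr0 : (r : ℚ) ≠ 0 := fun h0 => hr.ne_zero (Subtype.ext h0)
    have hs : (⟨(r : ℚ)⁻¹, trivial⟩ : (⊤ : Subring ℚ)) * r = 1 :=
      Subtype.ext (inv_mul_cancel₀ hr0)
    have := congrArg ((⟨(r : ℚ)⁻¹, trivial⟩ : (⊤ : Subring ℚ)) • ·) h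
    simpa only [smul_smul, hs, one_smul] using this

lemma one_tmul_injective {A : Subring ℚ} {M : Type*} [AddCommGroup M] [Module A M]
    [Module.IsTorsionFree A M] : Function.Injective (TensorProduct.mk A ℚ M 1) := by
  rw [injective_iff_map_eq_zero]
  intro x hx
  have h : x ∈ Submodule.torsion A M := one_tmul_eq_zero_iff.1 hx
  rwa [Submodule.isTorsionFree_iff_torsion_eq_bot.1 ‹_›, Submodule.mem_bot] at h

namespace MHS

section Reduction

variable {A : Subring ℚ} (V : MHS.{u} A) (hV : effective A V)

lemma range_kappaInt : LinearMap.range (V.kappaInt.subtype.baseChange ℚ) = kappa V.W V.F :=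
  range_baseChange_subtype_eq_kappa le_rfl fun x hx => ⟨1 ⊗ₜ ⟨x, hx⟩, rfl⟩

include hV in
lemma isHodgeSub_kappaInt :
    IsHodgeSub V.W V.F (LinearMap.range (V.kappaInt.subtype.baseChange ℚ)) := by
  rw [range_kappaInt]
  exact V.isPolarizableMixedHodge.isHodgeSub_kappa hV

/-- The inclusion of the sub-Hodge structure `kappa`. -/
noncomputable def kappaι : V.sub V.kappaInt.subtype
    (baseChange_injective_of_injective V.kappaInt.injective_subtype)
    (isHodgeSub_kappaInt V hV) ⟶ V :=
  V.subι _ _ _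

lemma cokerπ_kappaι_eq_zero_iff (x : V.carrier) :
    Hom.lin (cokerπ (kappaι V hV)) x = 0 ↔ x ∈ V.kappaInt := by
  refine (Submodule.Quotient.mk_eq_zero _).trans ⟨?_, fun h => ⟨⟨x, h⟩, rfl⟩⟩
  rintro ⟨y, rfl⟩
  exact y.2

lemma reduced_coker_kappaι : reduced A (coker (kappaι V hV)) := by
  refine reduced_of_epi (cokerπ (kappaι V hV)) hV fun x hx => ?_
  obtain ⟨r, z, hz, rfl⟩ := exists_smul_one_tmul_of_mem_kappa hx
  rw [map_smul, LinearMap.baseChange_tmul, (cokerπ_kappaι_eq_zero_iff V hV z).2 hz,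
    TensorProduct.tmul_zero, smul_zero]

variable {V}

lemma mem_kappaInt_iff_eq_zero {N : MHS.{u} A} (hN : one A N) {x : N.carrier} :
    x ∈ N.kappaInt ↔ x = 0 := by
  have := hN.1
  rw [mem_kappaInt, ((one_iff N).1 hN).2.2, Submodule.mem_bot]
  exact map_eq_zero_iff (TensorProduct.mk A ℚ N.carrier 1) one_tmul_injective

/-- Morphisms preserve `kappaInt`, and for a torsion-free target with vanishing `kappa` the
submodule `kappaInt` is zero because V_A embeds in V_ℚ. -/
lemma kappaι_comp {N : MHS.{u} A} (hN : one A N) (q : V ⟶ N) : kappaι V hV ≫ q = 0 :=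
  hom_ext (LinearMap.ext fun x => (mem_kappaInt_iff_eq_zero hN).1 (map_mem_kappaInt q x.2))

end Reduction

/-- Rationally, morphisms are strict for `kappaInt`. -/
lemma exists_mem_kappaInt {X Y : MHS.{u} (⊤ : Subring ℚ)} (f : X ⟶ Y) {x : X.carrier}
    (hx : Hom.lin f x ∈ Y.kappaInt) : ∃ z ∈ X.kappaInt, Hom.lin f z = Hom.lin f x := by
  rw [mem_kappaInt, ← LinearMap.baseChange_tmul] at hx
  obtain ⟨y, hy, e⟩ := (Hom.isFiltered f).strict_kappa X.isPolarizableMixedHodge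
    Y.isPolarizableMixedHodge hx
  obtain ⟨r, z, hz, rfl⟩ := exists_smul_one_tmul_of_mem_kappa hy
  -- Over ℚ the scalar `r` acts on the module itself, so the preimage in V_ℚ is already one in V.
  refine ⟨(⟨r, Subring.mem_top r⟩ : (⊤ : Subring ℚ)) • z, Submodule.smul_mem _ _ hz, ?_⟩
  have := isTorsionFree_top Y.carrier
  refine one_tmul_injective (A := ⊤) ?_
  change (1 : ℚ) ⊗ₜ Hom.lin f _ = (1 : ℚ) ⊗ₜ Hom.lin f _
  rw [← LinearMap.baseChange_tmul, ← LinearMap.baseChange_tmul, ← e, TensorProduct.tmul_smul,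
    TensorProduct.smul_tmul', TensorProduct.smul_tmul']
  rfl

end MHS

open MHS

/-- The maximal quotient in `MHSOne` of an effective rational Hodge structure. -/
noncomputable def lalbObj (V : MHSEff.{u} ⊤) : MHSOne.{u} ⊤ :=
  ⟨coker (kappaι V.obj V.property), (one_iff _).2 ⟨isTorsionFree_top _, reduced_coker_kappaι _ _⟩⟩

/-- The projection to the maximal quotient. -/
noncomputable def lalbπ (V : MHSEff.{u} ⊤) : V ⟶ (tot ⊤).obj (lalbObj V) :=
  ObjectProperty.homMk (cokerπ (kappaι V.obj V.property))

/-- The universal property of the maximal quotient. -/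
noncomputable def lalbEquiv (V : MHSEff.{u} ⊤) (N : MHSOne.{u} ⊤) :
    (lalbObj V ⟶ N) ≃ (V ⟶ (tot ⊤).obj N) where
  toFun f := lalbπ V ≫ (tot ⊤).map f
  invFun q := ObjectProperty.homMk ((cokerIsColimit (kappaι V.obj V.property)).desc
    (CokernelCofork.ofπ q.hom (kappaι_comp V.property N.property q.hom)))
  left_inv f := by
    ext
    refine (cancel_epi (cokerπ (kappaι V.obj V.property))).1 ?_
    exact (cokerIsColimit (kappaι V.obj V.property)).fac _ WalkingParallelPair.one
  right_inv q := by
    ext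
    exact (cokerIsColimit (kappaι V.obj V.property)).fac _ WalkingParallelPair.one

lemma lalbEquiv_naturality (V : MHSEff.{u} ⊤) (N N' : MHSOne.{u} ⊤) (g : N ⟶ N')
    (h : lalbObj V ⟶ N) : lalbEquiv V N' (h ≫ g) = lalbEquiv V N h ≫ (tot ⊤).map g := by
  change lalbπ V ≫ (tot ⊤).map (h ≫ g) = (lalbπ V ≫ (tot ⊤).map h) ≫ (tot ⊤).map g
  rw [Functor.map_comp, Category.assoc]

/-- The left adjoint of the inclusion of `MHSOne ⊤` in `MHSEff ⊤`. -/
noncomputable def lalb : MHSEff.{u} ⊤ ⥤ MHSOne.{u} ⊤ :=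
  Adjunction.leftAdjointOfEquiv lalbEquiv lalbEquiv_naturality

/-- The adjunction between `lalb` and the inclusion. -/
noncomputable def lalbAdj : lalb.{u} ⊣ tot ⊤ :=
  Adjunction.adjunctionOfEquivLeft lalbEquiv lalbEquiv_naturality

instance : lalb.{u}.Additive := lalbAdj.left_adjoint_additive

lemma lalbAdj_unit_app (V : MHSEff.{u} ⊤) : lalbAdj.unit.app V = lalbπ V := by
  have : lalbAdj.unit.app V = lalbEquiv V (lalbObj V) (𝟙 _) :=
    Adjunction.adjunctionOfEquivLeft_unit_app lalbEquiv lalbEquiv_naturality V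
  rw [this]
  change lalbπ V ≫ (tot ⊤).map (𝟙 _) = lalbπ V
  rw [CategoryTheory.Functor.map_id, Category.comp_id]

lemma epi_lalbπ (V : MHSEff.{u} ⊤) : Epi (lalbπ V) where
  left_cancellation g h e := by
    ext
    exact (cancel_epi (cokerπ (kappaι V.obj V.property))).1
      (congrArg (fun k : V ⟶ _ => k.hom) e)

lemma isMaximalQuotient_lalbAdj_unit (V : MHSEff.{u} ⊤) :
    IsMaximalQuotient (lalbAdj.unit.app V) := by
  rw [lalbAdj_unit_app]
  exact ⟨epi_lalbπ V, fun N' q _ => ⟨(lalbEquiv V N').symm q, (lalbEquiv V N').right_inv q⟩⟩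

/-! ### Exactness of `lalb` -/

section Elements

variable {V V' V'' : MHSEff.{u} ⊤}

/-- The quotient map on elements. -/
noncomputable def lalbMk (V : MHSEff.{u} ⊤) : V.obj.carrier →ₗ[(⊤ : Subring ℚ)]
    (lalb.obj V).obj.carrier := Hom.lin (lalbπ V).hom

lemma lalbMk_surjective : Function.Surjective (lalbMk V) := Submodule.mkQ_surjective _

lemma lalbMk_eq_zero_iff {x : V.obj.carrier} : lalbMk V x = 0 ↔ x ∈ V.obj.kappaInt :=
  cokerπ_kappaι_eq_zero_iff V.obj V.property x

lemma lalb_map_mk (f : V ⟶ V') (x : V.obj.carrier) :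
    Hom.lin (lalb.map f).hom (lalbMk V x) = lalbMk V' (Hom.lin f.hom x) := by
  have := lalbAdj.unit.naturality f
  rw [lalbAdj_unit_app, lalbAdj_unit_app] at this
  exact (LinearMap.congr_fun (congrArg (fun k : V ⟶ _ => Hom.lin k.hom) this) x).symm

lemma lalb_map_injective (f : V ⟶ V') (hf : Function.Injective (Hom.lin f.hom)) :
    Function.Injective (Hom.lin (lalb.map f).hom) := by
  rw [injective_iff_map_eq_zero]
  intro y hy
  obtain ⟨x, rfl⟩ := lalbMk_surjective y
  rw [lalb_map_mk, lalbMk_eq_zero_iff] at hy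
  obtain ⟨z, hz, e⟩ := exists_mem_kappaInt f.hom hy
  rw [lalbMk_eq_zero_iff, ← hf e]
  exact hz

lemma lalb_map_surjective (f : V ⟶ V') (hf : Function.Surjective (Hom.lin f.hom)) :
    Function.Surjective (Hom.lin (lalb.map f).hom) := by
  intro y
  obtain ⟨y, rfl⟩ := lalbMk_surjective y
  obtain ⟨x, rfl⟩ := hf y
  exact ⟨lalbMk V x, lalb_map_mk f x⟩

/-- A representative of a class killed by `g` maps into `kappaInt`. Strictness corrects it by an
element of `kappaInt`, which does not change the class, to an element of the kernel of `g`. -/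
lemma lalb_map_exact (f : V ⟶ V') (g : V' ⟶ V'')
    (h : ∀ y, Hom.lin g.hom y = 0 → ∃ x, Hom.lin f.hom x = y) (y : (lalb.obj V').obj.carrier)
    (hy : Hom.lin (lalb.map g).hom y = 0) : ∃ x, Hom.lin (lalb.map f).hom x = y := by
  obtain ⟨y, rfl⟩ := lalbMk_surjective y
  rw [lalb_map_mk, lalbMk_eq_zero_iff] at hy
  obtain ⟨z, hz, e⟩ := exists_mem_kappaInt g.hom hy
  obtain ⟨x, hx⟩ := h (y - z) (by rw [map_sub, e, sub_self])
  refine ⟨lalbMk V x, ?_⟩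
  rw [lalb_map_mk, hx, map_sub, lalbMk_eq_zero_iff.2 hz, sub_zero]

end Elements

lemma isExact_lalb : IsExact lalb.{u} := fun S hS => by
  have h₁ := (MHS.mono_iff_injective _).1 hS.mono_f
  have h₂ := (MHS.epi_iff_surjective _).1 hS.epi_g
  have h₃ := (exact_iff _).1 hS.exact
  exact
    { exact := (exact_iff _).2 (lalb_map_exact S.f S.g h₃)
      mono_f := mono_of_injective _ (lalb_map_injective S.f h₁)
      epi_g := epi_of_surjective _ (lalb_map_surjective S.g h₂) }

lemma acyclic_map_lalb (K : Kb (MHSEff.{u} ⊤)) (hK : acyclic (effective ⊤) K) :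
    acyclic (one ⊤) ((Kb.map lalb).obj K) := fun i => by
  have h := (exactAt_iff_exists _ (sub_add_cancel i 1) rfl).1 (hK i)
  exact (exactAt_iff_exists _ (sub_add_cancel i 1) rfl).2
    (lalb_map_exact (K.obj.as.d (i - 1) i) (K.obj.as.d i (i + 1)) h)

lemma trW_map_lalb :
    (acyclic (effective.{u} ⊤)).trW.IsInvertedBy (Kb.map lalb ⋙ Db.Q (one ⊤)) := by
  intro X Y f hf
  obtain ⟨Z, g, h, hT, hZ⟩ := hf
  have h' := (Kb.map lalb).map_distinguished _ hT
  exact Localization.inverts (Db.Q (one ⊤)) (acyclic (one ⊤)).trW _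
    (ObjectProperty.trW.mk _ h' (acyclic_map_lalb Z hZ))

/-- The functor on derived categories induced by `lalb`. -/
noncomputable def LAlb : Db (effective.{u} ⊤) ⥤ Db (one.{u} ⊤) :=
  Localization.lift (Kb.map lalb ⋙ Db.Q (one ⊤)) trW_map_lalb (Db.Q (effective ⊤))

/-- `LAlb` is computed degree by degree. -/
noncomputable def LAlb.square :
    Db.Q (effective.{u} ⊤) ⋙ LAlb ≅ Kb.map lalb ⋙ Db.Q (one ⊤) :=
  Localization.fac (Kb.map lalb ⋙ Db.Q (one ⊤)) trW_map_lalb (Db.Q (effective ⊤))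

/-! ### Adjunctions between homotopy categories -/

section HomotopyAdjunction

universe v v' w w'

variable {C : Type w} [Category.{v} C] [Preadditive C] {D : Type w'} [Category.{v'} D]
  [Preadditive D] {F : C ⥤ D} {G : D ⥤ C} [F.Additive] [G.Additive]

/-- The map `F(G(K)) ⟶ K` which is `ε` in each degree. -/
noncomputable def Kb.counitApp (ε : G ⋙ F ⟶ 𝟭 D) (K : Kb D) :
    (Kb.map F).obj ((Kb.map G).obj K) ⟶ K :=
  (bounded D).homMk ((HomotopyCategory.quotient D (ComplexShape.up ℤ)).map
    (show (F.mapHomologicalComplex _).obj ((G.mapHomologicalComplex _).obj K.obj.as) ⟶ K.obj.as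
      from
      { f := fun n => ε.app (K.obj.as.X n)
        comm' := fun i j _ => (ε.naturality (K.obj.as.d i j)).symm }))

/-- An adjunction between additive functors induces an adjunction on homotopy categories. -/
noncomputable def Kb.adjunction (adj : F ⊣ G) : Kb.map F ⊣ Kb.map G where
  unit :=
    { app := Kb.unitApp adj.unit
      naturality := fun K L f => by
        ext
        obtain ⟨f₀, hf₀⟩ := (HomotopyCategory.quotient C (ComplexShape.up ℤ)).map_surjective f.hom
        change f.hom ≫ _ = _ ≫ (G.mapHomotopyCategory _).map ((F.mapHomotopyCategory _).map f.hom)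
        rw [← hf₀]
        refine ((HomotopyCategory.quotient C _).map_comp _ _).symm.trans (Eq.trans ?_
          ((HomotopyCategory.quotient C _).map_comp _ _))
        congr 1
        ext n
        exact adj.unit.naturality (f₀.f n) }
  counit :=
    { app := Kb.counitApp adj.counit
      naturality := fun K L f => by
        ext
        obtain ⟨f₀, hf₀⟩ := (HomotopyCategory.quotient D (ComplexShape.up ℤ)).map_surjective f.hom
        change (F.mapHomotopyCategory _).map ((G.mapHomotopyCategory _).map f.hom) ≫ _ = _ ≫ f.hom
        rw [← hf₀]
        refine ((HomotopyCategory.quotient D _).map_comp _ _).symm.trans (Eq.trans ?_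
          ((HomotopyCategory.quotient D _).map_comp _ _))
        congr 1
        ext n
        exact adj.counit.naturality (f₀.f n) }
  left_triangle_components K := by
    ext
    refine ((HomotopyCategory.quotient D _).map_comp _ _).symm.trans (Eq.trans ?_
      ((HomotopyCategory.quotient D _).map_id _))
    congr 1
    ext n
    exact adj.left_triangle_components (K.obj.as.X n)
  right_triangle_components K := by
    ext
    refine ((HomotopyCategory.quotient C _).map_comp _ _).symm.trans (Eq.trans ?_
      ((HomotopyCategory.quotient C _).map_id _))
    congr 1
    ext n
    exact adj.right_triangle_components (K.obj.as.X n)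

/-- Complexes concentrated in degree `0` are preserved by additive functors. -/
noncomputable def Kb.mapSingleIso [HasZeroObject C] [HasZeroObject D] (F : C ⥤ D) [F.Additive]
    (X : C) : (Kb.map F).obj ((Kb.single C).obj X) ≅ (Kb.single D).obj (F.obj X) :=
  (bounded D).ι.preimageIso ((HomotopyCategory.quotient D (ComplexShape.up ℤ)).mapIso
    ((HomologicalComplex.singleMapHomologicalComplex F (ComplexShape.up ℤ) 0).app X))

end HomotopyAdjunction

/-! ### The derived adjunction and t-exactness -/

noncomputable instance : CatCommSq (Kb.map lalb.{u}) (Db.Q (effective ⊤)) (Db.Q (one ⊤)) LAlb :=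
  ⟨LAlb.square.symm⟩

noncomputable instance : CatCommSq (Kb.map (tot.{u} ⊤)) (Db.Q (one ⊤)) (Db.Q (effective ⊤))
    (Tot ⊤) := ⟨(Tot.square ⊤).symm⟩

/-- The adjunction on derived categories induced by the adjunction of `lalb` and the inclusion. -/
noncomputable def LAlb.adj : LAlb.{u} ⊣ Tot ⊤ :=
  (Kb.adjunction lalbAdj).localization (Db.Q (effective ⊤)) (acyclic (effective ⊤)).trW
    (Db.Q (one ⊤)) (acyclic (one ⊤)).trW LAlb (Tot ⊤)

lemma LAlb.adj_unit_app (K : Kb (MHSEff.{u} ⊤)) :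
    LAlb.adj.unit.app ((Db.Q (effective ⊤)).obj K) ≫ (Tot ⊤).map (LAlb.square.hom.app K) ≫
        (Tot.square ⊤).hom.app ((Kb.map lalb).obj K) =
      (Db.Q (effective ⊤)).map (Kb.unitApp lalbAdj.unit K) := by
  have h : LAlb.adj.unit.app ((Db.Q (effective ⊤)).obj K) =
      (Db.Q (effective ⊤)).map (Kb.unitApp lalbAdj.unit K) ≫
        (Tot.square ⊤).inv.app ((Kb.map lalb).obj K) ≫ (Tot ⊤).map (LAlb.square.inv.app K) :=
    (Kb.adjunction lalbAdj).localization_unit_app (Db.Q (effective ⊤)) (acyclic (effective ⊤)).trW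
      (Db.Q (one ⊤)) (acyclic (one ⊤)).trW LAlb (Tot ⊤) K
  have e : (Tot ⊤).map (LAlb.square.inv.app K) ≫ (Tot ⊤).map (LAlb.square.hom.app K) = 𝟙 _ := by
    rw [← Functor.map_comp, Iso.inv_hom_id_app, CategoryTheory.Functor.map_id]
  rw [h, Category.assoc, Category.assoc, reassoc_of% e]
  exact (congrArg (_ ≫ ·) ((Tot.square ⊤).inv_hom_id_app _)).trans (Category.comp_id _)

/-- Applying `lalb` termwise to a representing complex creates no new nonzero degrees. -/
lemma LAlb.isTExact : IsTExact LAlb.{u} := by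
  refine fun X n => ⟨?_, ?_⟩
  · rintro ⟨K, _, ⟨e⟩⟩
    exact ⟨(Kb.map lalb).obj K, inferInstanceAs (CochainComplex.IsStrictlyLE
      ((lalb.mapHomologicalComplex _).obj K.obj.as) n),
      ⟨LAlb.square.symm.app K ≪≫ LAlb.mapIso e⟩⟩
  · rintro ⟨K, _, ⟨e⟩⟩
    exact ⟨(Kb.map lalb).obj K, inferInstanceAs (CochainComplex.IsStrictlyGE
      ((lalb.mapHomologicalComplex _).obj K.obj.as) n),
      ⟨LAlb.square.symm.app K ≪≫ LAlb.mapIso e⟩⟩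

end HodgeAlbanese

theorem proposition3p1 :
    -- full faithfulness, for every ring of coefficients `ℤ ⊂ A ⊂ ℚ`
    (∀ A : Subring ℚ, (Tot.{u} A).Full ∧ (Tot.{u} A).Faithful) ∧
    -- the left adjoint, for `A = ℚ`
    ∃ (lalb : MHSEff.{u} ⊤ ⥤ MHSOne.{u} ⊤) (_ : lalb.Additive) (adj : lalb ⊣ tot ⊤)
      (LAlb : Db (MHS.effective.{u} ⊤) ⥤ Db (MHS.one.{u} ⊤)) (Adj : LAlb ⊣ Tot ⊤)
      (square : Db.Q (MHS.effective.{u} ⊤) ⋙ LAlb ≅ Kb.map lalb ⋙ Db.Q (MHS.one ⊤)),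
      -- `lalb` is exact and sends `V` to its maximal quotient of the prescribed type
      IsExact lalb ∧
      (∀ V : MHSEff.{u} ⊤, IsMaximalQuotient (adj.unit.app V)) ∧
      -- the adjunction `LAlb ⊣ Tot` is induced by `lalb ⊣ tot`
      (∀ K : Kb (MHSEff.{u} ⊤),
        Adj.unit.app ((Db.Q (MHS.effective ⊤)).obj K) ≫ (Tot ⊤).map (square.hom.app K) ≫
            (Tot.square ⊤).hom.app ((Kb.map lalb).obj K) =
          (Db.Q (MHS.effective ⊤)).map (Kb.unitApp adj.unit K)) ∧
      -- `t`-exactness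
      (∀ M : MHSEff.{u} ⊤, Nonempty (LAlb.obj ((Db.single (MHS.effective ⊤)).obj M) ≅
        (Db.single (MHS.one ⊤)).obj (lalb.obj M))) ∧
      IsTExact LAlb := by
  refine ⟨fun A => Tot.full_faithful A, lalb, inferInstance, lalbAdj, LAlb, LAlb.adj, LAlb.square,
    isExact_lalb, isMaximalQuotient_lalbAdj_unit, LAlb.adj_unit_app, fun M => ⟨?_⟩, LAlb.isTExact⟩
  exact LAlb.square.app ((Kb.single (MHSEff ⊤)).obj M) ≪≫
    (Db.Q (MHS.one ⊤)).mapIso (Kb.mapSingleIso lalb M)
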